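/- Let $n\in\mathbb N$, $0<T<\infty$, let $\Lambda\subset\mathbb R$ and $\Omega\subset\mathbb R^n$ be open, $f:\Lambda\times\Omega\times[0,T]\to\mathbb R^n$, $g:\Omega\times[0,T]\to\mathbb R^n$, and let $h:[0,T]\to\mathbb R$ have bounded variation and be left-continuous on $(0,T]$. Let $\|\cdot\|$ be the Euclidean norm on $\mathbb R^n$ and the operator norm on $n\times n$ matrices (other norms give the same statement). Let $G[0,T]$ be the space of regulated functions $x:[0,T]\to\mathbb R^n$ (i.e. with finite one-sided limits $x(t-)$, $t\in(0,T]$, and $x(t+)$, $t\in[0,T)$) with the supremum norm $\|\cdot\|_\infty$, and let $B(x_0,\rho)$ be the closed ball in $G[0,T]$. Integrals with respect to $h$ and to $v(t)=\mathrm{var}_0^t h$ are Kurzweil--Stieltjes integrals. Primes with index $x$ denote total differentials with respect to $x$. **Solutions.** Consider the periodic problem $$Dx=f(\lambda,x,t)+g(x,t)\,.\,Dh,\qquad x(0)=x(T).\tag{P}$$ A pair $(x,\lambda)$ with $\lambda\in\Lambda$ and $x:[0,T]\to\mathbb R^n$ is a solution of (P) if $x$ has bounded variation, is left-continuous on $(0,T]$,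 $x(t)\in\Omega$ for all $t\in[0,T]$, $t\mapsto f(\lambda,x(t),t)$ is Lebesgue integrable, the integral $H(t)=\int_0^t g(x(s),s)\,dh(s)$ exists for $t\in[0,T]$, the identity $Dx=f(\lambda,x(\cdot),\cdot)+DH$ holds in the sense of distributions, i.e. when tested with all $C^\infty$ functions $\varphi:\mathbb R\to\mathbb R^n$ vanishing outside $(0,T)$, the jump relation $x(0+)=x(0)+g(x(0),0)\,(h(0+)-h(0))$ holds at the initial point, and $x(0)=x(T)$. **Assumptions.** 1. For $\lambda\in\Lambda$, $x\in\Omega$, $t\in[0,T]$: $f(\lambda,\cdot,t)$ is continuous on $\Omega$, $f(\lambda,x,\cdot)$ is Lebesgue measurable, and $\|f(\lambda,x,t)\|\le m(t)$ for a Lebesgue integrable $m:[0,T]\to[0,\infty)$ independent of $\lambda,x$. 2. $g(\cdot,t)$ is continuous on $\Omega$ for each $t\in[0,T]$, and $\|g(x,t)\|\le m_h(t)$ on $\Omega\times[0,T]$ for some $m_h:[0,T]\to[0,\infty)$ for which $\int_0^T m_h\,dv$ exists (and is finite). 3. $f'_x(\lambda,x,t)$ exists for all $(\lambda,x,t)\in\Lambda\times\Omega\times[0,T]$,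 is continuous in $x\in\Omega$ for fixed $\lambda,t$, and $\|f'_x(\lambda,x,t)\|\le\Theta(t)$ for some Lebesgue integrable $\Theta$. 4. $g'_x(x,t)$ exists for all $(x,t)\in\Omega\times[0,T]$, is bounded on $\Omega\times[0,T]$, is continuous in $x\in\Omega$ for fixed $t$, and $\|g'_x(x,t)\|\le\Theta_h(t)$ for some $\Theta_h:[0,T]\to\mathbb R$ for which $\int_0^T\Theta_h\,dv$ exists (and is finite). 5. $x_0\in G[0,T]$, $(x_0,\lambda)$ is a solution of (P) for every $\lambda\in\Lambda$, and $\rho>0$ is such that $x(t)\in\Omega$ for all $x\in B(x_0,\rho)$ and $t\in[0,T]$. 6. There is a nondecreasing $\gamma:[0,T]\to\mathbb R$ such that for every $\varepsilon>0$ there is $\delta>0$ with $$\Big\|\int_s^t[f(\lambda_2,x,r)-f(\lambda_1,x,r)]\,dr\Big\|\le\varepsilon\,|\gamma(t)-\gamma(s)|$$ for all $x\in\Omega$, $s,t\in[0,T]$ and $\lambda_1,\lambda_2\in\Lambda$ with $|\lambda_1-\lambda_2|<\delta$. 7. There is a nondecreasing $\widetilde\gamma:[0,T]\to\mathbb R$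 such that for every $\varepsilon>0$ there is $\delta>0$ such that, for all $s,t\in[0,T]$, $x,y\in\Omega$, $\lambda_1,\lambda_2\in\Lambda$ with $|\lambda_1-\lambda_2|+\|x-y\|<\delta$, the second integral below exists and $$\Big\|\int_s^t[f'_x(\lambda_1,x,r)-f'_x(\lambda_2,y,r)]\,dr+\int_s^t[g'_x(x,r)-g'_x(y,r)]\,dh(r)\Big\|\le\varepsilon\,|\widetilde\gamma(t)-\widetilde\gamma(s)|.$$ **Bifurcation.** Let $\lambda_0\in\Lambda$ be such that $(x_0,\lambda_0)$ is a bifurcation point of (P): every neighbourhood of $(x_0,\lambda_0)$ in $B(x_0,\rho)\times\Lambda$ contains a solution $(x,\lambda)$ of (P) with $x\neq x_0$. **Conclusion.** There exists $q\in G[0,T]$ such that the equation $$z(t)-z(T)-\int_0^t f'_x(\lambda_0,x_0(\tau),\tau)\,z(\tau)\,d\tau-\int_0^t g'_x(x_0(\tau),\tau)\,z(\tau)\,dh(\tau)=q(t),\qquad t\in[0,T],$$ has no solution $z\in G[0,T]$ (a solution being a $z$ for which all the integrals exist and the equality holds), and the corresponding homogeneous equation (with $q=0$) has at least one solution $z\in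 G[0,T]$ that is not identically zero. -/

import Mathlib

open Set Filter Topology MeasureTheory
open scoped ContDiff

noncomputable section

namespace MeasureDE

/-- `x` is regulated on `[a, b]`: it has a finite left limit at each point of `(a, b]` and a finite
right limit at each point of `[a, b)`. Functions on `[a, b]` are represented by functions on `ℝ`
of which only the values on `[a, b]` matter. -/
def RegulatedOn {F : Type*} [TopologicalSpace F] (x : ℝ → F) (a b : ℝ) : Prop :=
  (∀ t ∈ Ioc a b, ∃ l, Tendsto x (𝓝[<] t) (𝓝 l)) ∧
  (∀ t ∈ Ico a b, ∃ l, Tendsto x (𝓝[>] t) (𝓝 l))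

/-- Tagged partitions `a = t₀ ≤ t₁ ≤ … ≤ t_m = b` of `[a, b]` with tags `τ_j ∈ [t_j, t_{j+1}]`. -/
structure TaggedDivision (a b : ℝ) where
  m : ℕ
  pt : ℕ → ℝ
  tag : ℕ → ℝ
  pt_zero : pt 0 = a
  pt_last : pt m = b
  tag_mem : ∀ j < m, tag j ∈ Icc (pt j) (pt (j + 1))

/-- The tagged partition is `δ`-fine. -/
def TaggedDivision.IsFine {a b : ℝ} (P : TaggedDivision a b) (δ : ℝ → ℝ) : Prop :=
  ∀ j < P.m, Icc (P.pt j) (P.pt (j + 1)) ⊆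
    Ioo (P.tag j - δ (P.tag j)) (P.tag j + δ (P.tag j))

/-- The Stieltjes sum `∑ [h(t_{j+1}) - h(t_j)] G(τ_j)`. -/
def TaggedDivision.stieltjesSum {a b : ℝ} {F : Type*} [AddCommGroup F] [Module ℝ F]
    (P : TaggedDivision a b) (G : ℝ → F) (h : ℝ → ℝ) : F :=
  ∑ j ∈ Finset.range P.m, (h (P.pt (j + 1)) - h (P.pt j)) • G (P.tag j)

/-- The Kurzweil-Stieltjes integral `∫_a^b G dh` (where `a ≤ b`) exists and is equal to `I`. -/
def HasKSIntegral {F : Type*} [NormedAddCommGroup F] [NormedSpace ℝ F]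
    (G : ℝ → F) (h : ℝ → ℝ) (a b : ℝ) (I : F) : Prop :=
  a ≤ b ∧ ∀ ε > 0, ∃ δ : ℝ → ℝ, (∀ t ∈ Icc a b, 0 < δ t) ∧
    ∀ P : TaggedDivision a b, P.IsFine δ → ‖P.stieltjesSum G h - I‖ < ε

/-- The variation function `t ↦ var_0^t h` on `[0, T]`. -/
def varFun (T : ℝ) (h : ℝ → ℝ) (t : ℝ) : ℝ := variationOnFromTo h (Icc 0 T) 0 t

/-- `ℝⁿ`. -/
abbrev Vec (n : ℕ) := EuclideanSpace ℝ (Fin n)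

/-- The differential with respect to `x` of `f(λ, x, t)`. -/
def fx {n : ℕ} (f : ℝ → Vec n → ℝ → Vec n) (lam : ℝ) (x : Vec n) (t : ℝ) : Vec n →L[ℝ] Vec n :=
  fderiv ℝ (fun y => f lam y t) x

/-- The differential with respect to `x` of `g(x, t)`. -/
def gx {n : ℕ} (g : Vec n → ℝ → Vec n) (x : Vec n) (t : ℝ) : Vec n →L[ℝ] Vec n :=
  fderiv ℝ (fun y => g y t) x

/-! ### Conditions on the data -/

/-- `h` has bounded variation on `[0, T]` and is left-continuous on `(0, T]`. -/
def IntegratorCondition (T : ℝ) (h : ℝ → ℝ) : Prop :=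
  BoundedVariationOn h (Icc 0 T) ∧ ∀ t ∈ Ioc 0 T, ContinuousWithinAt h (Iic t) t

/-- Carathéodory conditions on `f`. -/
def CaratheodoryCondition {n : ℕ} (T : ℝ) (Lam : Set ℝ) (Om : Set (Vec n))
    (f : ℝ → Vec n → ℝ → Vec n) : Prop :=
  (∀ lam ∈ Lam, ∀ t ∈ Icc 0 T, ContinuousOn (fun x => f lam x t) Om) ∧
  (∀ lam ∈ Lam, ∀ x ∈ Om, AEMeasurable (f lam x) (volume.restrict (Icc 0 T))) ∧
  ∃ m : ℝ → ℝ, (∀ t ∈ Icc 0 T, 0 ≤ m t) ∧ IntegrableOn m (Icc 0 T) ∧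
    ∀ lam ∈ Lam, ∀ x ∈ Om, ∀ t ∈ Icc 0 T, ‖f lam x t‖ ≤ m t

/-- Conditions on `g`: continuity in `x` and a majorant integrable with respect to `var_0^t h`. -/
def StieltjesCondition {n : ℕ} (T : ℝ) (Om : Set (Vec n))
    (g : Vec n → ℝ → Vec n) (h : ℝ → ℝ) : Prop :=
  (∀ t ∈ Icc 0 T, ContinuousOn (fun x => g x t) Om) ∧
  ∃ m : ℝ → ℝ, (∀ t ∈ Icc 0 T, 0 ≤ m t) ∧ (∃ I, HasKSIntegral m (varFun T h) 0 T I) ∧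
    ∀ x ∈ Om, ∀ t ∈ Icc 0 T, ‖g x t‖ ≤ m t

/-- `f` has a total differential in `x`, continuous in `x`, with a Lebesgue integrable majorant. -/
def DiffConditionF {n : ℕ} (T : ℝ) (Lam : Set ℝ) (Om : Set (Vec n))
    (f : ℝ → Vec n → ℝ → Vec n) : Prop :=
  (∀ lam ∈ Lam, ∀ x ∈ Om, ∀ t ∈ Icc 0 T, DifferentiableAt ℝ (fun y => f lam y t) x) ∧
  (∀ lam ∈ Lam, ∀ t ∈ Icc 0 T, ContinuousOn (fun x => fx f lam x t) Om) ∧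
  ∃ θ : ℝ → ℝ, IntegrableOn θ (Icc 0 T) ∧
    ∀ lam ∈ Lam, ∀ x ∈ Om, ∀ t ∈ Icc 0 T, ‖fx f lam x t‖ ≤ θ t

/-- `g` has a bounded total differential in `x`, continuous in `x`, with a majorant which is
integrable with respect to `var_0^t h`. -/
def DiffConditionG {n : ℕ} (T : ℝ) (Om : Set (Vec n))
    (g : Vec n → ℝ → Vec n) (h : ℝ → ℝ) : Prop :=
  (∀ x ∈ Om, ∀ t ∈ Icc 0 T, DifferentiableAt ℝ (fun y => g y t) x) ∧
  (∃ C : ℝ, ∀ x ∈ Om, ∀ t ∈ Icc 0 T, ‖gx g x t‖ ≤ C) ∧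
  (∀ t ∈ Icc 0 T, ContinuousOn (fun x => gx g x t) Om) ∧
  ∃ θ : ℝ → ℝ, (∃ I, HasKSIntegral θ (varFun T h) 0 T I) ∧
    ∀ x ∈ Om, ∀ t ∈ Icc 0 T, ‖gx g x t‖ ≤ θ t

/-- Uniform continuity of the integrals of `f` in the parameter. -/
def ParameterCondition {n : ℕ} (T : ℝ) (Lam : Set ℝ) (Om : Set (Vec n))
    (f : ℝ → Vec n → ℝ → Vec n) : Prop :=
  ∃ γ : ℝ → ℝ, MonotoneOn γ (Icc 0 T) ∧ ∀ ε > 0, ∃ δ > 0,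
    ∀ x ∈ Om, ∀ s ∈ Icc 0 T, ∀ t ∈ Icc 0 T, s ≤ t →
    ∀ lam₁ ∈ Lam, ∀ lam₂ ∈ Lam, |lam₁ - lam₂| < δ →
      ‖∫ r in s..t, (f lam₂ x r - f lam₁ x r)‖ ≤ ε * (γ t - γ s)

/-- Uniform continuity of the integrals of the differentials of `f` and `g`; the Stieltjes
integral which occurs in the estimate is required to exist. -/
def DiffUniformCondition {n : ℕ} (T : ℝ) (Lam : Set ℝ) (Om : Set (Vec n))
    (f : ℝ → Vec n → ℝ → Vec n) (g : Vec n → ℝ → Vec n) (h : ℝ → ℝ) : Prop :=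
  ∃ γ : ℝ → ℝ, MonotoneOn γ (Icc 0 T) ∧ ∀ ε > 0, ∃ δ > 0,
    ∀ s ∈ Icc 0 T, ∀ t ∈ Icc 0 T, s ≤ t →
    ∀ x ∈ Om, ∀ y ∈ Om, ∀ lam₁ ∈ Lam, ∀ lam₂ ∈ Lam, |lam₁ - lam₂| + ‖x - y‖ < δ →
      ∃ J : Vec n →L[ℝ] Vec n, HasKSIntegral (fun r => gx g x r - gx g y r) h s t J ∧
        ‖(∫ r in s..t, (fx f lam₁ x r - fx f lam₂ y r)) + J‖ ≤ ε * (γ t - γ s)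

/-! ### Distributional solutions -/

/-- Test functions: smooth functions `ℝ → ℝⁿ` which vanish outside `(0, T)`. -/
def IsTestFunction {n : ℕ} (T : ℝ) (φ : ℝ → Vec n) : Prop :=
  ContDiff ℝ ∞ φ ∧ ∀ t, t ∉ Ioo 0 T → φ t = 0

/-- The action `⟨u, φ⟩ = ∫_0^T u(t) φ(t) dt` of the regular distribution given by `u`. -/
def pairing {n : ℕ} (T : ℝ) (u φ : ℝ → Vec n) : ℝ :=
  ∫ t in (0 : ℝ)..T, inner ℝ (u t) (φ t)

/-- The action `⟨Du, φ⟩ = -⟨u, φ'⟩` of the distributional derivative of `u`. -/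
def derivPairing {n : ℕ} (T : ℝ) (u φ : ℝ → Vec n) : ℝ := - pairing T u (deriv φ)

/-- `x` is a solution of `Dx = f(λ, x, t) + g(x, t) . Dh` on `[0, T]`: `x` has bounded variation,
is left-continuous on `(0, T]`, takes values in `Ω`, the product `g(x(t), t) . Dh` is defined as
the distributional derivative of the indefinite Kurzweil-Stieltjes integral
`H(t) = ∫_0^t g(x(s), s) dh(s)`, and the equation holds in the sense of distributions on `(0, T)`.
Since test functions vanish at `0`, the value `x(0)` is tied to the equation by the jump
relation `x(0+) = x(0) + g(x(0), 0) (h(0+) - h(0))`. -/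
def IsSolution {n : ℕ} (T : ℝ) (Om : Set (Vec n)) (f : ℝ → Vec n → ℝ → Vec n)
    (g : Vec n → ℝ → Vec n) (h : ℝ → ℝ) (lam : ℝ) (x : ℝ → Vec n) : Prop :=
  BoundedVariationOn x (Icc 0 T) ∧
  (∀ t ∈ Ioc 0 T, ContinuousWithinAt x (Iic t) t) ∧
  (∀ t ∈ Icc 0 T, x t ∈ Om) ∧
  IntegrableOn (fun t => f lam (x t) t) (Icc 0 T) ∧
  (∃ H : ℝ → Vec n,
    (∀ t ∈ Icc 0 T, HasKSIntegral (fun s => g (x s) s) h 0 t (H t)) ∧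
    ∀ φ : ℝ → Vec n, IsTestFunction T φ →
      derivPairing T x φ = pairing T (fun t => f lam (x t) t) φ + derivPairing T H φ) ∧
  Tendsto (fun t => x t - (h t - h 0) • g (x 0) 0) (𝓝[>] 0) (𝓝 (x 0))

/-- Solutions of the periodic problem. -/
def IsPeriodicSolution {n : ℕ} (T : ℝ) (Om : Set (Vec n)) (f : ℝ → Vec n → ℝ → Vec n)
    (g : Vec n → ℝ → Vec n) (h : ℝ → ℝ) (lam : ℝ) (x : ℝ → Vec n) : Prop :=
  IsSolution T Om f g h lam x ∧ x 0 = x T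

/-- `x` belongs to the closed ball `B(x₀, ρ)` of the space of functions regulated on `[0, T]`
with the supremum norm. -/
def MemBall {n : ℕ} (T : ℝ) (x₀ : ℝ → Vec n) (ρ : ℝ) (x : ℝ → Vec n) : Prop :=
  RegulatedOn x 0 T ∧ ∀ t ∈ Icc 0 T, ‖x t - x₀ t‖ ≤ ρ

/-- `x₀` is a regulated periodic solution for every parameter, and all functions of the
ball `B(x₀, ρ)` have their values in `Ω`. -/
def TrivialBranch {n : ℕ} (T : ℝ) (Lam : Set ℝ) (Om : Set (Vec n))
    (f : ℝ → Vec n → ℝ → Vec n) (g : Vec n → ℝ → Vec n) (h : ℝ → ℝ)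
    (x₀ : ℝ → Vec n) (ρ : ℝ) : Prop :=
  RegulatedOn x₀ 0 T ∧ (∀ lam ∈ Lam, IsPeriodicSolution T Om f g h lam x₀) ∧
  ∀ x : ℝ → Vec n, MemBall T x₀ ρ x → ∀ t ∈ Icc 0 T, x t ∈ Om

/-- `(x₀, λ₀)` is a bifurcation point of the periodic problem: it is a solution and each of its
neighbourhoods in `B(x₀, ρ) × Λ` contains a solution `(x, λ)` with `x ≠ x₀`. -/
def IsBifurcationPoint {n : ℕ} (T : ℝ) (Lam : Set ℝ) (Om : Set (Vec n))
    (f : ℝ → Vec n → ℝ → Vec n) (g : Vec n → ℝ → Vec n) (h : ℝ → ℝ) (ρ : ℝ)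
    (x₀ : ℝ → Vec n) (lam₀ : ℝ) : Prop :=
  RegulatedOn x₀ 0 T ∧ lam₀ ∈ Lam ∧ IsPeriodicSolution T Om f g h lam₀ x₀ ∧
  ∀ ε > 0, ∃ lam ∈ Lam, ∃ x : ℝ → Vec n,
    MemBall T x₀ ρ x ∧ |lam - lam₀| < ε ∧ (∀ t ∈ Icc 0 T, ‖x t - x₀ t‖ < ε) ∧
    IsPeriodicSolution T Om f g h lam x ∧ ∃ t ∈ Icc 0 T, x t ≠ x₀ t

/-- `z` is a regulated solution on `[0, T]` of
`z(t) - z(T) - ∫_0^t A(τ) z(τ) dτ - ∫_0^t B(τ) z(τ) dh(τ) = q(t)`, with Kurzweil-Stieltjes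
integrals. -/
def IsLinearSolution {n : ℕ} (T : ℝ) (A B : ℝ → Vec n →L[ℝ] Vec n) (h : ℝ → ℝ)
    (q z : ℝ → Vec n) : Prop :=
  RegulatedOn z 0 T ∧ ∀ t ∈ Icc 0 T, ∃ I J : Vec n,
    HasKSIntegral (fun τ => A τ (z τ)) (fun τ => τ) 0 t I ∧
    HasKSIntegral (fun τ => B τ (z τ)) h 0 t J ∧
    z t - z T - I - J = q t

end MeasureDE

end

/-! The theorem is a blow-up argument followed by a finite-dimensional Fredholm alternative. Choose
solutions (x_k, λ_k) tending to (x₀, λ₀) with x_k ≠ x₀, put N_k = sup ‖x_k - x₀‖ and z_k = (x_k -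
x₀)/N_k. Once the distributional equation is in integral form (`IsSolution.exists_integral_eq`), the
mean value inequality bounds the increments of all z_k by those of the single function Γ(t) = ∫_0^t
θ + C μ[0,t). As functions of Γ(t) the z_k are equi-Lipschitz, so Arzelà–Ascoli yields a uniformly
convergent subsequence (`exists_subseq_tendstoUniformlyOn`); its limit z is nonzero because the z_k
have norm one.

The limit solves the linearized homogeneous problem (`isLinearSolution_of_tendsto`): with the
parameter frozen at λ₀ the difference quotients converge pointwise and are dominated. What remains
is the effect of moving λ_k to λ₀ in f. Assumption 7 with equal space arguments, which removes g,
shows through `norm_integral_comp_sub_le` that this effect is o(N_k).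

Limit theorems for Kurzweil–Stieltjes integrals come from measure theory. Since h is
left-continuous, dh = σ dμ on half-open intervals [s,t), with a finite measure μ and a sign σ
(`IntegratorCondition.exists_isPolar`). Functions integrable for μ are Kurzweil–Stieltjes integrable
(`IsPolar.hasKSIntegral`); conversely, bounded functions with an indefinite Kurzweil–Stieltjes
integral are measurable for μ, with the same integral (`IsPolar.integrableOn_of_hasKSIntegral`).

For the non-solvability a constant q suffices. Jumps act only to the right of a point, so the linear
initial value problem is forward unique without any invertibility condition
(`IsPolar.eq_zero_of_mem_solutionSpace`). If all constants were attained as z(0) - z(T), solutions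
Z_i for the unit vectors would have independent initial values; a combination of them would share
the initial value of the nontrivial periodic solution, hence equal it, and comparing the defects
z(0) - z(T) would force it to vanish (`exists_const_not_solvable`). No existence theorem for initial
value problems enters. -/

namespace MeasureDE

/-! ### Gauges adapted to Lebesgue integrable functions -/

/-- McShane-type approximation: near a tag `τ`, measured by a gauge, an integrable function differs
from its value at `τ` by at most a function of small integral. -/
theorem exists_gauge_of_integrable {F : Type*} [NormedAddCommGroup F] [MeasurableSpace F]
    [BorelSpace F] [SecondCountableTopology F] (μ : Measure ℝ) [IsFiniteMeasure μ] {φ : ℝ → F}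
    (hφ : Integrable φ μ) {ε : ENNReal} (hε : ε ≠ 0) :
    ∃ δ : ℝ → ℝ, ∃ W : ℝ → ENNReal, (∀ t, 0 < δ t) ∧ AEMeasurable W μ ∧ ∫⁻ x, W x ∂μ ≤ ε ∧
      ∀ τ x, |x - τ| < δ τ → ‖φ x - φ τ‖ₑ ≤ W x := by
  obtain ⟨η, hη0, hη⟩ : ∃ η : ℝ, 0 < η ∧ ENNReal.ofReal (2 * η) * μ univ ≤ ε / 2 := by
    have : Tendsto (fun η : ℝ => ENNReal.ofReal (2 * η) * μ univ) (𝓝[>] 0) (𝓝 0) := by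
      have h1 : Tendsto (fun η : ℝ => ENNReal.ofReal (2 * η)) (𝓝[>] 0) (𝓝 0) := by
        have : Tendsto (fun η : ℝ => ENNReal.ofReal (2 * η)) (𝓝 0) (𝓝 (ENNReal.ofReal (2 * 0))) :=
          (ENNReal.continuous_ofReal.comp (continuous_const.mul continuous_id)).tendsto 0
        simpa using this.mono_left nhdsWithin_le_nhds
      simpa using ENNReal.Tendsto.mul_const h1 (Or.inr (measure_ne_top μ univ))
    have h2 := this.eventually (Iic_mem_nhds (ENNReal.half_pos hε))
    obtain ⟨η, h3, h4⟩ := (h2.and self_mem_nhdsWithin).exists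
    exact ⟨η, h4, h3⟩
  -- The range is cut into disjoint Borel pieces `D n`, each within η of a point of a dense
  -- sequence, so φ oscillates by less than 2η on the preimage `E n`. Outer regularity gives an open
  -- `U n` around `E n` such that `w n`, which bounds ‖φ x - φ τ‖ for every τ in `E n`, has small
  -- integral over the excess `U n \ E n`. The gauge keeps x in the `U n` that belongs to τ.
  let B : ℕ → Set F := fun n => Metric.ball (TopologicalSpace.denseSeq F n) η
  have hB : ⋃ n, B n = univ := by
    refine eq_univ_of_forall fun x => ?_
    obtain ⟨n, hn⟩ := (TopologicalSpace.denseRange_denseSeq F).exists_dist_lt x hη0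
    exact mem_iUnion.2 ⟨n, hn⟩
  let D : ℕ → Set F := disjointed B
  have hDm : ∀ n, MeasurableSet (D n) := fun n =>
    MeasurableSet.disjointed (fun _ => Metric.isOpen_ball.measurableSet) n
  have hDu : ∀ x, ∃ n, x ∈ D n := fun x => by
    have : x ∈ ⋃ n, D n := by rw [iUnion_disjointed, hB]; trivial
    exact mem_iUnion.1 this
  choose N hN using fun t => hDu (φ t)
  let E : ℕ → Set ℝ := fun n => φ ⁻¹' D n
  have hE : ∀ n, NullMeasurableSet (E n) μ := fun n =>
    hφ.aestronglyMeasurable.aemeasurable.nullMeasurableSet_preimage (hDm n)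
  have hEball : ∀ n x, x ∈ E n → dist (φ x) (TopologicalSpace.denseSeq F n) < η := fun n x hx =>
    disjointed_subset B n hx
  let w : ℕ → ℝ → ENNReal := fun n x =>
    ‖φ x‖ₑ + (‖TopologicalSpace.denseSeq F n‖ₑ + ENNReal.ofReal η)
  have hwm : ∀ n, AEMeasurable (w n) μ := fun n =>
    hφ.aestronglyMeasurable.enorm.add aemeasurable_const
  have hwfin : ∀ n, ∫⁻ x, w n x ∂μ ≠ ⊤ := fun n => by
    rw [lintegral_add_right _ measurable_const, lintegral_const]
    exact ENNReal.add_ne_top.2 ⟨hφ.hasFiniteIntegral.ne, ENNReal.mul_ne_top (by simp)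
      (measure_ne_top _ _)⟩
  obtain ⟨e, he0, hesum⟩ := ENNReal.exists_pos_sum_of_countable (ε := ε / 2)
    (by simpa using hε) ℕ
  have hU : ∀ n, ∃ U, IsOpen U ∧ E n ⊆ U ∧ ∫⁻ x in U \ E n, w n x ∂μ < e n := by
    intro n
    obtain ⟨d, hd0, hd⟩ := exists_pos_setLIntegral_lt_of_measure_lt (hwfin n)
      (ε := e n) (by simpa using (he0 n).ne')
    obtain ⟨U, hEU, hUo, hUlt⟩ := (E n).exists_isOpen_lt_add (μ := μ) (measure_ne_top _ _) hd0.ne'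
    refine ⟨U, hUo, hEU, hd _ ?_⟩
    rw [measure_sdiff hEU (hE n) (measure_ne_top _ _)]
    exact ENNReal.sub_lt_of_lt_add (measure_mono hEU) (by rwa [add_comm])
  choose U hUo hEU hUlt using hU
  have hδ : ∀ t, ∃ d > 0, Metric.ball t d ⊆ U (N t) := fun t =>
    Metric.isOpen_iff.1 (hUo (N t)) t (hEU _ (hN t))
  choose δ hδ0 hδ using hδ
  have hnm : ∀ n, NullMeasurableSet (U n \ E n) μ := fun n =>
    (hUo n).measurableSet.nullMeasurableSet.diff (hE n)
  refine ⟨δ, fun x => ENNReal.ofReal (2 * η) + ∑' n, (U n \ E n).indicator (w n) x, hδ0, ?_, ?_, ?_⟩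
  · exact aemeasurable_const.add (AEMeasurable.tsum fun n => (hwm n).indicator₀ (hnm n))
  · rw [lintegral_add_left measurable_const, lintegral_const,
      lintegral_tsum fun n => (hwm n).indicator₀ (hnm n)]
    calc _ ≤ ε / 2 + ∑' n, (e n : ENNReal) := by
          refine add_le_add hη (ENNReal.tsum_le_tsum fun n => ?_)
          rw [lintegral_indicator₀ (hnm n)]
          exact (hUlt n).le
      _ ≤ ε / 2 + ε / 2 := by gcongr
      _ = ε := ENNReal.add_halves ε
  · intro τ x hx
    have hxU : x ∈ U (N τ) := hδ τ (by simpa [Real.dist_eq] using hx)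
    have hτ := hEball _ _ (hN τ)
    by_cases hxE : x ∈ E (N τ)
    · have := hEball _ _ hxE
      refine le_trans ?_ le_self_add
      rw [← ofReal_norm, ← dist_eq_norm]
      refine ENNReal.ofReal_le_ofReal ?_
      linarith [dist_triangle_right (φ x) (φ τ) (TopologicalSpace.denseSeq F (N τ))]
    · refine le_trans ?_ (le_trans (ENNReal.le_tsum (N τ)) le_add_self)
      rw [indicator_of_mem (show x ∈ U (N τ) \ E (N τ) from ⟨hxU, hxE⟩)]
      refine (enorm_sub_le).trans (add_le_add le_rfl ?_)
      rw [← ofReal_norm, ← ofReal_norm, ← ENNReal.ofReal_add (norm_nonneg _) hη0.le]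
      refine ENNReal.ofReal_le_ofReal ?_
      have := norm_sub_norm_le (φ τ) (TopologicalSpace.denseSeq F (N τ))
      rw [dist_eq_norm] at hτ
      linarith

/-- Real-valued form of `exists_gauge_of_integrable`. -/
theorem exists_gauge_integral_le {F : Type*} [NormedAddCommGroup F] [MeasurableSpace F]
    [BorelSpace F] [SecondCountableTopology F] (μ : Measure ℝ) [IsFiniteMeasure μ] {φ : ℝ → F}
    (hφ : Integrable φ μ) {ε : ℝ} (hε : 0 < ε) :
    ∃ δ W : ℝ → ℝ, (∀ t, 0 < δ t) ∧ Integrable W μ ∧ (∀ x, 0 ≤ W x) ∧ ∫ x, W x ∂μ ≤ ε ∧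
      ∀ᵐ x ∂μ, ∀ τ, |x - τ| < δ τ → ‖φ x - φ τ‖ ≤ W x := by
  obtain ⟨δ, W, hδ, hW, hWi, h⟩ := exists_gauge_of_integrable μ hφ
    (ε := ENNReal.ofReal ε) (by simpa using hε)
  have hfin : ∫⁻ x, W x ∂μ ≠ ⊤ := ne_top_of_le_ne_top ENNReal.ofReal_ne_top hWi
  refine ⟨δ, fun x => (W x).toReal, hδ, integrable_toReal_of_lintegral_ne_top hW hfin,
    fun x => ENNReal.toReal_nonneg, ?_, ?_⟩
  · rw [integral_toReal hW (ae_lt_top' hW hfin)]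
    exact ENNReal.toReal_le_of_le_ofReal hε.le hWi
  · filter_upwards [ae_lt_top' hW hfin] with x hx τ hτ
    have := ENNReal.toReal_mono hx.ne (h τ x hτ)
    rwa [toReal_enorm] at this

end MeasureDE

/-! ### Tagged divisions and the Kurzweil–Stieltjes integral -/

namespace MeasureDE

namespace TaggedDivision

variable {a b c : ℝ} {F : Type*} [NormedAddCommGroup F]

/-- The sum `∑ U(τ_j, t_j, t_{j+1})` over a tagged division. -/
def sum (P : TaggedDivision a b) (U : ℝ → ℝ → ℝ → F) : F :=
  ∑ j ∈ Finset.range P.m, U (P.tag j) (P.pt j) (P.pt (j + 1))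

lemma stieltjesSum_eq_sum [NormedSpace ℝ F] (P : TaggedDivision a b) (G : ℝ → F) (h : ℝ → ℝ) :
    P.stieltjesSum G h = P.sum fun τ s t => (h t - h s) • G τ := rfl

lemma pt_le_succ (P : TaggedDivision a b) {j : ℕ} (hj : j < P.m) : P.pt j ≤ P.pt (j + 1) :=
  (P.tag_mem j hj).1.trans (P.tag_mem j hj).2

lemma pt_mono (P : TaggedDivision a b) {i j : ℕ} (hij : i ≤ j) (hj : j ≤ P.m) :
    P.pt i ≤ P.pt j := by
  induction j, hij using Nat.le_induction with
  | base => exact le_rfl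
  | succ k hk ih => exact (ih (by omega)).trans (P.pt_le_succ (by omega))

lemma left_le_pt (P : TaggedDivision a b) {j : ℕ} (hj : j ≤ P.m) : a ≤ P.pt j := by
  simpa [P.pt_zero] using P.pt_mono (Nat.zero_le j) hj

lemma pt_le_right (P : TaggedDivision a b) {j : ℕ} (hj : j ≤ P.m) : P.pt j ≤ b := by
  have := P.pt_mono hj le_rfl
  rwa [P.pt_last] at this

lemma tag_mem_Icc (P : TaggedDivision a b) {j : ℕ} (hj : j < P.m) : P.tag j ∈ Icc a b :=
  ⟨(P.left_le_pt hj.le).trans (P.tag_mem j hj).1, (P.tag_mem j hj).2.trans (P.pt_le_right hj)⟩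

/-- The division of a degenerate interval without subintervals. -/
def nil (a : ℝ) : TaggedDivision a a := ⟨0, fun _ => a, fun _ => a, rfl, rfl, by simp⟩

/-- The division with a single subinterval. -/
def single {a b τ : ℝ} (hτ : τ ∈ Icc a b) : TaggedDivision a b where
  m := 1
  pt j := if j = 0 then a else b
  tag _ := τ
  pt_zero := by simp
  pt_last := by simp
  tag_mem := by
    intro j hj
    obtain rfl : j = 0 := by omega
    simpa using hτ

/-- Concatenation of divisions of adjacent intervals. -/
def append (P : TaggedDivision a b) (Q : TaggedDivision b c) : TaggedDivision a c where
  m := P.m + Q.m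
  pt j := if j ≤ P.m then P.pt j else Q.pt (j - P.m)
  tag j := if j < P.m then P.tag j else Q.tag (j - P.m)
  pt_zero := by simp [P.pt_zero]
  pt_last := by
    by_cases h : Q.m = 0
    · have := Q.pt_zero
      rw [← h, Q.pt_last] at this
      simp [h, P.pt_last, this]
    · simp [h, Q.pt_last]
  tag_mem := by
    intro j hj
    by_cases h1 : j < P.m
    · simpa [h1, h1.le, Nat.succ_le_of_lt h1] using P.tag_mem j h1
    · obtain ⟨k, rfl⟩ := Nat.exists_eq_add_of_le (not_lt.1 h1)
      have := Q.tag_mem k (by omega)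
      -- At the junction the left end point is still read off `P`, and agrees with the first point
      -- of `Q`.
      by_cases hk : k = 0
      · subst hk
        simpa [P.pt_last, Q.pt_zero] using this
      · simpa [hk, add_assoc] using this

lemma sum_nil (U : ℝ → ℝ → ℝ → F) : (nil a).sum U = 0 := by simp [sum, nil]

lemma sum_single {τ : ℝ} (hτ : τ ∈ Icc a b) (U : ℝ → ℝ → ℝ → F) :
    (single hτ).sum U = U τ a b := by simp [sum, single]

lemma append_tag_left (P : TaggedDivision a b) (Q : TaggedDivision b c) {j : ℕ} (hj : j < P.m) :
    (P.append Q).tag j = P.tag j := by simp [append, hj]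

lemma append_pt_left (P : TaggedDivision a b) (Q : TaggedDivision b c) {j : ℕ} (hj : j ≤ P.m) :
    (P.append Q).pt j = P.pt j := by simp [append, hj]

lemma append_tag_right (P : TaggedDivision a b) (Q : TaggedDivision b c) (j : ℕ) :
    (P.append Q).tag (P.m + j) = Q.tag j := by simp [append]

lemma append_pt_right (P : TaggedDivision a b) (Q : TaggedDivision b c) (j : ℕ) :
    (P.append Q).pt (P.m + j) = Q.pt j := by
  by_cases hj : j = 0
  · subst hj
    simp [append, P.pt_last, Q.pt_zero]
  · simp [append, hj]

lemma sum_append (P : TaggedDivision a b) (Q : TaggedDivision b c) (U : ℝ → ℝ → ℝ → F) :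
    (P.append Q).sum U = P.sum U + Q.sum U := by
  have hm : (P.append Q).m = P.m + Q.m := rfl
  rw [sum, hm, Finset.sum_range_add]
  congr 1
  · refine Finset.sum_congr rfl fun j hj => ?_
    have hj := Finset.mem_range.1 hj
    rw [append_tag_left _ _ hj, append_pt_left _ _ hj.le, append_pt_left _ _ (by omega)]
  · refine Finset.sum_congr rfl fun j hj => ?_
    rw [append_tag_right, append_pt_right, add_assoc, append_pt_right]

lemma isFine_nil (δ : ℝ → ℝ) : (nil a).IsFine δ := by simp [IsFine, nil]

lemma isFine_single {τ : ℝ} (hτ : τ ∈ Icc a b) {δ : ℝ → ℝ}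
    (h : Icc a b ⊆ Ioo (τ - δ τ) (τ + δ τ)) : (single hτ).IsFine δ := by
  intro j hj
  obtain rfl : j = 0 := by simpa [single] using hj
  simpa [single] using h

lemma IsFine.append {P : TaggedDivision a b} {Q : TaggedDivision b c} {δ : ℝ → ℝ}
    (hP : P.IsFine δ) (hQ : Q.IsFine δ) : (P.append Q).IsFine δ := by
  intro j hj
  by_cases h1 : j < P.m
  · rw [append_tag_left _ _ h1, append_pt_left _ _ h1.le, append_pt_left _ _ (by omega)]
    exact hP j h1
  · obtain ⟨k, rfl⟩ := Nat.exists_eq_add_of_le (not_lt.1 h1)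
    rw [append_tag_right, append_pt_right, add_assoc, append_pt_right]
    exact hQ k (by change P.m + k < P.m + Q.m at hj; omega)

lemma IsFine.mono {P : TaggedDivision a b} {δ δ' : ℝ → ℝ} (hP : P.IsFine δ)
    (h : ∀ t ∈ Icc a b, δ t ≤ δ' t) : P.IsFine δ' := by
  intro j hj x hx
  have h1 := hP j hj hx
  have h2 := h _ (P.tag_mem_Icc hj)
  exact ⟨by linarith [h1.1], by linarith [h1.2]⟩

lemma sum_add (P : TaggedDivision a b) (U V : ℝ → ℝ → ℝ → F) :
    P.sum (fun τ s t => U τ s t + V τ s t) = P.sum U + P.sum V := Finset.sum_add_distrib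

lemma sum_sub (P : TaggedDivision a b) (U V : ℝ → ℝ → ℝ → F) :
    P.sum (fun τ s t => U τ s t - V τ s t) = P.sum U - P.sum V := Finset.sum_sub_distrib _ _

lemma sum_increment (P : TaggedDivision a b) (H : ℝ → F) :
    P.sum (fun _ s t => H t - H s) = H b - H a := by
  have := Finset.sum_range_sub (fun j => H (P.pt j)) P.m
  rwa [P.pt_last, P.pt_zero] at this

lemma sum_le_sum {P : TaggedDivision a b} {δ : ℝ → ℝ} (hP : P.IsFine δ) {U V : ℝ → ℝ → ℝ → ℝ}
    (h : ∀ τ s t, a ≤ s → s ≤ τ → τ ≤ t → t ≤ b → τ - δ τ < s → t < τ + δ τ → U τ s t ≤ V τ s t) :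
    P.sum U ≤ P.sum V := by
  refine Finset.sum_le_sum fun j hj => ?_
  have hj := Finset.mem_range.1 hj
  exact h _ _ _ (P.left_le_pt hj.le) (P.tag_mem j hj).1 (P.tag_mem j hj).2 (P.pt_le_right hj)
    (hP j hj (left_mem_Icc.2 (P.pt_le_succ hj))).1 (hP j hj (right_mem_Icc.2 (P.pt_le_succ hj))).2

lemma norm_sum_le (P : TaggedDivision a b) (U : ℝ → ℝ → ℝ → F) :
    ‖P.sum U‖ ≤ P.sum fun τ s t => ‖U τ s t‖ := _root_.norm_sum_le _ _

lemma sum_mul_left (P : TaggedDivision a b) (c : ℝ) (U : ℝ → ℝ → ℝ → ℝ) :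
    P.sum (fun τ s t => c * U τ s t) = c * P.sum U := (Finset.mul_sum _ _ _).symm

/-- Cousin's lemma. -/
theorem exists_isFine (hab : a ≤ b) {δ : ℝ → ℝ} (hδ : ∀ t ∈ Icc a b, 0 < δ t) :
    ∃ P : TaggedDivision a b, P.IsFine δ := by
  let s : Set ℝ := {t | t ∈ Icc a b ∧ ∃ P : TaggedDivision a t, P.IsFine δ}
  have hsn : a ∈ s := ⟨left_mem_Icc.2 hab, nil a, isFine_nil δ⟩
  have hsb : BddAbove s := ⟨b, fun t ht => ht.1.2⟩
  set u := sSup s with hu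
  have hau : a ≤ u := le_csSup hsb hsn
  have hub : u ≤ b := csSup_le ⟨a, hsn⟩ fun t ht => ht.1.2
  have hδu := hδ u ⟨hau, hub⟩
  obtain ⟨t, ⟨htI, P, hP⟩, htu⟩ := exists_lt_of_lt_csSup ⟨a, hsn⟩ (show u - δ u < sSup s by linarith)
  have htle : t ≤ u := le_csSup hsb ⟨htI, P, hP⟩
  -- A division ending beyond u - δ(u) is continued across u by one interval tagged at u. So the
  -- supremum is attained and cannot lie below b.
  have key : ∀ r, u ≤ r → r < u + δ u → ∃ Q : TaggedDivision a r, Q.IsFine δ := fun r hr1 hr2 =>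
    ⟨P.append (single (τ := u) ⟨htle, hr1⟩), hP.append (isFine_single _ fun x hx =>
      ⟨by linarith [hx.1], by linarith [hx.2]⟩)⟩
  by_cases hlt : u = b
  · rw [← hlt]
    exact key u le_rfl (by linarith)
  · have hlt : u < b := lt_of_le_of_ne hub hlt
    obtain ⟨r, hr1, hr2⟩ : ∃ r, u < r ∧ r < min b (u + δ u) := exists_between (lt_min hlt (by linarith))
    have : r ∈ s := ⟨⟨by linarith, (hr2.trans_le (min_le_left _ _)).le⟩,
      key r hr1.le (hr2.trans_le (min_le_right _ _))⟩
    exact absurd (le_csSup hsb this) (by rw [← hu]; linarith)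

end TaggedDivision

namespace HasKSIntegral

variable {a b c : ℝ} {F : Type*} [NormedAddCommGroup F] [NormedSpace ℝ F] {G : ℝ → F} {h : ℝ → ℝ}

open TaggedDivision

theorem unique {I J : F} (hI : HasKSIntegral G h a b I) (hJ : HasKSIntegral G h a b J) : I = J := by
  refine eq_of_norm_sub_le_zero (le_of_forall_pos_le_add fun ε hε => ?_)
  obtain ⟨δ₁, h₁, H₁⟩ := hI.2 (ε / 2) (half_pos hε)
  obtain ⟨δ₂, h₂, H₂⟩ := hJ.2 (ε / 2) (half_pos hε)
  obtain ⟨P, hP⟩ := exists_isFine hI.1 (δ := fun t => min (δ₁ t) (δ₂ t))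
    fun t ht => lt_min (h₁ t ht) (h₂ t ht)
  have e1 := H₁ P (hP.mono fun t _ => min_le_left _ _)
  have e2 := H₂ P (hP.mono fun t _ => min_le_right _ _)
  rw [norm_sub_rev] at e1
  linarith [norm_sub_le_norm_sub_add_norm_sub I (P.stieltjesSum G h) J]

/-- The integral over `[b, c]` is the difference of the integrals over `[a, c]` and `[a, b]`. -/
theorem sub {I J : F} (hI : HasKSIntegral G h a b I) (hJ : HasKSIntegral G h a c J) (hbc : b ≤ c) :
    HasKSIntegral G h b c (J - I) := by
  refine ⟨hbc, fun ε hε => ?_⟩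
  obtain ⟨δ₁, h₁, H₁⟩ := hI.2 (ε / 2) (half_pos hε)
  obtain ⟨δ₂, h₂, H₂⟩ := hJ.2 (ε / 2) (half_pos hε)
  refine ⟨δ₂, fun t ht => h₂ t ⟨hI.1.trans ht.1, ht.2⟩, fun P hP => ?_⟩
  obtain ⟨Q, hQ⟩ := exists_isFine hI.1 (δ := fun t => min (δ₁ t) (δ₂ t))
    fun t ht => lt_min (h₁ t ht) (h₂ t ⟨ht.1, ht.2.trans hbc⟩)
  have e1 := H₁ Q (hQ.mono fun t _ => min_le_left _ _)
  have e2 := H₂ (Q.append P) ((hQ.mono fun t _ => min_le_right _ _).append hP)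
  rw [stieltjesSum_eq_sum, sum_append, ← stieltjesSum_eq_sum, ← stieltjesSum_eq_sum] at e2
  calc ‖P.stieltjesSum G h - (J - I)‖
      = ‖(Q.stieltjesSum G h + P.stieltjesSum G h - J) - (Q.stieltjesSum G h - I)‖ := by
        congr 1; abel
    _ ≤ _ := norm_sub_le _ _
    _ < ε := by linarith

theorem clm_comp {F' : Type*} [NormedAddCommGroup F'] [NormedSpace ℝ F'] {I : F}
    (hI : HasKSIntegral G h a b I) (L : F →L[ℝ] F') :
    HasKSIntegral (fun t => L (G t)) h a b (L I) := by
  refine ⟨hI.1, fun ε hε => ?_⟩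
  obtain ⟨δ, h0, H⟩ := hI.2 (ε / (‖L‖ + 1)) (by positivity)
  refine ⟨δ, h0, fun P hP => ?_⟩
  have e : P.stieltjesSum (fun t => L (G t)) h = L (P.stieltjesSum G h) := by
    simp [stieltjesSum, map_sum]
  rw [e, ← map_sub]
  refine (L.le_opNorm _).trans_lt ?_
  have h1 := H P hP
  rw [lt_div_iff₀ (by positivity)] at h1
  nlinarith [norm_nonneg (P.stieltjesSum G h - I), norm_nonneg L]

theorem sub_fun {G' : ℝ → F} {I J : F} (hI : HasKSIntegral G h a b I)
    (hJ : HasKSIntegral G' h a b J) : HasKSIntegral (fun t => G t - G' t) h a b (I - J) := by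
  refine ⟨hI.1, fun ε hε => ?_⟩
  obtain ⟨δ₁, h₁, H₁⟩ := hI.2 (ε / 2) (half_pos hε)
  obtain ⟨δ₂, h₂, H₂⟩ := hJ.2 (ε / 2) (half_pos hε)
  refine ⟨fun t => min (δ₁ t) (δ₂ t), fun t ht => lt_min (h₁ t ht) (h₂ t ht), fun P hP => ?_⟩
  have e1 := H₁ P (hP.mono fun t _ => min_le_left _ _)
  have e2 := H₂ P (hP.mono fun t _ => min_le_right _ _)
  have e : P.stieltjesSum (fun t => G t - G' t) h = P.stieltjesSum G h - P.stieltjesSum G' h := by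
    simp [stieltjesSum, smul_sub]
  rw [e, sub_sub_sub_comm]
  exact (norm_sub_le _ _).trans_lt (by linarith)

theorem const_smul {I : F} (hI : HasKSIntegral G h a b I) (c : ℝ) :
    HasKSIntegral (fun t => c • G t) h a b (c • I) := by
  simpa using hI.clm_comp (c • ContinuousLinearMap.id ℝ F)

theorem zero (hab : a ≤ b) : HasKSIntegral (fun _ => (0 : F)) h a b 0 :=
  ⟨hab, fun ε hε => ⟨fun _ => 1, fun _ _ => one_pos, fun P _ => by simpa [stieltjesSum]⟩⟩

theorem refl (I : F) (hI : HasKSIntegral G h a a I) : I = 0 := by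
  simpa using (hI.sub hI le_rfl).unique hI |>.symm

/-- A division of [a,b] fine for both gauges, followed by the single interval [b,c] tagged at τ, is
fine on [a,c]; the two sums differ by exactly one term. This isolates the contribution of one short
interval to an indefinite integral. -/
theorem norm_sub_lt_of_fine {I₁ I₂ : F} {δ₁ δ₂ : ℝ → ℝ} {ε₁ ε₂ : ℝ} {τ : ℝ} (hab : a ≤ b)
    (h₁ : ∀ t ∈ Icc a b, 0 < δ₁ t) (h₂ : ∀ t ∈ Icc a b, 0 < δ₂ t)
    (H₁ : ∀ P : TaggedDivision a b, P.IsFine δ₁ → ‖P.stieltjesSum G h - I₁‖ < ε₁)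
    (H₂ : ∀ P : TaggedDivision a c, P.IsFine δ₂ → ‖P.stieltjesSum G h - I₂‖ < ε₂)
    (hτ : τ ∈ Icc b c) (hfine : Icc b c ⊆ Ioo (τ - δ₂ τ) (τ + δ₂ τ)) :
    ‖I₂ - I₁ - (h c - h b) • G τ‖ < ε₁ + ε₂ := by
  obtain ⟨Q, hQ⟩ := exists_isFine hab (δ := fun t => min (δ₁ t) (δ₂ t))
    fun t ht => lt_min (h₁ t ht) (h₂ t ht)
  have e1 := H₁ Q (hQ.mono fun t _ => min_le_left _ _)
  have e2 := H₂ (Q.append (single hτ)) ((hQ.mono fun t _ => min_le_right _ _).append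
    (isFine_single hτ hfine))
  rw [stieltjesSum_eq_sum, sum_append, sum_single] at e2
  rw [stieltjesSum_eq_sum] at e1
  calc _ = ‖(Q.sum (fun τ s t => (h t - h s) • G τ) - I₁) -
        (Q.sum (fun τ s t => (h t - h s) • G τ) + (h c - h b) • G τ - I₂)‖ := by congr 1; abel
    _ ≤ _ := norm_sub_le _ _
    _ < _ := by linarith

/-- Behaviour of the indefinite integral to the left of a point. -/
theorem tendsto_left {T t : ℝ} {H : ℝ → F} (hH : ∀ t ∈ Icc 0 T, HasKSIntegral G h 0 t (H t))
    (ht : t ∈ Ioc 0 T) :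
    Tendsto (fun s => H t - H s - (h t - h s) • G t) (𝓝[<] t) (𝓝 0) := by
  rw [Metric.tendsto_nhds]
  intro ε hε
  obtain ⟨δ, h0, Hδ⟩ := (hH t ⟨ht.1.le, ht.2⟩).2 (ε / 2) (half_pos hε)
  have hδt := h0 t ⟨ht.1.le, le_rfl⟩
  filter_upwards [Ioo_mem_nhdsLT (show max 0 (t - δ t) < t from max_lt ht.1 (by linarith))]
    with s hs
  have hs0 := (le_max_left _ _).trans_lt hs.1
  have hs1 := (le_max_right _ _).trans_lt hs.1
  obtain ⟨δ', h0', Hδ'⟩ := (hH s ⟨hs0.le, hs.2.le.trans ht.2⟩).2 (ε / 2) (half_pos hε)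
  rw [dist_zero_right]
  have := norm_sub_lt_of_fine hs0.le h0' (fun r hr => h0 r ⟨hr.1, hr.2.trans hs.2.le⟩) Hδ' Hδ
    (τ := t) ⟨hs.2.le, le_rfl⟩ fun x hx => ⟨by linarith [hx.1], by linarith [hx.2]⟩
  linarith

/-- Behaviour of the indefinite integral to the right of a point. -/
theorem tendsto_right {T t : ℝ} {H : ℝ → F} (hH : ∀ t ∈ Icc 0 T, HasKSIntegral G h 0 t (H t))
    (ht : t ∈ Ico 0 T) :
    Tendsto (fun s => H s - H t - (h s - h t) • G t) (𝓝[>] t) (𝓝 0) := by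
  rw [Metric.tendsto_nhds]
  intro ε hε
  -- Passing to integrals over [t,T] allows the interval tagged at t to be put in front of a fine
  -- division of [s,T].
  have htT := (hH t ⟨ht.1, ht.2.le⟩).sub (hH T ⟨ht.1.trans ht.2.le, le_rfl⟩) ht.2.le
  obtain ⟨δ, h0, Hδ⟩ := htT.2 (ε / 2) (half_pos hε)
  have hδt := h0 t ⟨le_rfl, ht.2.le⟩
  filter_upwards [Ioo_mem_nhdsGT (show t < min T (t + δ t) from lt_min ht.2 (by linarith))]
    with s hs
  have hs0 := hs.2.trans_le (min_le_left _ _)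
  have hs1 := hs.2.trans_le (min_le_right _ _)
  have hsT := (hH s ⟨ht.1.trans hs.1.le, hs0.le⟩).sub (hH T ⟨ht.1.trans ht.2.le, le_rfl⟩) hs0.le
  obtain ⟨δ', h0', Hδ'⟩ := hsT.2 (ε / 2) (half_pos hε)
  obtain ⟨Q, hQ⟩ := exists_isFine hs0.le (δ := fun t => min (δ t) (δ' t))
    fun r hr => lt_min (h0 r ⟨hs.1.le.trans hr.1, hr.2⟩) (h0' r hr)
  have e1 := Hδ' Q (hQ.mono fun t _ => min_le_right _ _)
  have hτ : t ∈ Icc t s := ⟨le_rfl, hs.1.le⟩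
  have e2 := Hδ ((single hτ).append Q) ((isFine_single hτ fun x hx =>
    ⟨by linarith [hx.1], by linarith [hx.2]⟩).append (hQ.mono fun t _ => min_le_left _ _))
  rw [stieltjesSum_eq_sum, sum_append, sum_single] at e2
  rw [stieltjesSum_eq_sum] at e1
  rw [dist_zero_right]
  calc _ = ‖(Q.sum (fun τ s t => (h t - h s) • G τ) - (H T - H s)) -
        ((h s - h t) • G t + Q.sum (fun τ s t => (h t - h s) • G τ) - (H T - H t))‖ := by
          congr 1; abel
    _ ≤ _ := norm_sub_le _ _
    _ < _ := by linarith

/-- The Saks–Henstock lemma for real-valued functions. -/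
theorem saks_henstock {T : ℝ} {G : ℝ → ℝ} {H : ℝ → ℝ} (hT : 0 ≤ T)
    (hH : ∀ t ∈ Icc 0 T, HasKSIntegral G h 0 t (H t)) {ε : ℝ} (hε : 0 < ε) :
    ∃ δ : ℝ → ℝ, (∀ t ∈ Icc 0 T, 0 < δ t) ∧ ∀ P : TaggedDivision 0 T, P.IsFine δ →
      P.sum (fun τ s t => |(h t - h s) * G τ - (H t - H s)|) ≤ ε := by
  obtain ⟨δ, h0, Hδ⟩ := (hH T ⟨hT, le_rfl⟩).2 (ε / 2) (half_pos hε)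
  refine ⟨δ, h0, fun P hP => ?_⟩
  let U : ℝ → ℝ → ℝ → ℝ := fun τ s t => (h t - h s) * G τ - (H t - H s)
  have hH0 : H 0 = 0 := (hH 0 ⟨le_rfl, hT⟩).refl
  have hsumU : ∀ a b (Q : TaggedDivision a b), Q.sum U = Q.stieltjesSum G h - (H b - H a) := by
    intro a b Q
    rw [stieltjesSum_eq_sum, ← Q.sum_increment, ← sum_sub]
    rfl
  -- The terms are separated by sign. `Q₁` keeps the tagged intervals with U ≥ 0 and replaces the
  -- others by fine subdivisions on which U nearly sums to zero; `Q₂` does the opposite. Both are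
  -- δ-fine, so each total is within ε/2 of zero.
  have key : ∀ j ≤ P.m, ∀ η > 0, ∃ Q₁ Q₂ : TaggedDivision 0 (P.pt j), Q₁.IsFine δ ∧ Q₂.IsFine δ ∧
      ∑ i ∈ Finset.range j, |U (P.tag i) (P.pt i) (P.pt (i + 1))| ≤ Q₁.sum U - Q₂.sum U + η := by
    intro j
    induction j with
    | zero =>
      intro _ η hη
      rw [P.pt_zero]
      exact ⟨nil 0, nil 0, isFine_nil _, isFine_nil _, by simp [sum_nil, hη.le]⟩
    | succ j ih =>
      intro hj η hη
      obtain ⟨Q₁, Q₂, f₁, f₂, hQ⟩ := ih (by omega) (η / 2) (half_pos hη)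
      have hjm : j < P.m := by omega
      have hle := P.pt_le_succ hjm
      have hmem : ∀ i ≤ P.m, P.pt i ∈ Icc 0 T := fun i hi => ⟨P.left_le_pt hi, P.pt_le_right hi⟩
      obtain ⟨δ', h0', Hδ'⟩ := ((hH _ (hmem j hjm.le)).sub (hH _ (hmem (j + 1) hj)) hle).2
        (η / 2) (half_pos hη)
      obtain ⟨Q, hQf⟩ := exists_isFine hle (δ := fun t => min (δ t) (δ' t)) fun t ht =>
        lt_min (h0 t ⟨(hmem j hjm.le).1.trans ht.1, ht.2.trans (hmem _ hj).2⟩) (h0' t ht)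
      have e1 := Hδ' Q (hQf.mono fun t _ => min_le_right _ _)
      rw [← hsumU, Real.norm_eq_abs, abs_lt] at e1
      have fQ := hQf.mono (δ' := δ) fun t _ => min_le_left _ _
      have fS := isFine_single (P.tag_mem j hjm) (hP j hjm)
      rw [Finset.sum_range_succ]
      rcases le_total 0 (U (P.tag j) (P.pt j) (P.pt (j + 1))) with hu | hu
      · refine ⟨_, _, f₁.append fS, f₂.append fQ, ?_⟩
        rw [sum_append, sum_append, sum_single, abs_of_nonneg hu]
        linarith
      · refine ⟨_, _, f₁.append fQ, f₂.append fS, ?_⟩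
        rw [sum_append, sum_append, sum_single, abs_of_nonpos hu]
        linarith
  refine le_of_forall_pos_le_add fun η hη => ?_
  obtain ⟨Q₁, Q₂, f₁, f₂, hQ⟩ := key P.m le_rfl η hη
  refine hQ.trans ?_
  have hfin : ∀ b (hb : b = T) (Q : TaggedDivision 0 b), Q.IsFine δ → |Q.sum U| < ε / 2 := by
    rintro b rfl Q hQ
    rw [hsumU, hH0, sub_zero]
    exact Hδ Q hQ
  have a1 := abs_lt.1 (hfin _ P.pt_last Q₁ f₁)
  have a2 := abs_lt.1 (hfin _ P.pt_last Q₂ f₂)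
  linarith

end HasKSIntegral

end MeasureDE

/-! ### The measure behind a left-continuous integrator -/

namespace MeasureDE

/-- The intervals decrease to the empty set because t itself is left out; an atom at t does no harm.
-/
lemma tendsto_measureReal_Ioo_right (μ : Measure ℝ) [IsFiniteMeasure μ] (t : ℝ) :
    Tendsto (fun s => μ.real (Ioo t s)) (𝓝[>] t) (𝓝 0) := by
  have h := tendsto_measure_biInter_gt (μ := μ) (s := fun r => Ioo t r) (a := t)
    (fun r _ => measurableSet_Ioo.nullMeasurableSet) (fun i j _ hij => Ioo_subset_Ioo_right hij)
    ⟨t + 1, by simp, measure_ne_top _ _⟩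
  have e : ⋂ r > t, Ioo t r = ∅ := by
    refine eq_empty_of_forall_notMem fun x hx => ?_
    simp only [mem_iInter] at hx
    have h1 := hx (t + 1) (by simp)
    exact absurd (hx x h1.1).2 (lt_irrefl x)
  rw [e, measure_empty] at h
  simpa [Measure.real, Function.comp_def] using (ENNReal.tendsto_toReal ENNReal.zero_ne_top).comp h

lemma tendsto_measureReal_Ico_left (μ : Measure ℝ) [IsFiniteMeasure μ] (t : ℝ) :
    Tendsto (fun s => μ.real (Ico s t)) (𝓝[<] t) (𝓝 0) := by
  have h := tendsto_measure_biInter_gt (ι := ℝᵒᵈ) (μ := μ) (s := fun r => Ico (OrderDual.ofDual r) t)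
    (a := OrderDual.toDual t)
    (fun r _ => measurableSet_Ico.nullMeasurableSet) (fun i j _ hij => Ico_subset_Ico_left hij)
    ⟨OrderDual.toDual (t - 1), sub_one_lt t, measure_ne_top _ _⟩
  have e : ⋂ r > OrderDual.toDual t, Ico (OrderDual.ofDual r) t = ∅ := by
    refine eq_empty_of_forall_notMem fun x hx => ?_
    simp only [mem_iInter] at hx
    have h1 := hx (OrderDual.toDual (t - 1)) (sub_one_lt t)
    obtain ⟨y, hy1, hy2⟩ := exists_between h1.2
    exact absurd (hx (OrderDual.toDual y) hy2).1 (not_le.2 hy1)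
  rw [e, measure_empty] at h
  exact (ENNReal.tendsto_toReal ENNReal.zero_ne_top).comp h

/-- A left-continuous function of bounded variation on `[0, T]` has increments which are dominated
by a finite measure. -/
theorem IntegratorCondition.exists_measure {T : ℝ} (hT : 0 ≤ T) {h : ℝ → ℝ}
    (hh : IntegratorCondition T h) :
    ∃ μ : Measure ℝ, IsFiniteMeasure μ ∧ ∀ s t, 0 ≤ s → s ≤ t → t ≤ T →
      |h t - h s| ≤ μ.real (Ico s t) := by
  -- The vector measure of a function of bounded variation gives [s,t) the difference of left
  -- limits. By left-continuity these are values of h, and the constant extension makes this true at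
  -- 0 as well.
  let k : ℝ → ℝ := h ∘ fun t => (projIcc 0 T hT t : ℝ)
  have hk : BoundedVariationOn k univ := by
    refine ne_top_of_le_ne_top hh.1 (eVariationOn.comp_le_of_monotoneOn h _ ?_ fun t _ => (projIcc 0 T hT t).2)
    exact fun x _ y _ hxy => monotone_projIcc hT hxy
  have hkeq : ∀ t ∈ Icc 0 T, k t = h t := fun t ht => by simp [k, projIcc_of_mem hT ht]
  have hlim : ∀ t ∈ Icc 0 T, k.leftLim t = h t := by
    intro t ht
    rcases ht.1.eq_or_lt with rfl | h0
    · refine leftLim_eq_of_tendsto (Tendsto.congr' ?_ tendsto_const_nhds)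
      filter_upwards [self_mem_nhdsWithin] with s hs
      simp only [k, Function.comp_apply, projIcc_of_le_left hT (le_of_lt hs)]
    · refine leftLim_eq_of_tendsto (Tendsto.congr' ?_
        ((hh.2 t ⟨h0, ht.2⟩).tendsto.mono_left (nhdsWithin_mono _ Iio_subset_Iic_self)))
      filter_upwards [Ioo_mem_nhdsLT h0] with s hs
      exact (hkeq s ⟨hs.1.le, hs.2.le.trans ht.2⟩).symm
  refine ⟨SignedMeasure.totalVariation hk.vectorMeasure, inferInstance, fun s t hs hst ht => ?_⟩
  have h1 := SignedMeasure.norm_le_totalVariation hk.vectorMeasure (Ico s t)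
  rwa [hk.vectorMeasure_Ico hst, hlim t ⟨hs.trans hst, ht⟩, hlim s ⟨hs, hst.trans ht⟩] at h1

/-- The hypothesis says that Cν + F and Cν - F have nonnegative increments, so they are given by
finite measures κ₁ and κ₂ with κ₁ + κ₂ = 2Cν. Hence κ₁ ≪ ν, and dκ₁/dν - C is the required density.
-/
lemma exists_density_aux (ν : Measure ℝ) [IsFiniteMeasure ν] (F : ℝ → ℝ) {C : ℝ} (hC : 0 ≤ C)
    (hF : ∀ s t, s ≤ t → |F t - F s| ≤ C * ν.real (Ico s t)) :
    ∃ φ : ℝ → ℝ, Measurable φ ∧ Integrable φ ν ∧ ∀ s t, s ≤ t → F t - F s = ∫ x in Ico s t, φ x ∂ν := by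
  have main : ∀ G : ℝ → ℝ, (∀ s t, s ≤ t → |G t - G s| ≤ C * ν.real (Ico s t)) →
      ∃ κ : Measure ℝ, IsFiniteMeasure κ ∧ ∀ s t, s ≤ t →
        κ (Ico s t) = ENNReal.ofReal (C * ν.real (Ico s t) + (G t - G s)) := by
    intro G hG
    let p : ℝ → ℝ := fun t => C * ν.real (Iio t) + G t
    have hp : ∀ s t, s ≤ t → p t - p s = C * ν.real (Ico s t) + (G t - G s) := by
      intro s t hst
      have : ν.real (Iio t) = ν.real (Iio s) + ν.real (Ico s t) := by
        rw [← measureReal_union _ measurableSet_Ico, Iio_union_Ico_eq_Iio hst]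
        exact disjoint_left.2 fun x hx hx' => absurd hx'.1 (not_le.2 hx)
      simp only [p, this]
      ring
    have hmono : Monotone p := fun s t hst => by
      linarith [hp s t hst, neg_abs_le (G t - G s), hG s t hst]
    have hbd : ∀ t, |G t - G 0| ≤ C * ν.real univ := by
      intro t
      rcases le_total 0 t with h | h
      · exact (hG 0 t h).trans (mul_le_mul_of_nonneg_left (measureReal_mono (subset_univ _)) hC)
      · rw [abs_sub_comm]
        exact (hG t 0 h).trans (mul_le_mul_of_nonneg_left (measureReal_mono (subset_univ _)) hC)
    have hlim : ∀ t, Tendsto p (𝓝[<] t) (𝓝 (p t)) := by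
      intro t
      rw [tendsto_iff_norm_sub_tendsto_zero]
      refine squeeze_zero' (Eventually.of_forall fun s => norm_nonneg _) ?_
        (by simpa using (tendsto_measureReal_Ico_left ν t).const_mul (2 * C))
      filter_upwards [self_mem_nhdsWithin] with s hs
      have hs' : s ≤ t := le_of_lt hs
      rw [norm_sub_rev, hp s t hs', Real.norm_eq_abs]
      have := hG s t hs'
      rw [abs_le] at this ⊢
      constructor <;> nlinarith [measureReal_nonneg (μ := ν) (s := Ico s t)]
    -- `S` is the right-continuous modification of `p`. Since `p` is left-continuous, the left
    -- limits of `S` recover `p`, and those are what the measure of [s,t) sees.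
    let S := hmono.stieltjesFunction
    have hS : ∀ t, Function.leftLim S t = p t := by
      intro t
      have e := leftLim_eq_of_tendsto (hlim t)
      have : Function.leftLim (Function.rightLim p) t = Function.leftLim p t :=
        leftLim_rightLim (by rw [e]; exact hlim t)
      exact this.trans e
    refine ⟨S.measure, ?_, fun s t hst => by rw [S.measure_Ico, hS, hS, hp s t hst]⟩
    refine S.isFiniteMeasure_of_forall_abs_le (C := 2 * (C * ν.real univ) + |G 0|) fun x => ?_
    have hb : ∀ y, |p y| ≤ 2 * (C * ν.real univ) + |G 0| := by
      intro y
      have h1 : C * ν.real (Iio y) ≤ C * ν.real univ :=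
        mul_le_mul_of_nonneg_left (measureReal_mono (subset_univ _)) hC
      have h2 : 0 ≤ C * ν.real (Iio y) := by positivity
      have h3 := abs_add_le (G y - G 0) (G 0)
      rw [sub_add_cancel] at h3
      calc |p y| ≤ |C * ν.real (Iio y)| + |G y| := abs_add_le _ _
        _ ≤ _ := by rw [abs_of_nonneg h2]; linarith [hbd y]
    have hlt := hmono.tendsto_rightLim x
    exact le_of_tendsto hlt.abs (Eventually.of_forall hb)
  obtain ⟨κ₁, _, h₁⟩ := main F hF
  obtain ⟨κ₂, _, h₂⟩ := main (fun t => - F t) fun s t hst => by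
    simpa [abs_sub_comm, neg_add_eq_sub] using hF s t hst
  have hsum : κ₁ + κ₂ = ENNReal.ofReal (2 * C) • ν := by
    refine Measure.ext_of_Ico _ _ fun s t hst => ?_
    have h := abs_le.1 (hF s t hst.le)
    rw [Measure.add_apply, h₁ s t hst.le, h₂ s t hst.le, ← ENNReal.ofReal_add (by linarith)
      (by linarith), Measure.smul_apply, smul_eq_mul, ← ofReal_measureReal,
      ← ENNReal.ofReal_mul (by positivity)]
    congr 1
    ring
  have hac : κ₁ ≪ ν := by
    refine Measure.AbsolutelyContinuous.trans (Measure.absolutelyContinuous_of_le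
      (show κ₁ ≤ κ₁ + κ₂ from Measure.le_add_right le_rfl)) ?_
    rw [hsum]
    exact Measure.smul_absolutelyContinuous
  refine ⟨fun x => (κ₁.rnDeriv ν x).toReal - C,
    (Measure.measurable_rnDeriv κ₁ ν).ennreal_toReal.sub_const C,
    Measure.integrable_toReal_rnDeriv.sub (integrable_const C), fun s t hst => ?_⟩
  rw [integral_sub Measure.integrable_toReal_rnDeriv.integrableOn (integrable_const C).integrableOn,
    Measure.setIntegral_toReal_rnDeriv hac, setIntegral_const, measureReal_def, h₁ s t hst,
    ENNReal.toReal_ofReal (by linarith [neg_abs_le (F t - F s), hF s t hst]), smul_eq_mul]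
  ring

/-- A function with increments dominated by a measure is an indefinite integral. -/
theorem exists_density {T : ℝ} (hT : 0 ≤ T) (μ : Measure ℝ) [IsFiniteMeasure μ] (F : ℝ → ℝ) {C : ℝ}
    (hC : 0 ≤ C)
    (hF : ∀ s t, 0 ≤ s → s ≤ t → t ≤ T → |F t - F s| ≤ C * μ.real (Ico s t)) :
    ∃ φ : ℝ → ℝ, Measurable φ ∧ Integrable φ μ ∧ ∀ s t, 0 ≤ s → s ≤ t → t ≤ T →
      F t - F s = ∫ x in Ico s t, φ x ∂μ := by
  obtain ⟨φ, hφm, hφ, h⟩ := exists_density_aux μ (fun t => F (projIcc 0 T hT t)) hC fun s t hst => by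
    refine (hF _ _ (projIcc 0 T hT s).2.1 (monotone_projIcc hT hst) (projIcc 0 T hT t).2.2).trans ?_
    refine mul_le_mul_of_nonneg_left (measureReal_mono fun x hx => ?_) hC
    simp only [coe_projIcc, mem_Ico] at hx ⊢
    have h1 := hx.1
    have h2 := hx.2
    simp only [max_le_iff, lt_max_iff, lt_min_iff, min_le_iff] at h1 h2
    grind
  refine ⟨φ, hφm, hφ, fun s t hs hst ht => ?_⟩
  simpa [projIcc_of_mem hT ⟨hs, hst.trans ht⟩, projIcc_of_mem hT ⟨hs.trans hst, ht⟩] using h s t hst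

end MeasureDE

/-! ### Polar decomposition and comparison of the two integrals -/

namespace MeasureDE

/-- The increments of `h` on `[0, T]` are the integrals of a sign `σ` with respect to `μ`. -/
structure IsPolar (T : ℝ) (h : ℝ → ℝ) (μ : Measure ℝ) (σ : ℝ → ℝ) : Prop where
  finite : IsFiniteMeasure μ
  meas : Measurable σ
  abs_eq : ∀ x, |σ x| = 1
  sub_eq : ∀ s t, 0 ≤ s → s ≤ t → t ≤ T → h t - h s = ∫ x in Ico s t, σ x ∂μ

lemma setIntegral_Ico_sub {F : Type*} [NormedAddCommGroup F] [NormedSpace ℝ F] {μ : Measure ℝ}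
    {T s t : ℝ} {f : ℝ → F} (hf : IntegrableOn f (Ico 0 T) μ) (hs : 0 ≤ s) (hst : s ≤ t)
    (ht : t ≤ T) :
    (∫ x in Ico 0 t, f x ∂μ) - ∫ x in Ico 0 s, f x ∂μ = ∫ x in Ico s t, f x ∂μ := by
  rw [← Ico_union_Ico_eq_Ico hs hst, setIntegral_union (Ico_disjoint_Ico_same) measurableSet_Ico
    (hf.mono_set (Ico_subset_Ico_right (hst.trans ht)))
    (hf.mono_set (Ico_subset_Ico hs ht))]
  abel

lemma measureReal_Ico_sub {μ : Measure ℝ} [IsFiniteMeasure μ] {s t : ℝ} (hs : 0 ≤ s)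
    (hst : s ≤ t) : μ.real (Ico 0 t) - μ.real (Ico 0 s) = μ.real (Ico s t) := by
  rw [← Ico_union_Ico_eq_Ico hs hst, measureReal_union Ico_disjoint_Ico_same measurableSet_Ico]
  ring

/-- Polar decomposition of the Stieltjes measure of a left-continuous integrator. -/
theorem IntegratorCondition.exists_isPolar {T : ℝ} (hT : 0 ≤ T) {h : ℝ → ℝ}
    (hh : IntegratorCondition T h) : ∃ μ σ, IsPolar T h μ σ := by
  obtain ⟨μ, _, hμ⟩ := hh.exists_measure hT
  obtain ⟨φ, hφm, hφ, hφ'⟩ := exists_density hT μ h zero_le_one (by simpa using hμ)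
  -- The density φ is split into modulus and sign; the sign chosen at zeros of φ is immaterial, as
  -- the new measure does not charge them.
  refine ⟨μ.withDensity fun x => ‖φ x‖ₑ, fun x => if 0 ≤ φ x then 1 else -1, ?_, ?_, ?_, ?_⟩
  · exact isFiniteMeasure_withDensity hφ.hasFiniteIntegral.ne
  · exact Measurable.ite (measurableSet_le measurable_const hφm) measurable_const measurable_const
  · intro x
    split_ifs <;> simp
  · intro s t hs hst ht
    rw [hφ' s t hs hst ht, setIntegral_withDensity_eq_setIntegral_toReal_smul hφm.enorm
      (Eventually.of_forall fun x => enorm_lt_top) _ measurableSet_Ico]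
    refine integral_congr_ae (Eventually.of_forall fun x => ?_)
    simp only [toReal_enorm, Real.norm_eq_abs, smul_eq_mul]
    split_ifs with h0
    · rw [abs_of_nonneg h0, mul_one]
    · rw [abs_of_neg (not_le.1 h0)]
      ring

/-- The integrator h(t) = t is included so that the dt-term of the linear equation, also a
Kurzweil–Stieltjes integral, falls under the same theory. -/
theorem isPolar_id {T : ℝ} : IsPolar T (fun t => t) (volume.restrict (Icc 0 T)) fun _ => 1 where
  finite := inferInstance
  meas := measurable_const
  abs_eq := by simp
  sub_eq s t hs hst ht := by
    rw [Measure.restrict_restrict measurableSet_Ico,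
      inter_eq_left.2 (Ico_subset_Icc_self.trans (Icc_subset_Icc hs ht))]
    simp [hst]

namespace IsPolar

variable {T : ℝ} {h : ℝ → ℝ} {μ : Measure ℝ} {σ : ℝ → ℝ}
  {F : Type*} [NormedAddCommGroup F] [NormedSpace ℝ F]

lemma integrable_sign (hp : IsPolar T h μ σ) : Integrable σ μ := by
  have := hp.finite
  refine Integrable.of_bound hp.meas.aestronglyMeasurable 1 (Eventually.of_forall fun x => ?_)
  rw [Real.norm_eq_abs, hp.abs_eq]

lemma abs_sub_le (hp : IsPolar T h μ σ) {s t : ℝ} (hs : 0 ≤ s) (hst : s ≤ t) (ht : t ≤ T) :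
    |h t - h s| ≤ μ.real (Ico s t) := by
  have := hp.finite
  rw [hp.sub_eq s t hs hst ht]
  refine (norm_integral_le_integral_norm σ).trans (le_of_eq ?_)
  simp [hp.abs_eq]

lemma norm_smul (hp : IsPolar T h μ σ) (x : ℝ) (v : F) : ‖σ x • v‖ = ‖v‖ := by
  rw [_root_.norm_smul, Real.norm_eq_abs, hp.abs_eq, one_mul]

lemma integrableOn_smul (hp : IsPolar T h μ σ) {f : ℝ → F} {s : Set ℝ} (hf : IntegrableOn f s μ) :
    IntegrableOn (fun x => σ x • f x) s μ := by
  refine Integrable.mono' hf.norm (hp.meas.aestronglyMeasurable.smul hf.aestronglyMeasurable)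
    (Eventually.of_forall fun x => ?_)
  rw [hp.norm_smul]

/-- Functions which are integrable with respect to the Stieltjes measure are Kurzweil–Stieltjes
integrable. -/
theorem hasKSIntegral [CompleteSpace F] [SecondCountableTopology F] (hp : IsPolar T h μ σ)
    {f : ℝ → F} (hf : IntegrableOn f (Ico 0 T) μ) {t : ℝ} (ht : t ∈ Icc 0 T) :
    HasKSIntegral f h 0 t (∫ x in Ico 0 t, σ x • f x ∂μ) := by
  borelize F
  have := hp.finite
  refine ⟨ht.1, fun ε hε => ?_⟩
  obtain ⟨δ, W, hδ, hWi, hW0, hW, hfW⟩ := exists_gauge_integral_le (μ.restrict (Ico 0 T)) hf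
    (half_pos hε)
  refine ⟨δ, fun t _ => hδ t, fun P hP => ?_⟩
  let H : ℝ → F := fun t => ∫ x in Ico 0 t, σ x • f x ∂μ
  let w : ℝ → ℝ := fun t => ∫ x in Ico 0 t, W x ∂μ
  have e : P.stieltjesSum f h - H t = P.sum fun τ s t => (h t - h s) • f τ - (H t - H s) := by
    rw [TaggedDivision.sum_sub, P.sum_increment, TaggedDivision.stieltjesSum_eq_sum]
    simp [H]
  have hwt : w t ≤ ε / 2 := by
    refine le_trans ?_ hW
    exact setIntegral_mono_set hWi (Eventually.of_forall fun x => hW0 x)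
      (Ico_subset_Ico_right ht.2).eventuallyLE
  calc ‖P.stieltjesSum f h - H t‖ = _ := by rw [e]
    _ ≤ _ := P.norm_sum_le _
    _ ≤ P.sum fun _ s t => w t - w s := by
        -- Each error is the integral of σ(x)(f(τ) - f(x)) over [s,r), hence at most the increment
        -- of the integral of `W`; these increments telescope.
        refine TaggedDivision.sum_le_sum hP fun τ s r hs hsτ hτr hr h1 h2 => ?_
        have hsr := hsτ.trans hτr
        have hrT := hr.trans ht.2
        have hsub : Ico s r ⊆ Ico 0 T := Ico_subset_Ico hs hrT
        have i1 : IntegrableOn (fun x => σ x • f x) (Ico s r) μ :=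
          hp.integrableOn_smul (hf.mono_set hsub)
        have i2 : IntegrableOn (fun x => σ x • f τ) (Ico s r) μ :=
          hp.integrable_sign.integrableOn.smul_const _
        rw [setIntegral_Ico_sub hWi hs hsr hrT,
          setIntegral_Ico_sub (hp.integrableOn_smul hf) hs hsr hrT, hp.sub_eq s r hs hsr hrT,
          ← integral_smul_const, ← integral_sub i2 i1]
        refine norm_integral_le_of_norm_le (IntegrableOn.mono_set hWi hsub) ?_
        have := ae_restrict_of_ae_restrict_of_subset hsub hfW
        filter_upwards [this, ae_restrict_mem measurableSet_Ico] with x hx hxI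
        rw [← smul_sub, hp.norm_smul, norm_sub_rev]
        exact hx τ (abs_lt.2 ⟨by linarith [hxI.1], by linarith [hxI.2]⟩)
    _ = w t := by rw [P.sum_increment]; simp [w]
    _ < ε := by linarith

end IsPolar

lemma HasKSIntegral.norm_le {F : Type*} [NormedAddCommGroup F] [NormedSpace ℝ F] {a b C : ℝ}
    {G : ℝ → F} {h m : ℝ → ℝ} {I : F} (hI : HasKSIntegral G h a b I)
    (hG : ∀ t ∈ Icc a b, ‖G t‖ ≤ C) (hC : 0 ≤ C)
    (hm : ∀ s t, a ≤ s → s ≤ t → t ≤ b → |h t - h s| ≤ m t - m s) :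
    ‖I‖ ≤ C * (m b - m a) := by
  refine le_of_forall_pos_le_add fun ε hε => ?_
  obtain ⟨δ, h0, H⟩ := hI.2 ε hε
  obtain ⟨P, hP⟩ := TaggedDivision.exists_isFine hI.1 h0
  have e1 : ‖P.stieltjesSum G h‖ ≤ C * (m b - m a) := by
    rw [← P.sum_increment, ← TaggedDivision.sum_mul_left, TaggedDivision.stieltjesSum_eq_sum]
    refine (P.norm_sum_le _).trans (TaggedDivision.sum_le_sum hP fun τ s t hs h1 h2 ht _ _ => ?_)
    rw [norm_smul, Real.norm_eq_abs, mul_comm]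
    exact mul_le_mul (hG τ ⟨hs.trans h1, h2.trans ht⟩) (hm s t hs (h1.trans h2) ht) (abs_nonneg _) hC
  have e2 := norm_sub_norm_le I (P.stieltjesSum G h)
  rw [norm_sub_rev] at e2
  linarith [H P hP]

/-- A function whose sums with respect to a measure are arbitrarily small vanishes almost
everywhere. -/
theorem ae_eq_zero_of_sum_small {T : ℝ} (hT : 0 < T) (μ : Measure ℝ) [IsFiniteMeasure μ] {ψ : ℝ → ℝ}
    (hψ : ∀ ε > 0, ∃ δ : ℝ → ℝ, (∀ t ∈ Icc 0 T, 0 < δ t) ∧ ∀ P : TaggedDivision 0 T, P.IsFine δ →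
      P.sum (fun τ s t => |ψ τ| * μ.real (Ico s t)) ≤ ε) :
    ∀ᵐ x ∂(μ.restrict (Ico 0 T)), ψ x = 0 := by
  have main : ∀ η > 0, μ {x | x ∈ Ico 0 T ∧ η < |ψ x|} = 0 := by
    intro η hη
    set E : Set ℝ := {x | x ∈ Ico 0 T ∧ η < |ψ x|}
    refine le_antisymm (ENNReal.le_of_forall_pos_le_add fun ε' hε' _ => ?_) bot_le
    rw [zero_add]
    have hε'' : (0 : ℝ) < ε' := hε'
    obtain ⟨δ, h0, H⟩ := hψ (η * ε') (by positivity)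
    -- On `En n` the gauge exceeds the mesh of the uniform grid with n + 1 cells. Every cell meeting
    -- `En n` can thus be tagged by one of its points there, giving a fine division whose sum is at
    -- least η μ(`En n`).
    let En : ℕ → Set ℝ := fun n => {x | x ∈ E ∧ T / (n + 1) < δ x}
    have hmono : Monotone En := fun m n hmn x hx => ⟨hx.1, lt_of_le_of_lt (by gcongr) hx.2⟩
    have hun : E = ⋃ n, En n := by
      refine Subset.antisymm (fun x hx => ?_) (iUnion_subset fun n x hx => hx.1)
      obtain ⟨n, hn⟩ := exists_nat_gt (T / δ x)
      have hδx := h0 x ⟨hx.1.1, hx.1.2.le⟩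
      rw [div_lt_iff₀ hδx] at hn
      refine mem_iUnion.2 ⟨n, hx, ?_⟩
      rw [div_lt_iff₀ (by positivity)]
      nlinarith
    rw [hun, hmono.measure_iUnion]
    refine iSup_le fun n => ?_
    have hN : (0 : ℝ) < (n : ℝ) + 1 := by positivity
    let p : ℕ → ℝ := fun j => j * (T / (n + 1))
    have hps : ∀ j, p (j + 1) = p j + T / (n + 1) := fun j => by simp only [p]; push_cast; ring
    have hTn : 0 < T / ((n : ℝ) + 1) := by positivity
    have hp0 : ∀ j, 0 ≤ p j := fun j => by positivity
    have hpN : p (n + 1) = T := by simp only [p]; push_cast; field_simp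
    have key : ∀ j ≤ n + 1, ∃ Q : TaggedDivision 0 (p j), Q.IsFine δ ∧
        η * μ.real (En n ∩ Ico 0 (p j)) ≤ Q.sum (fun τ s t => |ψ τ| * μ.real (Ico s t)) := by
      intro j
      induction j with
      | zero =>
        intro _
        have : p 0 = 0 := by simp [p]
        rw [this]
        exact ⟨TaggedDivision.nil 0, TaggedDivision.isFine_nil _, by simp [TaggedDivision.sum_nil]⟩
      | succ j ih =>
        intro hj
        obtain ⟨Q, hQ, hle⟩ := ih (by omega)
        have hpT : p (j + 1) ≤ T := by
          rw [← hpN]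
          simp only [p]
          gcongr
        have hstep : p j ≤ p (j + 1) := by linarith [hps j]
        have hsplit : μ.real (En n ∩ Ico 0 (p (j + 1))) ≤
            μ.real (En n ∩ Ico 0 (p j)) + μ.real (En n ∩ Ico (p j) (p (j + 1))) := by
          rw [← Ico_union_Ico_eq_Ico (hp0 j) hstep, inter_union_distrib_left]
          exact measureReal_union_le _ _
        suffices ∃ R : TaggedDivision (p j) (p (j + 1)), R.IsFine δ ∧
            η * μ.real (En n ∩ Ico (p j) (p (j + 1))) ≤
              R.sum (fun τ s t => |ψ τ| * μ.real (Ico s t)) by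
          obtain ⟨R, hR, hRle⟩ := this
          refine ⟨Q.append R, hQ.append hR, ?_⟩
          rw [TaggedDivision.sum_append]
          nlinarith
        by_cases hx : (En n ∩ Ico (p j) (p (j + 1))).Nonempty
        · obtain ⟨x, hxE, hxI⟩ := hx
          have hxI' : x ∈ Icc (p j) (p (j + 1)) := Ico_subset_Icc_self hxI
          refine ⟨TaggedDivision.single hxI',
            TaggedDivision.isFine_single _ fun y hy => ?_, ?_⟩
          · have := hxE.2
            have := hps j
            exact ⟨by linarith [hy.1, hxI.2], by linarith [hy.2, hxI.1]⟩
          · rw [TaggedDivision.sum_single]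
            exact mul_le_mul hxE.1.2.le (measureReal_mono inter_subset_right) measureReal_nonneg
              (abs_nonneg _)
        · obtain ⟨R, hR⟩ := TaggedDivision.exists_isFine hstep (δ := δ) fun t ht =>
            h0 t ⟨(hp0 j).trans ht.1, ht.2.trans hpT⟩
          refine ⟨R, hR, ?_⟩
          rw [not_nonempty_iff_eq_empty.1 hx]
          simp only [measureReal_empty, mul_zero]
          exact Finset.sum_nonneg fun i _ => mul_nonneg (abs_nonneg _) measureReal_nonneg
    have hfin : ∀ b (hb : b = T) (Q : TaggedDivision 0 b), Q.IsFine δ →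
        Q.sum (fun τ s t => |ψ τ| * μ.real (Ico s t)) ≤ η * ε' := by
      rintro b rfl Q hQ
      exact H Q hQ
    obtain ⟨Q, hQ, hle⟩ := key (n + 1) le_rfl
    have h1 := hle.trans (hfin _ hpN Q hQ)
    rw [hpN, inter_eq_left.2 fun x hx => hx.1.1] at h1
    have h2 : μ.real (En n) ≤ ε' := le_of_mul_le_mul_left h1 hη
    rw [measureReal_def] at h2
    rw [← ENNReal.ofReal_coe_nnreal]
    exact (ENNReal.le_ofReal_iff_toReal_le (measure_ne_top _ _) hε''.le).2 h2
  have hall : ∀ k : ℕ, ∀ᵐ x ∂(μ.restrict (Ico 0 T)), |ψ x| ≤ 1 / ((k : ℝ) + 1) := by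
    intro k
    rw [ae_restrict_iff' measurableSet_Ico, ae_iff]
    refine measure_mono_null (fun x hx => ?_) (main (1 / ((k : ℝ) + 1)) (by positivity))
    simpa [and_assoc] using hx
  filter_upwards [ae_all_iff.2 hall] with x hx
  exact abs_nonpos_iff.1 (ge_of_tendsto' tendsto_one_div_add_atTop_nhds_zero_nat hx)

namespace IsPolar

variable {T : ℝ} {h : ℝ → ℝ} {μ : Measure ℝ} {σ : ℝ → ℝ}

/-- Bounded Kurzweil–Stieltjes integrable functions are measurable with respect to the Stieltjes
measure. -/
theorem aemeasurable_of_hasKSIntegral (hp : IsPolar T h μ σ) (hT : 0 < T) {f H : ℝ → ℝ} {C : ℝ}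
    (hC : ∀ t ∈ Icc 0 T, |f t| ≤ C) (hH : ∀ t ∈ Icc 0 T, HasKSIntegral f h 0 t (H t)) :
    AEMeasurable f (μ.restrict (Ico 0 T)) := by
  have := hp.finite
  have hC0 : 0 ≤ C := (abs_nonneg _).trans (hC 0 ⟨le_rfl, hT.le⟩)
  have hHsub : ∀ s t, 0 ≤ s → s ≤ t → t ≤ T → |H t - H s| ≤ C * μ.real (Ico s t) := by
    intro s t hs hst ht
    have h1 := ((hH s ⟨hs, hst.trans ht⟩).sub (hH t ⟨hs.trans hst, ht⟩) hst).norm_le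
      (m := fun t => μ.real (Ico 0 t)) (fun r hr => hC r ⟨hs.trans hr.1, hr.2.trans ht⟩) hC0
      fun s' t' hs' hst' ht' => by
        rw [measureReal_Ico_sub (hs.trans hs') hst']
        exact hp.abs_sub_le (hs.trans hs') hst' (ht'.trans ht)
    rwa [measureReal_Ico_sub hs hst] at h1
  obtain ⟨φ, hφm, hφi, hφ⟩ := exists_density hT.le μ H hC0 hHsub
  have hzero : ∀ᵐ x ∂(μ.restrict (Ico 0 T)), f x * σ x - φ x = 0 := by
    -- For a small interval I tagged at τ, f(τ)σ(τ)μ(I) ≈ f(τ)Δh ≈ ΔH ≈ φ(τ)μ(I). The middle error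
    -- is summable by Saks–Henstock and the outer ones by the gauges for σ and φ. The error from σ
    -- is multiplied by the bound C, whence the total weight C + 2.
    refine ae_eq_zero_of_sum_small hT μ fun ε hε => ?_
    have hε' : 0 < ε / (C + 2) := by positivity
    obtain ⟨δ₁, h₁, H₁⟩ := HasKSIntegral.saks_henstock hT.le hH hε'
    obtain ⟨δ₂, W₂, h₂, i₂, p₂, j₂, H₂⟩ := exists_gauge_integral_le μ hφi hε'
    obtain ⟨δ₃, W₃, h₃, i₃, p₃, j₃, H₃⟩ := exists_gauge_integral_le μ hp.integrable_sign hε'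
    refine ⟨fun t => min (δ₁ t) (min (δ₂ t) (δ₃ t)),
      fun t ht => lt_min (h₁ t ht) (lt_min (h₂ t) (h₃ t)), fun P hP => ?_⟩
    have e1 := H₁ P (hP.mono fun t _ => min_le_left _ _)
    have hw : ∀ W : ℝ → ℝ, Integrable W μ → (∀ x, 0 ≤ W x) → ∫ x, W x ∂μ ≤ ε / (C + 2) →
        P.sum (fun _ s t => (∫ x in Ico 0 t, W x ∂μ) - ∫ x in Ico 0 s, W x ∂μ) ≤ ε / (C + 2) := by
      intro W hW hW0 hWε
      rw [P.sum_increment]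
      simp only [Ico_self, Measure.restrict_empty, integral_zero_measure, sub_zero]
      exact (setIntegral_le_integral hW (Eventually.of_forall hW0)).trans hWε
    have e2 := hw W₂ i₂ p₂ j₂
    have e3 := hw W₃ i₃ p₃ j₃
    calc _ ≤ P.sum (fun τ s t => |(h t - h s) * f τ - (H t - H s)| +
          (((∫ x in Ico 0 t, W₂ x ∂μ) - ∫ x in Ico 0 s, W₂ x ∂μ) +
          C * ((∫ x in Ico 0 t, W₃ x ∂μ) - ∫ x in Ico 0 s, W₃ x ∂μ))) := by
          refine TaggedDivision.sum_le_sum hP fun τ s t hs hsτ hτt ht f1 f2 => ?_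
          have hst := hsτ.trans hτt
          have hnear : ∀ (ϕ W : ℝ → ℝ) (δ : ℝ → ℝ), Integrable ϕ μ → Integrable W μ →
              min (δ₁ τ) (min (δ₂ τ) (δ₃ τ)) ≤ δ τ →
              (∀ᵐ x ∂μ, ∀ τ, |x - τ| < δ τ → ‖ϕ x - ϕ τ‖ ≤ W x) →
              |(∫ x in Ico s t, ϕ x ∂μ) - ϕ τ * μ.real (Ico s t)| ≤
                (∫ x in Ico 0 t, W x ∂μ) - ∫ x in Ico 0 s, W x ∂μ := by
            intro ϕ W δ hϕ hW hδ hae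
            have : ϕ τ * μ.real (Ico s t) = ∫ x in Ico s t, ϕ τ ∂μ := by
              rw [setIntegral_const, smul_eq_mul, mul_comm]
            rw [setIntegral_Ico_sub hW.integrableOn hs hst ht, this,
              ← integral_sub hϕ.integrableOn (integrable_const _).integrableOn]
            refine norm_integral_le_of_norm_le (f := fun x => ϕ x - ϕ τ) hW.integrableOn ?_
            filter_upwards [ae_restrict_of_ae hae, ae_restrict_mem measurableSet_Ico] with x hx hxI
            exact hx τ (abs_lt.2 ⟨by linarith [hxI.1], by linarith [hxI.2]⟩)
          have n2 := hnear φ W₂ δ₂ hφi i₂ ((min_le_right _ _).trans (min_le_left _ _)) H₂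
          have n3 := hnear σ W₃ δ₃ hp.integrable_sign i₃
            ((min_le_right _ _).trans (min_le_right _ _)) H₃
          rw [← hφ s t hs hst ht] at n2
          rw [← hp.sub_eq s t hs hst ht] at n3
          have n3' : |f τ * ((h t - h s) - σ τ * μ.real (Ico s t))| ≤
              C * ((∫ x in Ico 0 t, W₃ x ∂μ) - ∫ x in Ico 0 s, W₃ x ∂μ) := by
            rw [abs_mul]
            exact mul_le_mul (hC τ ⟨hs.trans hsτ, hτt.trans ht⟩) n3 (abs_nonneg _) hC0
          have e : |f τ * σ τ - φ τ| * μ.real (Ico s t) = |((h t - h s) * f τ - (H t - H s)) +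
              ((H t - H s - φ τ * μ.real (Ico s t)) -
                f τ * ((h t - h s) - σ τ * μ.real (Ico s t)))| := by
            rw [← abs_of_nonneg (measureReal_nonneg (μ := μ) (s := Ico s t)), ← abs_mul,
              abs_of_nonneg (measureReal_nonneg (μ := μ) (s := Ico s t))]
            congr 1
            ring
          rw [e]
          refine (abs_add_le _ _).trans (add_le_add le_rfl ((abs_sub _ _).trans ?_))
          exact add_le_add n2 n3'
      _ ≤ ε / (C + 2) + (ε / (C + 2) + C * (ε / (C + 2))) := by
          rw [TaggedDivision.sum_add, TaggedDivision.sum_add, TaggedDivision.sum_mul_left]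
          gcongr
      _ = ε := by field_simp; ring
  -- Since σ² = 1, the identity fσ = φ solves to f = σφ, which is measurable.
  refine ⟨fun x => σ x * φ x, hp.meas.mul hφm, ?_⟩
  filter_upwards [hzero] with x hx
  have hσ : σ x * σ x = 1 := by rw [← abs_mul_abs_self, hp.abs_eq, one_mul]
  rw [← sub_eq_zero.1 hx]
  linear_combination (-f x) * hσ

/-- For bounded functions, Kurzweil–Stieltjes integrability means measurability with respect to the
Stieltjes measure, and the integral is a Lebesgue integral. -/
theorem integrableOn_of_hasKSIntegral (hp : IsPolar T h μ σ) (hT : 0 < T) {n : ℕ} {f H : ℝ → Vec n}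
    {C : ℝ} (hC : ∀ t ∈ Icc 0 T, ‖f t‖ ≤ C) (hH : ∀ t ∈ Icc 0 T, HasKSIntegral f h 0 t (H t)) :
    IntegrableOn f (Ico 0 T) μ ∧ ∀ t ∈ Icc 0 T, H t = ∫ x in Ico 0 t, σ x • f x ∂μ := by
  have := hp.finite
  have hm : AEMeasurable f (μ.restrict (Ico 0 T)) := by
    have h1 : AEMeasurable (fun x i => f x i) (μ.restrict (Ico 0 T)) :=
      aemeasurable_pi_lambda _ fun i => hp.aemeasurable_of_hasKSIntegral hT (C := C)
        (H := fun t => H t i)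
        (fun t ht => (PiLp.norm_apply_le (f t) i).trans (hC t ht))
        fun t ht => (hH t ht).clm_comp (EuclideanSpace.proj i)
    exact (WithLp.measurable_toLp 2 _).comp_aemeasurable h1
  have hi : IntegrableOn f (Ico 0 T) μ := by
    refine Integrable.of_bound hm.aestronglyMeasurable C ?_
    filter_upwards [ae_restrict_mem measurableSet_Ico] with x hx using hC x ⟨hx.1, hx.2.le⟩
  exact ⟨hi, fun t ht => (hH t ht).unique (hp.hasKSIntegral hi ht)⟩

end IsPolar

end MeasureDE

/-! ### Regulated functions -/

namespace MeasureDE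

section Regulated

variable {E : Type*} [NormedAddCommGroup E]

/-- Compactness of [0,T]. Only one-sided local bounds are required, so that indefinite integrals can
be treated before their one-sided limits are known. -/
lemma exists_bound_of_locally_bounded {T : ℝ} {x : ℝ → E}
    (hl : ∀ t ∈ Ioc 0 T, ∃ C, ∀ᶠ s in 𝓝[<] t, ‖x s‖ ≤ C)
    (hr : ∀ t ∈ Ico 0 T, ∃ C, ∀ᶠ s in 𝓝[>] t, ‖x s‖ ≤ C) : ∃ C, ∀ t ∈ Icc 0 T, ‖x t‖ ≤ C := by
  refine isCompact_Icc.induction_on (p := fun s => ∃ C, ∀ t ∈ s, ‖x t‖ ≤ C) ⟨0, by simp⟩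
    (fun s t hst ⟨C, hC⟩ => ⟨C, fun r hr => hC r (hst hr)⟩)
    (fun s t ⟨C, hC⟩ ⟨D, hD⟩ => ⟨max C D, fun r hr => hr.elim
      (fun h => (hC r h).trans (le_max_left _ _)) fun h => (hD r h).trans (le_max_right _ _)⟩)
    fun t ht => ?_
  obtain ⟨C, hC⟩ : ∃ C, ∀ᶠ s in 𝓝[<] t, s ∈ Icc 0 T → ‖x s‖ ≤ C := by
    rcases ht.1.eq_or_lt with rfl | h0
    · refine ⟨0, ?_⟩
      filter_upwards [self_mem_nhdsWithin] with s hs hs'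
      exact absurd hs'.1 (not_le.2 hs)
    · obtain ⟨C, hC⟩ := hl t ⟨h0, ht.2⟩
      exact ⟨C, hC.mono fun s hs _ => hs⟩
  obtain ⟨D, hD⟩ : ∃ D, ∀ᶠ s in 𝓝[>] t, s ∈ Icc 0 T → ‖x s‖ ≤ D := by
    rcases ht.2.eq_or_lt with rfl | h0
    · refine ⟨0, ?_⟩
      filter_upwards [self_mem_nhdsWithin] with s hs hs'
      exact absurd hs'.2 (not_le.2 hs)
    · obtain ⟨C, hC⟩ := hr t ⟨ht.1, h0⟩
      exact ⟨C, hC.mono fun s hs _ => hs⟩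
  refine ⟨Icc 0 T ∩ {s | s ∈ Icc 0 T → ‖x s‖ ≤ max ‖x t‖ (max C D)},
    inter_mem_nhdsWithin _ ?_, max ‖x t‖ (max C D),
    fun s hs => hs.2 hs.1⟩
  rw [← nhdsLT_sup_nhdsGE, ← Ioi_insert, nhdsWithin_insert]
  refine ⟨?_, ?_, ?_⟩
  · filter_upwards [hC] with s hs h using (hs h).trans (by simp)
  · exact mem_pure.2 fun _ => le_max_left _ _
  · filter_upwards [hD] with s hs h using (hs h).trans (by simp)

lemma eventually_norm_le_of_tendsto {ι : Type*} {l : Filter ι} {x : ι → E} {a : E}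
    (h : Tendsto x l (𝓝 a)) : ∃ C, ∀ᶠ s in l, ‖x s‖ ≤ C :=
  ⟨‖a‖ + 1, (h.norm.eventually (gt_mem_nhds (lt_add_one _))).mono fun _ h => le_of_lt h⟩

lemma RegulatedOn.exists_bound {T : ℝ} {x : ℝ → E} (hx : RegulatedOn x 0 T) :
    ∃ C, ∀ t ∈ Icc 0 T, ‖x t‖ ≤ C :=
  exists_bound_of_locally_bounded
    (fun t ht => let ⟨_, h⟩ := hx.1 t ht; eventually_norm_le_of_tendsto h)
    fun t ht => let ⟨_, h⟩ := hx.2 t ht; eventually_norm_le_of_tendsto h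

lemma _root_.BoundedVariationOn.regulatedOn [CompleteSpace E] {T : ℝ} {x : ℝ → E}
    (hx : BoundedVariationOn x (Icc 0 T)) : RegulatedOn x 0 T := by
  constructor
  · intro t ht
    obtain ⟨l, hl⟩ := hx.exists_tendsto_left t
    refine ⟨l, hl.mono_left (nhdsWithin_le_iff.2 ?_)⟩
    filter_upwards [Ioo_mem_nhdsLT ht.1] with s hs
    exact ⟨⟨hs.1.le, hs.2.le.trans ht.2⟩, hs.2⟩
  · intro t ht
    obtain ⟨l, hl⟩ := hx.exists_tendsto_right t
    refine ⟨l, hl.mono_left (nhdsWithin_le_iff.2 ?_)⟩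
    filter_upwards [Ioo_mem_nhdsGT ht.2] with s hs
    exact ⟨⟨ht.1.trans hs.1.le, hs.2.le⟩, hs.1⟩

lemma RegulatedOn.add {T : ℝ} {x y : ℝ → E} (hx : RegulatedOn x 0 T) (hy : RegulatedOn y 0 T) :
    RegulatedOn (fun t => x t + y t) 0 T :=
  ⟨fun t ht => let ⟨_, h⟩ := hx.1 t ht; let ⟨_, h'⟩ := hy.1 t ht; ⟨_, h.add h'⟩,
    fun t ht => let ⟨_, h⟩ := hx.2 t ht; let ⟨_, h'⟩ := hy.2 t ht; ⟨_, h.add h'⟩⟩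

lemma RegulatedOn.const_smul [NormedSpace ℝ E] {T : ℝ} {x : ℝ → E} (hx : RegulatedOn x 0 T)
    (c : ℝ) : RegulatedOn (fun t => c • x t) 0 T :=
  ⟨fun t ht => let ⟨_, h⟩ := hx.1 t ht; ⟨_, h.const_smul c⟩,
    fun t ht => let ⟨_, h⟩ := hx.2 t ht; ⟨_, h.const_smul c⟩⟩

lemma regulatedOn_const {T : ℝ} (c : E) : RegulatedOn (fun _ => c) 0 T :=
  ⟨fun _ _ => ⟨c, tendsto_const_nhds⟩, fun _ _ => ⟨c, tendsto_const_nhds⟩⟩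

end Regulated

/-! ### Step approximation from the left and superposition -/

section Step

/-- The left neighbour of `r` in the partition of `[0, t]` into `m + 1` equal parts. -/
noncomputable def stepPoint (t : ℝ) (m : ℕ) (r : ℝ) : ℝ := (⌈r / (t / (m + 1))⌉ - 1) * (t / (m + 1))

lemma stepPoint_lt {t r : ℝ} (ht : 0 < t) (m : ℕ) : stepPoint t m r < r := by
  have h0 : 0 < t / ((m : ℝ) + 1) := by positivity
  have := Int.ceil_lt_add_one (r / (t / ((m : ℝ) + 1)))
  rw [stepPoint, ← lt_div_iff₀ h0]
  linarith

lemma le_stepPoint {t r : ℝ} (ht : 0 < t) (m : ℕ) : r - t / (m + 1) ≤ stepPoint t m r := by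
  have h0 : 0 < t / ((m : ℝ) + 1) := by positivity
  have := Int.le_ceil (r / (t / ((m : ℝ) + 1)))
  rw [div_le_iff₀ h0] at this
  rw [stepPoint]
  linarith

lemma stepPoint_nonneg {t r : ℝ} (ht : 0 < t) (hr : 0 < r) (m : ℕ) : 0 ≤ stepPoint t m r := by
  have h0 : 0 < t / ((m : ℝ) + 1) := by positivity
  have : 0 < ⌈r / (t / ((m : ℝ) + 1))⌉ := Int.ceil_pos.2 (by positivity)
  have : (1 : ℝ) ≤ ⌈r / (t / ((m : ℝ) + 1))⌉ := by exact_mod_cast this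
  exact mul_nonneg (by linarith) h0.le

lemma tendsto_stepPoint {E : Type*} [TopologicalSpace E] {t r : ℝ} (ht : 0 < t) {x : ℝ → E}
    (hx : ContinuousWithinAt x (Iic r) r) :
    Tendsto (fun m => x (stepPoint t m r)) atTop (𝓝 (x r)) := by
  refine hx.tendsto.comp (tendsto_nhdsWithin_iff.2 ⟨?_, Eventually.of_forall fun m =>
    (stepPoint_lt ht m).le⟩)
  have h1 : Tendsto (fun m : ℕ => r - t / ((m : ℝ) + 1)) atTop (𝓝 r) := by
    have := (tendsto_one_div_add_atTop_nhds_zero_nat (𝕜 := ℝ)).const_mul t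
    simpa [div_eq_mul_inv] using this.const_sub r
  exact tendsto_of_tendsto_of_tendsto_of_le_of_le h1 tendsto_const_nhds (le_stepPoint ht)
    fun m => (stepPoint_lt ht m).le

lemma stepPoint_eq {t r : ℝ} (ht : 0 < t) {m j : ℕ}
    (hr : r ∈ Ioc (j * (t / ((m : ℝ) + 1))) ((j + 1 : ℕ) * (t / ((m : ℝ) + 1)))) :
    stepPoint t m r = j * (t / (m + 1)) := by
  have h0 : 0 < t / ((m : ℝ) + 1) := by positivity
  have : ⌈r / (t / ((m : ℝ) + 1))⌉ = (j : ℤ) + 1 := by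
    rw [Int.ceil_eq_iff]
    push_cast
    constructor
    · rw [lt_div_iff₀ h0]
      simpa using hr.1
    · rw [div_le_iff₀ h0]
      simpa using hr.2
  rw [stepPoint, this]
  push_cast
  ring

variable {E E' : Type*}

/-- There are countably many cells, and on each the first argument of F is frozen. Cells missing
(0,T] are treated apart, because their frozen value need not lie in Ω. -/
lemma aemeasurable_comp_stepPoint [MeasurableSpace E'] {T : ℝ} (hT : 0 < T) {κ : Measure ℝ} {Om : Set E}
    {F : E → ℝ → E'} {x : ℝ → E}
    (hF : ∀ y ∈ Om, AEMeasurable (F y) (κ.restrict (Ioc 0 T)))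
    (hxO : ∀ t ∈ Icc 0 T, x t ∈ Om) (m : ℕ) :
    AEMeasurable (fun t => F (x (stepPoint T m t)) t) (κ.restrict (Ioc 0 T)) := by
  have hcov : Ioc 0 T = ⋃ j : ℤ, Ioc 0 T ∩ {t | ⌈t / (T / ((m : ℝ) + 1))⌉ = j} := by
    ext t
    simp
  have hmeas : ∀ j : ℤ, MeasurableSet {t : ℝ | ⌈t / (T / ((m : ℝ) + 1))⌉ = j} := fun j =>
    (Int.measurable_ceil.comp (measurable_id.div_const _)) (measurableSet_singleton j)
  rw [hcov, aemeasurable_iUnion_iff]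
  intro j
  have hm := (measurableSet_Ioc (a := (0 : ℝ)) (b := T)).inter (hmeas j)
  rcases (Ioc 0 T ∩ {t : ℝ | ⌈t / (T / ((m : ℝ) + 1))⌉ = j}).eq_empty_or_nonempty with he | ⟨t₀, h₀⟩
  · rw [he, Measure.restrict_empty]
    exact aemeasurable_zero_measure
  · have hmem := hxO (stepPoint T m t₀) ⟨stepPoint_nonneg hT h₀.1.1 m,
      (stepPoint_lt hT m).le.trans h₀.1.2⟩
    refine ((hF _ hmem).mono_measure (Measure.restrict_mono inter_subset_left le_rfl)).congr ?_
    filter_upwards [ae_restrict_mem hm] with t ht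
    have e1 : ⌈t / (T / ((m : ℝ) + 1))⌉ = j := ht.2
    have e2 : ⌈t₀ / (T / ((m : ℝ) + 1))⌉ = j := h₀.2
    simp only [stepPoint, e1, e2]

lemma tendsto_comp_stepPoint [TopologicalSpace E] [TopologicalSpace E'] {T : ℝ} (hT : 0 < T) {Om : Set E} {F : E → ℝ → E'} {x : ℝ → E}
    (hFc : ∀ t ∈ Ioc 0 T, ContinuousOn (fun y => F y t) Om)
    (hx : ∀ t ∈ Ioc 0 T, ContinuousWithinAt x (Iic t) t) (hxO : ∀ t ∈ Icc 0 T, x t ∈ Om)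
    {t : ℝ} (ht : t ∈ Ioc 0 T) :
    Tendsto (fun m => F (x (stepPoint T m t)) t) atTop (𝓝 (F (x t) t)) := by
  refine (hFc t ht (x t) (hxO t ⟨ht.1.le, ht.2⟩)).tendsto.comp (tendsto_nhdsWithin_iff.2
    ⟨tendsto_stepPoint hT (hx t ht), Eventually.of_forall fun m => hxO _ ?_⟩)
  exact ⟨stepPoint_nonneg hT ht.1 m, (stepPoint_lt hT m).le.trans ht.2⟩

/-- Superposition of a Carathéodory function and a left-continuous function. -/
lemma aemeasurable_superposition [TopologicalSpace E] [TopologicalSpace E']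
    [TopologicalSpace.PseudoMetrizableSpace E'] [MeasurableSpace E'] [BorelSpace E'] {T : ℝ} (hT : 0 < T) {κ : Measure ℝ} {Om : Set E}
    {F : E → ℝ → E'} {x : ℝ → E}
    (hF : ∀ y ∈ Om, AEMeasurable (F y) (κ.restrict (Ioc 0 T)))
    (hFc : ∀ t ∈ Ioc 0 T, ContinuousOn (fun y => F y t) Om)
    (hx : ∀ t ∈ Ioc 0 T, ContinuousWithinAt x (Iic t) t) (hxO : ∀ t ∈ Icc 0 T, x t ∈ Om) :
    AEMeasurable (fun t => F (x t) t) (κ.restrict (Ioc 0 T)) := by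
  refine aemeasurable_of_tendsto_metrizable_ae atTop (aemeasurable_comp_stepPoint hT hF hxO) ?_
  filter_upwards [ae_restrict_mem measurableSet_Ioc] with t ht
  exact tendsto_comp_stepPoint hT hFc hx hxO ht

end Step

lemma aemeasurable_of_leftCont {n : ℕ} {T : ℝ} (hT : 0 < T) (κ : Measure ℝ) {x : ℝ → Vec n}
    (hx : ∀ t ∈ Ioc 0 T, ContinuousWithinAt x (Iic t) t) :
    AEMeasurable x (κ.restrict (Ioc 0 T)) :=
  aemeasurable_superposition (Om := univ) (F := fun y _ => y) hT
    (fun _ _ => aemeasurable_const) (fun _ _ => continuousOn_id) hx fun _ _ => mem_univ _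

lemma integrableOn_Ioc_of_leftCont {n : ℕ} {T C : ℝ} (hT : 0 < T) (κ : Measure ℝ)
    [IsFiniteMeasure (κ.restrict (Ioc 0 T))] {x : ℝ → Vec n}
    (hx : ∀ t ∈ Ioc 0 T, ContinuousWithinAt x (Iic t) t) (hC : ∀ t ∈ Icc 0 T, ‖x t‖ ≤ C) :
    IntegrableOn x (Ioc 0 T) κ := by
  refine Integrable.of_bound (aemeasurable_of_leftCont hT κ hx).aestronglyMeasurable C ?_
  filter_upwards [ae_restrict_mem measurableSet_Ioc] with t ht using hC t ⟨ht.1.le, ht.2⟩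

/-! ### Distributional derivatives and test functions -/

section DuBoisReymond

/-- The du Bois-Reymond lemma: a function which annihilates all derivatives of test functions is
almost everywhere constant. -/
theorem ae_const_of_forall_integral_deriv_smul_eq_zero {E : Type*} [NormedAddCommGroup E]
    [NormedSpace ℝ E] [CompleteSpace E] {T : ℝ} (hT : 0 < T) {u : ℝ → E}
    (hu : IntervalIntegrable u volume 0 T)
    (h : ∀ ψ : ℝ → ℝ, ContDiff ℝ ∞ ψ → (∀ t, t ∉ Ioo 0 T → ψ t = 0) →
      ∫ t in (0 : ℝ)..T, deriv ψ t • u t = 0) :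
    ∃ c, ∀ᵐ t, t ∈ Ioo 0 T → u t = c := by
  let bump : ContDiffBump (T / 2) := ⟨T / 8, T / 4, by positivity, by linarith⟩
  let χ : ℝ → ℝ := bump.normed volume
  have hχ : ContDiff ℝ ∞ χ := bump.contDiff_normed
  have hχs : ∀ t, t ∉ Ioo 0 T → χ t = 0 := by
    intro t ht
    by_contra h0
    have : t ∈ Function.support χ := h0
    rw [bump.support_normed_eq, Real.ball_eq_Ioo] at this
    exact ht ⟨by change T / 2 - T / 4 < t ∧ _ at this; linarith [this.1],
      by change _ ∧ t < T / 2 + T / 4 at this; linarith [this.2]⟩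
  have hzero : ∀ ψ : ℝ → ℝ, (∀ t, t ∉ Ioo 0 T → ψ t = 0) → ∫ t in (0 : ℝ)..T, ψ t = ∫ t, ψ t := by
    intro ψ hψ
    rw [intervalIntegral.integral_of_le hT.le]
    exact setIntegral_eq_integral_of_forall_compl_eq_zero fun t ht =>
      hψ t fun ht' => ht ⟨ht'.1, ht'.2.le⟩
  have hχ1 : ∫ t in (0 : ℝ)..T, χ t = 1 := by
    rw [hzero χ hχs]
    exact bump.integral_normed
  set c := ∫ t in (0 : ℝ)..T, χ t • u t with hc
  have hint : ∀ ψ : ℝ → ℝ, Continuous ψ → IntervalIntegrable (fun t => ψ t • u t) volume 0 T :=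
    fun ψ hψ => hu.continuousOn_smul hψ.continuousOn
  refine ⟨c, ?_⟩
  have hloc : LocallyIntegrableOn (fun t => u t - c) (Ioo 0 T) := by
    refine (IntegrableOn.mono_set ?_ Ioo_subset_Ioc_self).locallyIntegrableOn
    exact ((intervalIntegrable_iff_integrableOn_Ioc_of_le hT.le).1
      (hu.sub intervalIntegrable_const))
  have key := isOpen_Ioo.ae_eq_zero_of_integral_contDiff_smul_eq_zero hloc fun ψ hψ hψc hψs => ?_
  · filter_upwards [key] with t ht htI using sub_eq_zero.1 (ht htI)
  have hψ0 : ∀ t, t ∉ Ioo 0 T → ψ t = 0 := fun t ht =>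
    image_eq_zero_of_notMem_tsupport fun ht' => ht (hψs ht')
  set a := ∫ t in (0 : ℝ)..T, ψ t with ha
  -- Subtracting the right multiple of χ makes the mean value zero, so the primitive of θ vanishes
  -- outside (0,T) and is an admissible test function. The pairing of χ with u is the constant
  -- sought.
  let θ : ℝ → ℝ := fun t => ψ t - a * χ t
  have hθ : ContDiff ℝ ∞ θ := hψ.sub (contDiff_const.mul hχ)
  have hθ0 : ∀ t, t ∉ Ioo 0 T → θ t = 0 := fun t ht => by simp [θ, hψ0 t ht, hχs t ht]
  let Ψ : ℝ → ℝ := fun t => ∫ s in (0 : ℝ)..t, θ s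
  have hΨd : ∀ t, HasDerivAt Ψ (θ t) t := fun t =>
    intervalIntegral.integral_hasDerivAt_right (hθ.continuous.intervalIntegrable _ _)
      (hθ.continuous.stronglyMeasurableAtFilter _ _) hθ.continuous.continuousAt
  have hΨ' : deriv Ψ = θ := funext fun t => (hΨd t).deriv
  have hΨ : ContDiff ℝ ∞ Ψ :=
    contDiff_infty_iff_deriv.2 ⟨fun t => (hΨd t).differentiableAt, by rwa [hΨ']⟩
  have hΨT : Ψ T = 0 := by
    simp only [Ψ, θ]
    rw [intervalIntegral.integral_sub (hψ.continuous.intervalIntegrable _ _)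
      ((hχ.continuous.intervalIntegrable _ _).const_mul a),
      intervalIntegral.integral_const_mul, hχ1, ← ha]
    ring
  have hΨ0 : ∀ t, t ∉ Ioo 0 T → Ψ t = 0 := by
    intro t ht
    rcases le_or_gt t 0 with h0 | h0
    · simp only [Ψ]
      rw [intervalIntegral.integral_symm, neg_eq_zero]
      refine (intervalIntegral.integral_congr_ae (Eventually.of_forall fun s hs => ?_)).trans
        intervalIntegral.integral_zero
      rw [uIoc_of_le h0] at hs
      exact hθ0 s fun hs' => absurd hs'.1 (not_lt.2 hs.2)
    · have hTt : T ≤ t := not_lt.1 fun h => ht ⟨h0, h⟩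
      have : Ψ t = Ψ T + ∫ s in T..t, θ s :=
        (intervalIntegral.integral_add_adjacent_intervals (hθ.continuous.intervalIntegrable _ _)
          (hθ.continuous.intervalIntegrable _ _)).symm
      rw [this, hΨT, zero_add]
      refine (intervalIntegral.integral_congr_ae (Eventually.of_forall fun s hs => ?_)).trans
        intervalIntegral.integral_zero
      rw [uIoc_of_le hTt] at hs
      exact hθ0 s fun hs' => absurd hs'.2 (not_lt.2 hs.1.le)
  have h1 := h Ψ hΨ hΨ0
  rw [hΨ'] at h1
  have h2 : ∫ t in (0 : ℝ)..T, θ t • u t = (∫ t in (0 : ℝ)..T, ψ t • u t) - a • c := by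
    simp only [θ, sub_smul, mul_smul]
    have := intervalIntegral.integral_sub (hint ψ hψ.continuous) ((hint χ hχ.continuous).smul a)
    simp only [Pi.smul_apply] at this
    rw [this, intervalIntegral.integral_smul]
  have h3 : ∫ t in (0 : ℝ)..T, ψ t • (u t - c) = (∫ t in (0 : ℝ)..T, ψ t • u t) - a • c := by
    simp only [smul_sub]
    have hψc : Continuous fun t => ψ t • c := hψ.continuous.smul continuous_const
    rw [intervalIntegral.integral_sub (hint ψ hψ.continuous) (hψc.intervalIntegrable _ _),
      intervalIntegral.integral_smul_const]
  have h4 : ∫ t, ψ t • (u t - c) = ∫ t in (0 : ℝ)..T, ψ t • (u t - c) := by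
    rw [intervalIntegral.integral_of_le hT.le]
    refine (setIntegral_eq_integral_of_forall_compl_eq_zero fun t ht => ?_).symm
    rw [hψ0 t fun ht' => ht ⟨ht'.1, ht'.2.le⟩, zero_smul]
  rw [h4, h3, ← h2, h1]

/-- Integration by parts for absolutely continuous functions: f is merely integrable, so its
primitive is differentiable only almost everywhere. The boundary terms vanish with ψ. -/
lemma integral_primitive_mul_deriv {T : ℝ} {f : ℝ → ℝ}
    (hf : IntervalIntegrable f volume 0 T) {ψ : ℝ → ℝ} (hψ : ContDiff ℝ ∞ ψ)
    (hψ0 : ∀ t, t ∉ Ioo 0 T → ψ t = 0) :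
    ∫ t in (0 : ℝ)..T, (∫ s in (0 : ℝ)..t, f s) * deriv ψ t = - ∫ t in (0 : ℝ)..T, f t * ψ t := by
  have h1 := hf.absolutelyContinuousOnInterval_intervalIntegral (c := 0) left_mem_uIcc
  have h2 : AbsolutelyContinuousOnInterval ψ 0 T :=
    (hψ.of_le (by simp)).contDiffOn.absolutelyContinuousOnInterval
  rw [h1.integral_mul_deriv_eq_deriv_mul h2, hψ0 T (by simp), hψ0 0 (by simp), mul_zero, mul_zero,
    sub_zero, zero_sub]
  congr 1
  refine intervalIntegral.integral_congr_ae ?_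
  filter_upwards [hf.ae_hasDerivAt_integral] with t ht htI
  rw [(ht (uIoc_subset_uIcc htI) 0 left_mem_uIcc).deriv]

end DuBoisReymond

end MeasureDE

/-! ### From the distributional to the integral equation -/

namespace MeasureDE

/-- Every left neighbourhood of t has positive measure, hence contains points where u = c, and
left-continuity carries this value to t. -/
lemma eq_const_of_leftCont {E : Type*} [TopologicalSpace E] [T2Space E] {T : ℝ} {u : ℝ → E} {c : E}
    (hu : ∀ t ∈ Ioc 0 T, ContinuousWithinAt u (Iic t) t)
    (h : ∀ᵐ t, t ∈ Ioo 0 T → u t = c) : ∀ t ∈ Ioc 0 T, u t = c := by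
  intro t ht
  have h1 : ∃ᶠ s in 𝓝[<] t, u s = c := by
    intro hn
    obtain ⟨a, ha, hsub⟩ := (mem_nhdsLT_iff_exists_Ioo_subset' ht.1).1 hn
    have hlt : max 0 a < t := max_lt ht.1 ha
    have hpos : volume (Ioo (max 0 a) t) ≠ 0 := by simpa using hlt
    refine hpos (measure_mono_null (fun s hs => ?_) h)
    intro hs'
    exact hsub ⟨(le_max_right _ _).trans_lt hs.1, hs.2⟩
      (hs' ⟨(le_max_left _ _).trans_lt hs.1, hs.2.trans_le ht.2⟩)
  have h2 : Tendsto u (𝓝[<] t) (𝓝 (u t)) := (hu t ht).mono_left (nhdsWithin_mono _ Iio_subset_Iic_self)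
  by_contra hne
  obtain ⟨U, V, hU, hV, huU, hcV, hd⟩ := t2_separation hne
  obtain ⟨s, hs1, hs2⟩ := (h1.and_eventually (h2 (hU.mem_nhds huU))).exists
  rw [hs1] at hs2
  exact disjoint_left.1 hd hs2 hcV

/-- Near t from the left, H(t) - H(s) is asymptotically (h(t) - h(s))G(t), so H inherits
left-continuity from h whatever the size of G. -/
lemma leftCont_of_hasKSIntegral {E : Type*} [NormedAddCommGroup E] [NormedSpace ℝ E] {T : ℝ}
    {h : ℝ → ℝ} {G H : ℝ → E} (hh : ∀ t ∈ Ioc 0 T, ContinuousWithinAt h (Iic t) t)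
    (hH : ∀ t ∈ Icc 0 T, HasKSIntegral G h 0 t (H t)) :
    ∀ t ∈ Ioc 0 T, ContinuousWithinAt H (Iic t) t := by
  intro t ht
  rw [← Iio_insert, continuousWithinAt_insert_self]
  have h1 := HasKSIntegral.tendsto_left hH ht
  have h2 : Tendsto h (𝓝[<] t) (𝓝 (h t)) := (hh t ht).mono_left (nhdsWithin_mono _ Iio_subset_Iic_self)
  have h3 : Tendsto (fun s => (h t - h s) • G t) (𝓝[<] t) (𝓝 0) := by
    simpa using (h2.const_sub (h t)).smul_const (G t)
  have h4 := (h1.add h3).const_sub (H t)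
  simpa [ContinuousWithinAt] using h4

/-- The integrand may be unbounded. The one-sided asymptotics of H involve only its value at one
point and the one-sided limits of h, which bounds H near each point. -/
lemma bound_of_hasKSIntegral {E : Type*} [NormedAddCommGroup E] [NormedSpace ℝ E] {T : ℝ}
    {h : ℝ → ℝ} {G H : ℝ → E} (hh : RegulatedOn h 0 T)
    (hH : ∀ t ∈ Icc 0 T, HasKSIntegral G h 0 t (H t)) : ∃ C, ∀ t ∈ Icc 0 T, ‖H t‖ ≤ C := by
  refine exists_bound_of_locally_bounded (fun t ht => ?_) fun t ht => ?_
  · obtain ⟨l, hl⟩ := hh.1 t ht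
    have h1 := HasKSIntegral.tendsto_left hH ht
    have h4 := (h1.add ((hl.const_sub (h t)).smul_const (G t))).const_sub (H t)
    exact eventually_norm_le_of_tendsto (h4.congr fun s => by abel)
  · obtain ⟨l, hl⟩ := hh.2 t ht
    have h1 := HasKSIntegral.tendsto_right hH ht
    have h4 := (h1.add ((hl.sub_const (h t)).smul_const (G t))).add_const (H t)
    exact eventually_norm_le_of_tendsto (h4.congr fun s => by abel)

lemma leftCont_primitive {E : Type*} [NormedAddCommGroup E] [NormedSpace ℝ E] {T : ℝ} (hT : 0 ≤ T)
    {f : ℝ → E} (hf : IntegrableOn f (Icc 0 T)) :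
    ContinuousOn (fun t => ∫ s in (0 : ℝ)..t, f s) (Icc 0 T) := by
  have := intervalIntegral.continuousOn_primitive_interval (a := 0) (b := T) (f := f) (μ := volume)
    (by rwa [uIcc_of_le hT])
  rwa [uIcc_of_le hT] at this

/-- Solutions in the sense of distributions satisfy the integral equation. -/
theorem IsSolution.exists_integral_eq {n : ℕ} {T : ℝ} (hT : 0 < T) {Om : Set (Vec n)}
    {f : ℝ → Vec n → ℝ → Vec n} {g : Vec n → ℝ → Vec n} {h : ℝ → ℝ}
    (hh : IntegratorCondition T h) {lam : ℝ} {x : ℝ → Vec n} (hx : IsSolution T Om f g h lam x) :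
    ∃ H : ℝ → Vec n, (∀ t ∈ Icc 0 T, HasKSIntegral (fun s => g (x s) s) h 0 t (H t)) ∧
      ∀ t ∈ Icc 0 T, x t = x 0 + (∫ s in (0 : ℝ)..t, f lam (x s) s) + H t := by
  obtain ⟨hbv, hlc, -, hfi, ⟨H, hH, hdist⟩, hjump⟩ := hx
  refine ⟨H, hH, ?_⟩
  obtain ⟨Cx, hCx⟩ := hbv.regulatedOn.exists_bound
  obtain ⟨CH, hCH⟩ := bound_of_hasKSIntegral hh.1.regulatedOn hH
  have hHlc := leftCont_of_hasKSIntegral hh.2 hH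
  set fl : ℝ → Vec n := fun s => f lam (x s) s with hfl
  let Φ : ℝ → Vec n := fun t => ∫ s in (0 : ℝ)..t, fl s
  have hΦc : ContinuousOn Φ (Icc 0 T) := leftCont_primitive hT.le hfi
  have hΦlc : ∀ t ∈ Ioc 0 T, ContinuousWithinAt Φ (Iic t) t := fun t ht =>
    (hΦc t ⟨ht.1.le, ht.2⟩).mono_of_mem_nhdsWithin (by
      filter_upwards [self_mem_nhdsWithin, mem_nhdsWithin_of_mem_nhds (Ioi_mem_nhds ht.1)] with s h1 h2
      exact ⟨le_of_lt h2, le_trans h1 ht.2⟩)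
  -- The distributional equation says that u has zero derivative. Du Bois-Reymond makes it constant
  -- almost everywhere, and left-continuity makes it constant on (0,T].
  let u : ℝ → Vec n := fun t => x t - Φ t - H t
  have hii : ∀ {y : ℝ → Vec n} {C : ℝ}, (∀ t ∈ Ioc 0 T, ContinuousWithinAt y (Iic t) t) →
      (∀ t ∈ Icc 0 T, ‖y t‖ ≤ C) → IntervalIntegrable y volume 0 T := fun h1 h2 =>
    (intervalIntegrable_iff_integrableOn_Ioc_of_le hT.le).2 (integrableOn_Ioc_of_leftCont hT _ h1 h2)
  have hxi := hii hlc hCx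
  have hHi := hii hHlc hCH
  have hΦi : IntervalIntegrable Φ volume 0 T := by
    refine ContinuousOn.intervalIntegrable ?_
    rwa [uIcc_of_le hT.le]
  have hfli : IntervalIntegrable fl volume 0 T :=
    (intervalIntegrable_iff_integrableOn_Ioc_of_le hT.le).2 (hfi.mono_set Ioc_subset_Icc_self)
  have hann : ∀ ψ : ℝ → ℝ, ContDiff ℝ ∞ ψ → (∀ t, t ∉ Ioo 0 T → ψ t = 0) →
      ∫ t in (0 : ℝ)..T, deriv ψ t • u t = 0 := by
    intro ψ hψ hψ0
    have hψ' : Continuous (deriv ψ) := (contDiff_infty_iff_deriv.1 hψ).2.continuous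
    have hint : ∀ {y : ℝ → Vec n}, IntervalIntegrable y volume 0 T →
        IntervalIntegrable (fun t => deriv ψ t • y t) volume 0 T := fun hy =>
      hy.continuousOn_smul hψ'.continuousOn
    -- Pairing with a fixed vector v turns a scalar test function ψ into the vector-valued test
    -- function ψv.
    refine ext_inner_right ℝ fun v => ?_
    have hinner : ∀ {y : ℝ → Vec n}, IntervalIntegrable y volume 0 T →
        inner ℝ (∫ t in (0 : ℝ)..T, deriv ψ t • y t) v =
          ∫ t in (0 : ℝ)..T, inner ℝ (y t) (deriv ψ t • v) := by
      intro y hy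
      have := ((innerSL ℝ v).intervalIntegral_comp_comm (hint hy)).symm
      simp only [innerSL_apply_apply] at this
      rw [real_inner_comm, this]
      refine intervalIntegral.integral_congr fun t _ => ?_
      simp only [inner_smul_right, real_inner_comm]
    have htest : IsTestFunction T fun t => ψ t • v :=
      ⟨hψ.smul contDiff_const, fun t ht => by simp [hψ0 t ht]⟩
    have hd : deriv (fun t => ψ t • v) = fun t => deriv ψ t • v :=
      funext fun t => deriv_smul_const ((contDiff_infty_iff_deriv.1 hψ).1 t) v
    have h1 := hdist _ htest
    simp only [derivPairing, pairing, hd] at h1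
    rw [← hinner hxi, ← hinner hHi] at h1
    have h2 : ∫ t in (0 : ℝ)..T, inner ℝ (fl t) (ψ t • v) =
        - inner ℝ (∫ t in (0 : ℝ)..T, deriv ψ t • Φ t) v := by
      rw [hinner hΦi]
      have hfv : IntervalIntegrable (fun s => inner ℝ v (fl s)) volume 0 T :=
        ⟨(innerSL ℝ v).integrable_comp hfli.1, (innerSL ℝ v).integrable_comp hfli.2⟩
      have h3 := integral_primitive_mul_deriv hfv hψ hψ0
      have h4 : ∫ t in (0 : ℝ)..T, inner ℝ (Φ t) (deriv ψ t • v) =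
          ∫ t in (0 : ℝ)..T, (∫ s in (0 : ℝ)..t, inner ℝ v (fl s)) * deriv ψ t := by
        refine intervalIntegral.integral_congr fun t ht => ?_
        rw [uIcc_of_le hT.le] at ht
        have h5 := (innerSL ℝ v).intervalIntegral_comp_comm (μ := volume) (a := 0) (b := t) (f := fl)
          (hfli.mono_set (by rw [uIcc_of_le hT.le, uIcc_of_le ht.1]; exact Icc_subset_Icc_right ht.2))
        simp only [innerSL_apply_apply] at h5
        simp only [h5, inner_smul_right, real_inner_comm, Φ]
        ring
      rw [h4, h3, neg_neg]
      refine intervalIntegral.integral_congr fun t _ => ?_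
      simp only [inner_smul_right, real_inner_comm]
      ring
    rw [h2] at h1
    have h6 : ∫ t in (0 : ℝ)..T, deriv ψ t • u t = (∫ t in (0 : ℝ)..T, deriv ψ t • x t) -
        (∫ t in (0 : ℝ)..T, deriv ψ t • Φ t) - ∫ t in (0 : ℝ)..T, deriv ψ t • H t := by
      rw [← intervalIntegral.integral_sub (hint hxi) (hint hΦi),
        ← intervalIntegral.integral_sub ((hint hxi).sub (hint hΦi)) (hint hHi)]
      simp only [u, smul_sub]
    rw [h6, inner_sub_left, inner_sub_left, inner_zero_left]
    linarith
  obtain ⟨c, hc⟩ := ae_const_of_forall_integral_deriv_smul_eq_zero hT ((hxi.sub hΦi).sub hHi) hann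
  have hu : ∀ t ∈ Ioc 0 T, u t = c := eq_const_of_leftCont
    (fun t ht => ((hlc t ht).sub (hΦlc t ht)).sub (hHlc t ht)) hc
  have hH0 : H 0 = 0 := (hH 0 ⟨le_rfl, hT.le⟩).refl
  -- Test functions do not see the point 0, so the constant has to be identified by the jump
  -- relation there.
  have hcx : c = x 0 := by
    have t1 := HasKSIntegral.tendsto_right hH ⟨le_rfl, hT⟩
    have t2 : Tendsto Φ (𝓝[>] 0) (𝓝 0) := by
      have : Tendsto Φ (𝓝[Icc 0 T] 0) (𝓝 (Φ 0)) := hΦc 0 ⟨le_rfl, hT.le⟩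
      have h0 : Φ 0 = 0 := intervalIntegral.integral_same
      rw [h0] at this
      refine this.mono_left (nhdsWithin_le_iff.2 ?_)
      filter_upwards [Ioo_mem_nhdsGT hT] with s hs using ⟨hs.1.le, hs.2.le⟩
    have t3 := (hjump.sub t2).sub t1
    simp only [hH0, sub_zero] at t3
    refine tendsto_nhds_unique (tendsto_const_nhds.congr' ?_) t3
    filter_upwards [Ioo_mem_nhdsGT hT] with s hs
    rw [← hu s ⟨hs.1, hs.2.le⟩]
    simp only [u]
    abel
  intro t ht
  rcases ht.1.eq_or_lt with rfl | h0
  · simp [hH0]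
  · rw [← hcx, ← hu t ⟨h0, ht.2⟩]
    simp only [u, Φ]
    abel

end MeasureDE

/-! ### Differentials of the superposition operator and change of parameter -/

namespace MeasureDE

variable {n : ℕ}

/-- A linear map on `ℝⁿ` is determined by its values on the unit vectors. -/
lemma clm_eq_sum (A : Vec n →L[ℝ] Vec n) :
    A = ∑ i, (EuclideanSpace.proj i : Vec n →L[ℝ] ℝ).smulRight (A (EuclideanSpace.single i 1)) := by
  refine ContinuousLinearMap.ext fun v => ?_
  conv_lhs => rw [← (EuclideanSpace.basisFun (Fin n) ℝ).sum_repr v]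
  simp

/-- Measurability of the differential of a superposition. -/
lemma aestronglyMeasurable_of_hasFDerivAt {κ : Measure ℝ} {F : Vec n → ℝ → Vec n} {y : ℝ → Vec n}
    {A : ℝ → Vec n →L[ℝ] Vec n} (hA : ∀ᵐ r ∂κ, HasFDerivAt (fun w => F w r) (A r) (y r))
    (hm0 : AEMeasurable (fun r => F (y r) r) κ)
    (hm : ∀ v, ∀ᶠ s : ℝ in 𝓝 0, AEMeasurable (fun r => F (y r + s • v) r) κ) :
    AEStronglyMeasurable A κ := by
  have hv : ∀ v, AEStronglyMeasurable (fun r => A r v) κ := by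
    intro v
    have hs : Tendsto (fun k : ℕ => 1 / ((k : ℝ) + 1)) atTop (𝓝 0) :=
      tendsto_one_div_add_atTop_nhds_zero_nat
    -- Measurability of the shifted superpositions is known only for small shifts; starting the
    -- sequence at N keeps all increments 1/(k + N + 1) in that range.
    obtain ⟨N, hN⟩ := eventually_atTop.1 (hs.eventually (hm v))
    refine AEMeasurable.aestronglyMeasurable (aemeasurable_of_tendsto_metrizable_ae atTop
      (f := fun (k : ℕ) r => (((k + N : ℕ) : ℝ) + 1) •
        (F (y r + (1 / (((k + N : ℕ) : ℝ) + 1)) • v) r - F (y r) r)) (fun k => ?_) ?_)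
    · exact ((hN (k + N) (by omega)).sub hm0).const_smul (((k + N : ℕ) : ℝ) + 1)
    · filter_upwards [hA] with r hr
      have h1 := hr.lim_real v
      have h2 : Tendsto (fun k : ℕ => ((k + N : ℕ) : ℝ) + 1) atTop atTop :=
        tendsto_atTop_add_const_right _ _
          (tendsto_natCast_atTop_atTop.comp (tendsto_add_atTop_nat N))
      refine (h1.comp h2).congr fun k => ?_
      simp
  have : A = fun r => ∑ i, (EuclideanSpace.proj i : Vec n →L[ℝ] ℝ).smulRight
      (A r (EuclideanSpace.single i 1)) := funext fun r => clm_eq_sum _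
  rw [this]
  refine Finset.aestronglyMeasurable_fun_sum _ fun i _ => ?_
  exact ((ContinuousLinearMap.smulRightL ℝ (Vec n) (Vec n)
    (EuclideanSpace.proj i)).continuous).comp_aestronglyMeasurable (hv _)

variable {T : ℝ} {Lam : Set ℝ} {Om : Set (Vec n)} {f : ℝ → Vec n → ℝ → Vec n}

lemma CaratheodoryCondition.aemeasurable (hf : CaratheodoryCondition T Lam Om f) {lam : ℝ}
    (hlam : lam ∈ Lam) {y : Vec n} (hy : y ∈ Om) :
    AEMeasurable (f lam y) (volume.restrict (Ioc 0 T)) :=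
  (hf.2.1 lam hlam y hy).mono_measure (Measure.restrict_mono Ioc_subset_Icc_self le_rfl)

lemma CaratheodoryCondition.aemeasurable_comp (hT : 0 < T) (hf : CaratheodoryCondition T Lam Om f)
    {lam : ℝ} (hlam : lam ∈ Lam) {x : ℝ → Vec n}
    (hx : ∀ t ∈ Ioc 0 T, ContinuousWithinAt x (Iic t) t) (hxO : ∀ t ∈ Icc 0 T, x t ∈ Om) :
    AEMeasurable (fun t => f lam (x t) t) (volume.restrict (Ioc 0 T)) :=
  aemeasurable_superposition hT (fun _ hy => hf.aemeasurable hlam hy)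
    (fun t ht => hf.1 lam hlam t (Ioc_subset_Icc_self ht)) hx hxO

lemma CaratheodoryCondition.intervalIntegrable (hf : CaratheodoryCondition T Lam Om f)
    {lam : ℝ} (hlam : lam ∈ Lam) {x : ℝ → Vec n} {s t : ℝ} (hs : 0 ≤ s) (hst : s ≤ t) (ht : t ≤ T)
    (hxm : AEMeasurable (fun r => f lam (x r) r) (volume.restrict (Ioc s t)))
    (hxO : ∀ r ∈ Ioc s t, x r ∈ Om) :
    IntervalIntegrable (fun r => f lam (x r) r) volume s t := by
  obtain ⟨m, -, hmi, hm⟩ := hf.2.2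
  rw [intervalIntegrable_iff_integrableOn_Ioc_of_le hst]
  refine Integrable.mono' (hmi.mono_set fun r hr => ⟨hs.trans hr.1.le, hr.2.trans ht⟩)
    hxm.aestronglyMeasurable ?_
  filter_upwards [ae_restrict_mem measurableSet_Ioc] with r hr
  exact hm lam hlam _ (hxO r hr) r ⟨hs.trans hr.1.le, hr.2.trans ht⟩

lemma CaratheodoryCondition.intervalIntegrable_const (hf : CaratheodoryCondition T Lam Om f)
    {lam : ℝ} (hlam : lam ∈ Lam) {y : Vec n} (hy : y ∈ Om) {s t : ℝ} (hs : 0 ≤ s) (hst : s ≤ t)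
    (ht : t ≤ T) : IntervalIntegrable (f lam y) volume s t :=
  hf.intervalIntegrable hlam (x := fun _ => y) hs hst ht
    ((hf.aemeasurable hlam hy).mono_measure (Measure.restrict_mono (Ioc_subset_Ioc hs ht) le_rfl))
    fun _ _ => hy

/-- Directional derivatives are limits of measurable difference quotients; openness of Ω keeps the
shifted points y + sv admissible. -/
lemma aestronglyMeasurable_fx (hOm : IsOpen Om) (hf : CaratheodoryCondition T Lam Om f)
    (hdf : DiffConditionF T Lam Om f) {lam : ℝ} (hlam : lam ∈ Lam) {y : Vec n} (hy : y ∈ Om) :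
    AEStronglyMeasurable (fx f lam y) (volume.restrict (Ioc 0 T)) := by
  refine aestronglyMeasurable_of_hasFDerivAt (F := f lam) (y := fun _ => y) ?_
    (hf.aemeasurable hlam hy) fun v => ?_
  · filter_upwards [ae_restrict_mem measurableSet_Ioc] with r hr
    exact (hdf.1 lam hlam y hy r (Ioc_subset_Icc_self hr)).hasFDerivAt
  · have hc : Tendsto (fun s : ℝ => y + s • v) (𝓝 0) (𝓝 y) := by
      have : Continuous fun s : ℝ => y + s • v := by fun_prop
      simpa using this.tendsto 0
    filter_upwards [hc.eventually (hOm.mem_nhds hy)] with s hs using hf.aemeasurable hlam hs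

/-- Mean value inequality for the integrals of `f(λ₂, x, r) - f(λ₁, x, r)`. -/
lemma norm_integral_sub_le (hOm : IsOpen Om) (hf : CaratheodoryCondition T Lam Om f)
    (hdf : DiffConditionF T Lam Om f) {l₁ l₂ : ℝ} (hl₁ : l₁ ∈ Lam) (hl₂ : l₂ ∈ Lam) {s t : ℝ}
    (hs : 0 ≤ s) (hst : s ≤ t) (ht : t ≤ T) {K : ℝ}
    (hK : ∀ y ∈ Om, ‖∫ r in s..t, (fx f l₂ y r - fx f l₁ y r)‖ ≤ K) {x y : Vec n}
    (hxy : segment ℝ x y ⊆ Om) :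
    ‖(∫ r in s..t, (f l₂ y r - f l₁ y r)) - ∫ r in s..t, (f l₂ x r - f l₁ x r)‖ ≤
      K * ‖y - x‖ := by
  obtain ⟨θ, hθi, hθ⟩ := hdf.2.2
  have hIoc : Ioc s t ⊆ Icc 0 T := fun r hr => ⟨hs.trans hr.1.le, hr.2.trans ht⟩
  have hii : ∀ w ∈ Om, IntervalIntegrable (fun r => f l₂ w r - f l₁ w r) volume s t := fun w hw =>
    (hf.intervalIntegrable_const hl₂ hw hs hst ht).sub
      (hf.intervalIntegrable_const hl₁ hw hs hst ht)
  -- Differentiating under the integral first means that the mean value inequality needs a bound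
  -- only for the integrated differential, which is all that assumption 7 can supply.
  have hder : ∀ w ∈ Om, HasFDerivAt (fun w => ∫ r in s..t, (f l₂ w r - f l₁ w r))
      (∫ r in s..t, (fx f l₂ w r - fx f l₁ w r)) w := by
    intro w hw
    refine intervalIntegral.hasFDerivAt_integral_of_dominated_of_fderiv_le
      (F := fun w r => f l₂ w r - f l₁ w r) (F' := fun w r => fx f l₂ w r - fx f l₁ w r)
      (bound := fun r => 2 * θ r) (hOm.mem_nhds hw) ?_ (hii w hw) ?_ ?_ ?_ ?_
    · filter_upwards [hOm.mem_nhds hw] with w hw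
      exact (hii w hw).def'.aestronglyMeasurable
    · rw [uIoc_of_le hst]
      exact ((aestronglyMeasurable_fx hOm hf hdf hl₂ hw).sub
        (aestronglyMeasurable_fx hOm hf hdf hl₁ hw)).mono_measure
        (Measure.restrict_mono (Ioc_subset_Ioc hs ht) le_rfl)
    · refine Eventually.of_forall fun r hr w hw => ?_
      rw [uIoc_of_le hst] at hr
      have := norm_sub_le (fx f l₂ w r) (fx f l₁ w r)
      linarith [hθ l₂ hl₂ w hw r (hIoc hr), hθ l₁ hl₁ w hw r (hIoc hr)]
    · refine IntervalIntegrable.const_mul ?_ 2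
      exact (intervalIntegrable_iff_integrableOn_Ioc_of_le hst).2 (hθi.mono_set hIoc)
    · refine Eventually.of_forall fun r hr w hw => ?_
      rw [uIoc_of_le hst] at hr
      exact (hdf.1 l₂ hl₂ w hw r (hIoc hr)).hasFDerivAt.sub
        (hdf.1 l₁ hl₁ w hw r (hIoc hr)).hasFDerivAt
  exact (convex_segment x y).norm_image_sub_le_of_norm_hasFDerivWithin_le
    (fun w hw => (hder w (hxy hw)).hasFDerivWithinAt) (fun w hw => hK w (hxy hw))
    (left_mem_segment ℝ x y) (right_mem_segment ℝ x y)

/-- The effect of a change of the parameter on the increments of the superposition operator. -/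
lemma norm_integral_comp_sub_le (hOm : IsOpen Om) (hf : CaratheodoryCondition T Lam Om f)
    (hdf : DiffConditionF T Lam Om f) {l₁ l₂ : ℝ} (hl₁ : l₁ ∈ Lam) (hl₂ : l₂ ∈ Lam) {γ : ℝ → ℝ}
    {ε N : ℝ} (hε : 0 ≤ ε)
    (hγ : MonotoneOn γ (Icc 0 T))
    (hK : ∀ y ∈ Om, ∀ s t, 0 ≤ s → s ≤ t → t ≤ T →
      ‖∫ r in s..t, (fx f l₂ y r - fx f l₁ y r)‖ ≤ ε * (γ t - γ s))
    {x y : ℝ → Vec n} (hx : ∀ t ∈ Ioc 0 T, ContinuousWithinAt x (Iic t) t)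
    (hy : ∀ t ∈ Ioc 0 T, ContinuousWithinAt y (Iic t) t)
    (hxy : ∀ t ∈ Icc 0 T, segment ℝ (x t) (y t) ⊆ Om) (hN : ∀ t ∈ Icc 0 T, ‖y t - x t‖ ≤ N)
    {t : ℝ} (ht : 0 < t) (htT : t ≤ T) :
    ‖∫ r in (0 : ℝ)..t, ((f l₂ (y r) r - f l₁ (y r) r) - (f l₂ (x r) r - f l₁ (x r) r))‖ ≤
      ε * (γ t - γ 0) * N := by
  obtain ⟨m, -, hmi, hm⟩ := hf.2.2
  have hIcc : Icc 0 t ⊆ Icc 0 T := Icc_subset_Icc_right htT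
  have hIoc : Ioc 0 t ⊆ Ioc 0 T := Ioc_subset_Ioc_right htT
  have hxO : ∀ r ∈ Icc 0 t, x r ∈ Om := fun r hr => hxy r (hIcc hr) (left_mem_segment ℝ _ _)
  have hyO : ∀ r ∈ Icc 0 t, y r ∈ Om := fun r hr => hxy r (hIcc hr) (right_mem_segment ℝ _ _)
  have hsp : ∀ k, ∀ r ∈ Ioc 0 t, stepPoint t k r ∈ Icc 0 t := fun k r hr =>
    ⟨stepPoint_nonneg ht hr.1 k, (stepPoint_lt ht k).le.trans hr.2⟩
  have hmeas : ∀ l ∈ Lam, ∀ z : ℝ → Vec n, (∀ r ∈ Icc 0 t, z r ∈ Om) → ∀ k,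
      AEMeasurable (fun r => f l (z (stepPoint t k r)) r) (volume.restrict (Ioc 0 t)) :=
    fun l hl z hz k => aemeasurable_comp_stepPoint ht (fun w hw =>
      (hf.aemeasurable hl hw).mono_measure (Measure.restrict_mono hIoc le_rfl)) hz k
  have hlim : ∀ l ∈ Lam, ∀ z : ℝ → Vec n, (∀ r ∈ Ioc 0 T, ContinuousWithinAt z (Iic r) r) →
      (∀ r ∈ Icc 0 t, z r ∈ Om) → ∀ r ∈ Ioc 0 t,
      Tendsto (fun k => f l (z (stepPoint t k r)) r) atTop (𝓝 (f l (z r) r)) :=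
    fun l hl z hzc hz r hr => tendsto_comp_stepPoint ht
      (fun r hr => hf.1 l hl r (hIcc (Ioc_subset_Icc_self hr))) (fun r hr => hzc r (hIoc hr)) hz hr
  -- By left-continuity, x and y may be replaced by their values at the left grid points. For these
  -- step functions the preceding estimate applies on each cell with frozen arguments, and the
  -- bounds in γ telescope.
  have hDCT : Tendsto (fun k => ∫ r in (0 : ℝ)..t,
      ((f l₂ (y (stepPoint t k r)) r - f l₁ (y (stepPoint t k r)) r) -
        (f l₂ (x (stepPoint t k r)) r - f l₁ (x (stepPoint t k r)) r))) atTop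
      (𝓝 (∫ r in (0 : ℝ)..t, ((f l₂ (y r) r - f l₁ (y r) r) - (f l₂ (x r) r - f l₁ (x r) r)))) := by
    refine intervalIntegral.tendsto_integral_filter_of_dominated_convergence (fun r => 4 * m r)
      (Eventually.of_forall fun k => ?_) (Eventually.of_forall fun k =>
        Eventually.of_forall fun r hr => ?_) ?_ (Eventually.of_forall fun r hr => ?_)
    · rw [uIoc_of_le ht.le]
      exact (((hmeas l₂ hl₂ y hyO k).sub (hmeas l₁ hl₁ y hyO k)).sub
        ((hmeas l₂ hl₂ x hxO k).sub (hmeas l₁ hl₁ x hxO k))).aestronglyMeasurable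
    · rw [uIoc_of_le ht.le] at hr
      have hr' := hIcc (Ioc_subset_Icc_self hr)
      have h1 := hm l₂ hl₂ _ (hyO _ (hsp k r hr)) r hr'
      have h2 := hm l₁ hl₁ _ (hyO _ (hsp k r hr)) r hr'
      have h3 := hm l₂ hl₂ _ (hxO _ (hsp k r hr)) r hr'
      have h4 := hm l₁ hl₁ _ (hxO _ (hsp k r hr)) r hr'
      refine (norm_sub_le _ _).trans ?_
      linarith [norm_sub_le (f l₂ (y (stepPoint t k r)) r) (f l₁ (y (stepPoint t k r)) r),
        norm_sub_le (f l₂ (x (stepPoint t k r)) r) (f l₁ (x (stepPoint t k r)) r)]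
    · refine IntervalIntegrable.const_mul ?_ 4
      exact (intervalIntegrable_iff_integrableOn_Ioc_of_le ht.le).2
        (hmi.mono_set (hIoc.trans Ioc_subset_Icc_self))
    · rw [uIoc_of_le ht.le] at hr
      exact ((hlim l₂ hl₂ y hy hyO r hr).sub (hlim l₁ hl₁ y hy hyO r hr)).sub
        ((hlim l₂ hl₂ x hx hxO r hr).sub (hlim l₁ hl₁ x hx hxO r hr))
  refine le_of_tendsto hDCT.norm (Eventually.of_forall fun k => ?_)
  have hk0 : 0 < t / ((k : ℝ) + 1) := by positivity
  let p : ℕ → ℝ := fun j => j * (t / (k + 1))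
  have hp0 : ∀ j, 0 ≤ p j := fun j => by positivity
  have hpl : p (k + 1) = t := by simp only [p]; push_cast; field_simp
  have hpz : p 0 = 0 := by simp [p]
  have hpm : Monotone p := fun i j hij => by simp only [p]; gcongr
  have hpt : ∀ j ≤ k + 1, p j ≤ t := fun j hj => hpl ▸ hpm hj
  have hcongr : ∀ j, ∀ r ∈ Ioc (p j) (p (j + 1)), stepPoint t k r = p j := fun j r hr =>
    stepPoint_eq ht hr
  have hpiece : ∀ l ∈ Lam, ∀ z : ℝ → Vec n, (∀ r ∈ Icc 0 t, z r ∈ Om) → ∀ j < k + 1,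
      IntervalIntegrable (fun r => f l (z (stepPoint t k r)) r) volume (p j) (p (j + 1)) := by
    intro l hl z hz j hj
    refine hf.intervalIntegrable hl (x := fun r => z (stepPoint t k r)) (hp0 j) (hpm (by omega))
      ((hpt _ hj).trans htT) ((hmeas l hl z hz k).mono_measure (Measure.restrict_mono
        (Ioc_subset_Ioc (hp0 j) (hpt _ hj)) le_rfl)) fun r hr => hz _ (hsp k r
        ⟨(hp0 j).trans_lt hr.1, hr.2.trans (hpt _ hj)⟩)
  have hsum := intervalIntegral.sum_integral_adjacent_intervals (μ := volume) (a := p) (n := k + 1)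
    (f := fun r => ((f l₂ (y (stepPoint t k r)) r - f l₁ (y (stepPoint t k r)) r) -
        (f l₂ (x (stepPoint t k r)) r - f l₁ (x (stepPoint t k r)) r))) fun j hj =>
      ((hpiece l₂ hl₂ y hyO j hj).sub (hpiece l₁ hl₁ y hyO j hj)).sub
        ((hpiece l₂ hl₂ x hxO j hj).sub (hpiece l₁ hl₁ x hxO j hj))
  rw [hpz, hpl] at hsum
  rw [← hsum]
  calc _ ≤ ∑ j ∈ Finset.range (k + 1), ε * (γ (p (j + 1)) - γ (p j)) * N := by
        refine norm_sum_le_of_le _ fun j hj => ?_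
        have hj := Finset.mem_range.1 hj
        have hle : p j ≤ p (j + 1) := hpm (by omega)
        have hpj : p j ∈ Icc 0 T := ⟨hp0 j, (hpt j hj.le).trans htT⟩
        have hpj1 : p (j + 1) ∈ Icc 0 T := ⟨hp0 _, (hpt _ hj).trans htT⟩
        have e1 : ∫ r in (p j)..(p (j + 1)),
            ((f l₂ (y (stepPoint t k r)) r - f l₁ (y (stepPoint t k r)) r) -
            (f l₂ (x (stepPoint t k r)) r - f l₁ (x (stepPoint t k r)) r)) =
            ∫ r in (p j)..(p (j + 1)), ((f l₂ (y (p j)) r - f l₁ (y (p j)) r) -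
            (f l₂ (x (p j)) r - f l₁ (x (p j)) r)) := by
          refine intervalIntegral.integral_congr_ae (Eventually.of_forall fun r hr => ?_)
          rw [uIoc_of_le hle] at hr
          simp only [hcongr j r hr]
        have hc : ∀ l ∈ Lam, ∀ w ∈ Om, IntervalIntegrable (f l w) volume (p j) (p (j + 1)) :=
          fun l hl w hw => hf.intervalIntegrable_const hl hw (hp0 j) hle hpj1.2
        have hyj := hyO _ ⟨hp0 j, hpt j hj.le⟩
        have hxj := hxO _ ⟨hp0 j, hpt j hj.le⟩
        rw [e1, intervalIntegral.integral_sub ((hc l₂ hl₂ _ hyj).sub (hc l₁ hl₁ _ hyj))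
          ((hc l₂ hl₂ _ hxj).sub (hc l₁ hl₁ _ hxj))]
        refine (norm_integral_sub_le hOm hf hdf hl₁ hl₂ (hp0 j) hle hpj1.2
          (fun w hw => hK w hw _ _ (hp0 j) hle hpj1.2) (hxy _ hpj)).trans ?_
        exact mul_le_mul_of_nonneg_left (hN _ hpj)
          (mul_nonneg hε (sub_nonneg.2 (hγ hpj hpj1 hle)))
    _ = ε * (γ t - γ 0) * N := by
        rw [← Finset.sum_mul, ← Finset.mul_sum, Finset.sum_range_sub (fun j => γ (p j)), hpz, hpl]

end MeasureDE

/-! ### Linear equations: forward uniqueness and the Fredholm alternative -/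

namespace MeasureDE

variable {n : ℕ} {T : ℝ}

/-- End points are Lebesgue null, so the half-open intervals [0,t) of the polar form and (0,t] of
interval integrals are interchangeable here. -/
lemma hasKSIntegral_id {f : ℝ → Vec n} (hf : IntegrableOn f (Ioc 0 T)) {t : ℝ} (ht : t ∈ Icc 0 T) :
    HasKSIntegral f (fun τ => τ) 0 t (∫ s in (0 : ℝ)..t, f s) := by
  have h1 : IntegrableOn f (Ico 0 T) (volume.restrict (Icc 0 T)) := by
    rw [IntegrableOn, Measure.restrict_restrict measurableSet_Ico,
      inter_eq_left.2 Ico_subset_Icc_self]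
    exact (integrableOn_Ico_iff_integrableOn_Ioo).2
      ((integrableOn_Ioc_iff_integrableOn_Ioo).1 hf)
  have h2 := (isPolar_id (T := T)).hasKSIntegral h1 ht
  have e : ∫ x in Ico 0 t, (1 : ℝ) • f x ∂(volume.restrict (Icc 0 T)) = ∫ s in (0 : ℝ)..t, f s := by
    rw [Measure.restrict_restrict measurableSet_Ico,
      inter_eq_left.2 (Ico_subset_Icc_self.trans (Icc_subset_Icc_right ht.2)),
      intervalIntegral.integral_of_le ht.1, integral_Ico_eq_integral_Ioo,
      integral_Ioc_eq_integral_Ioo]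
    simp
  rwa [e] at h2

/-- Bounded solutions of `z(t) = z(0) + ∫_0^t A z ds + ∫_0^t B z dh`, with Lebesgue integrals. -/
def solutionSpace (T : ℝ) (A B : ℝ → Vec n →L[ℝ] Vec n) (μ : Measure ℝ) (σ : ℝ → ℝ)
    (hp : ∀ f : ℝ → Vec n, IntegrableOn f (Ico 0 T) μ →
      IntegrableOn (fun x => σ x • f x) (Ico 0 T) μ) :
    Submodule ℝ (ℝ → Vec n) where
  carrier := {z | (∃ M, ∀ t ∈ Icc 0 T, ‖z t‖ ≤ M) ∧ IntegrableOn (fun s => A s (z s)) (Ioc 0 T) ∧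
    IntegrableOn (fun s => B s (z s)) (Ico 0 T) μ ∧ ∀ t ∈ Icc 0 T,
      z t = z 0 + (∫ s in (0 : ℝ)..t, A s (z s)) + ∫ s in Ico 0 t, σ s • B s (z s) ∂μ}
  zero_mem' := by
    refine ⟨⟨0, by simp⟩, by simp, by simp, by simp⟩
  add_mem' := by
    rintro y z ⟨⟨M, hM⟩, hA, hB, he⟩ ⟨⟨M', hM'⟩, hA', hB', he'⟩
    refine ⟨⟨M + M', fun t ht => (norm_add_le _ _).trans (add_le_add (hM t ht) (hM' t ht))⟩, ?_, ?_,
      fun t ht => ?_⟩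
    · simpa only [Pi.add_apply, map_add] using! hA.add hA'
    · simpa only [Pi.add_apply, map_add] using! hB.add hB'
    · have hI : ∀ {f : ℝ → Vec n}, IntegrableOn f (Ioc 0 T) → IntervalIntegrable f volume 0 t :=
        fun hf => (intervalIntegrable_iff_integrableOn_Ioc_of_le ht.1).2
          (hf.mono_set (Ioc_subset_Ioc_right ht.2))
      have hJ : ∀ {f : ℝ → Vec n}, IntegrableOn f (Ico 0 T) μ →
          IntegrableOn (fun x => σ x • f x) (Ico 0 t) μ :=
        fun hf => (hp _ hf).mono_set (Ico_subset_Ico_right ht.2)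
      simp only [Pi.add_apply, map_add, smul_add]
      rw [intervalIntegral.integral_add (hI hA) (hI hA'), integral_add (hJ hB) (hJ hB'),
        he t ht, he' t ht]
      abel
  smul_mem' := by
    rintro c z ⟨⟨M, hM⟩, hA, hB, he⟩
    refine ⟨⟨|c| * M, fun t ht => ?_⟩, ?_, ?_, fun t ht => ?_⟩
    · rw [Pi.smul_apply, norm_smul, Real.norm_eq_abs]
      exact mul_le_mul_of_nonneg_left (hM t ht) (abs_nonneg c)
    · simpa only [Pi.smul_apply, map_smul] using! Integrable.smul c hA
    · simpa only [Pi.smul_apply, map_smul] using! Integrable.smul c hB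
    · simp only [Pi.smul_apply, map_smul, smul_comm _ c]
      rw [intervalIntegral.integral_smul, integral_smul, ← smul_add, ← smul_add, ← he t ht]

variable {A B : ℝ → Vec n →L[ℝ] Vec n} {μ : Measure ℝ} {σ h : ℝ → ℝ} {θ : ℝ → ℝ} {C : ℝ}

/-- The solution space which belongs to a polar decomposition of the integrator. -/
abbrev IsPolar.solutionSpace (hp : IsPolar T h μ σ) (A B : ℝ → Vec n →L[ℝ] Vec n) :
    Submodule ℝ (ℝ → Vec n) :=
  MeasureDE.solutionSpace T A B μ σ fun _ hf => hp.integrableOn_smul hf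

/-- Both indefinite integrals are left-continuous, so z is too, and Az is measurable. Boundedness of
B and z lets the Kurzweil–Stieltjes integral of Bz be read as a Lebesgue integral. At t = 0 the
integrals vanish, which identifies c as the periodicity defect. -/
lemma IsLinearSolution.mem_solutionSpace (hT : 0 < T)
    (hh : IntegratorCondition T h) (hp : IsPolar T h μ σ)
    (hA : AEStronglyMeasurable A (volume.restrict (Ioc 0 T)))
    (hθ : IntegrableOn θ (Icc 0 T)) (hAθ : ∀ t ∈ Icc 0 T, ‖A t‖ ≤ θ t)
    (hBC : ∀ t ∈ Icc 0 T, ‖B t‖ ≤ C) {c : Vec n} {z : ℝ → Vec n}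
    (hz : IsLinearSolution T A B h (fun _ => c) z) :
    z ∈ hp.solutionSpace A B ∧ z 0 - z T = c := by
  obtain ⟨hreg, heq⟩ := hz
  choose! I J hI hJ he using heq
  obtain ⟨M, hM⟩ := hreg.exists_bound
  have hM0 : 0 ≤ M := (norm_nonneg _).trans (hM 0 ⟨le_rfl, hT.le⟩)
  have hC0 : 0 ≤ C := (norm_nonneg _).trans (hBC 0 ⟨le_rfl, hT.le⟩)
  have h0 : (0 : ℝ) ∈ Icc 0 T := ⟨le_rfl, hT.le⟩
  have hI0 : I 0 = 0 := (hI 0 h0).refl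
  have hJ0 : J 0 = 0 := (hJ 0 h0).refl
  have hc : z 0 - z T = c := by simpa [hI0, hJ0] using he 0 h0
  have hzeq : ∀ t ∈ Icc 0 T, z t = z 0 + I t + J t := by
    intro t ht
    have : z t - z T - I t - J t = z 0 - z T := (he t ht).trans hc.symm
    rw [← sub_eq_zero] at this ⊢
    rw [← this]
    abel
  have hIl := leftCont_of_hasKSIntegral (h := fun τ => τ)
    (fun t _ => continuousWithinAt_id) hI
  have hJl := leftCont_of_hasKSIntegral hh.2 hJ
  have hzl : ∀ t ∈ Ioc 0 T, ContinuousWithinAt z (Iic t) t := by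
    intro t ht
    refine ((continuousWithinAt_const (b := z 0)).add (hIl t ht) |>.add (hJl t ht)).congr_of_eventuallyEq
      ?_ (hzeq t ⟨ht.1.le, ht.2⟩)
    filter_upwards [self_mem_nhdsWithin, mem_nhdsWithin_of_mem_nhds (Ioi_mem_nhds ht.1)] with s h1 h2
    exact hzeq s ⟨le_of_lt h2, le_trans h1 ht.2⟩
  have hAz : IntegrableOn (fun s => A s (z s)) (Ioc 0 T) := by
    refine Integrable.mono' ((hθ.mono_set Ioc_subset_Icc_self).mul_const M)
      (isBoundedBilinearMap_apply.continuous.comp_aestronglyMeasurable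
        (hA.prodMk (aemeasurable_of_leftCont hT volume hzl).aestronglyMeasurable)) ?_
    filter_upwards [ae_restrict_mem measurableSet_Ioc] with t ht
    have ht' := Ioc_subset_Icc_self ht
    exact ((A t).le_opNorm _).trans (mul_le_mul (hAθ t ht') (hM t ht') (norm_nonneg _)
      ((norm_nonneg _).trans (hAθ t ht')))
  obtain ⟨hBz, hJe⟩ := hp.integrableOn_of_hasKSIntegral hT (C := C * M) (fun t ht =>
    ((B t).le_opNorm _).trans (mul_le_mul (hBC t ht) (hM t ht) (norm_nonneg _) hC0)) hJ
  refine ⟨⟨⟨M, hM⟩, hAz, hBz, fun t ht => ?_⟩, hc⟩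
  rw [hzeq t ht, hJe t ht, (hI t ht).unique (hasKSIntegral_id hAz ht)]

/-- Forward uniqueness for linear equations. -/
lemma IsPolar.eq_zero_of_mem_solutionSpace (hT : 0 < T) (hp : IsPolar T h μ σ)
    (hθ : IntegrableOn θ (Icc 0 T)) (hAθ : ∀ t ∈ Icc 0 T, ‖A t‖ ≤ θ t)
    (hBC : ∀ t ∈ Icc 0 T, ‖B t‖ ≤ C) {z : ℝ → Vec n} (hz : z ∈ hp.solutionSpace A B)
    (hz0 : z 0 = 0) : ∀ t ∈ Icc 0 T, z t = 0 := by
  have := hp.finite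
  obtain ⟨⟨M, hM⟩, hAz, hBz, he⟩ := hz
  have hM0 : 0 ≤ M := (norm_nonneg _).trans (hM 0 ⟨le_rfl, hT.le⟩)
  have hC0 : 0 ≤ C := (norm_nonneg _).trans (hBC 0 ⟨le_rfl, hT.le⟩)
  have hσBz := hp.integrableOn_smul hBz
  -- Vanishing on [0,s) suffices: s is Lebesgue null, and an atom of μ at s is counted in [s,t). The
  -- case s = t then gives z(s) = 0, which makes the zero set closed.
  have hfrom : ∀ s t, 0 ≤ s → s ≤ t → t ≤ T → (∀ r ∈ Ico 0 s, z r = 0) →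
      z t = (∫ r in s..t, A r (z r)) + ∫ r in Ico s t, σ r • B r (z r) ∂μ := by
    intro s t hs hst ht hzs
    have hAi : ∀ a b, 0 ≤ a → a ≤ b → b ≤ T →
        IntervalIntegrable (fun r => A r (z r)) volume a b := fun a b ha hab hb =>
      (intervalIntegrable_iff_integrableOn_Ioc_of_le hab).2 (hAz.mono_set (Ioc_subset_Ioc ha hb))
    rw [he t ⟨hs.trans hst, ht⟩, hz0, zero_add,
      ← intervalIntegral.integral_add_adjacent_intervals (hAi 0 s le_rfl hs (hst.trans ht))
        (hAi s t hs hst ht), ← setIntegral_Ico_sub hσBz hs hst ht]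
    have e1 : ∫ r in (0 : ℝ)..s, A r (z r) = 0 := by
      rw [intervalIntegral.integral_of_le hs, integral_Ioc_eq_integral_Ioo]
      refine (setIntegral_congr_fun measurableSet_Ioo fun r hr => ?_).trans (integral_zero _ _)
      simp [hzs r ⟨hr.1.le, hr.2⟩]
    have e2 : ∫ r in Ico 0 s, σ r • B r (z r) ∂μ = 0 := by
      refine (setIntegral_congr_fun measurableSet_Ico fun r hr => ?_).trans (integral_zero _ _)
      simp [hzs r hr]
    rw [e1, e2]
    abel
  let S : Set ℝ := {t | ∀ r ∈ Icc 0 t, z r = 0}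
  have hSclosed : IsClosed (S ∩ Icc 0 T) := by
    refine isClosed_of_closure_subset fun t ht => ?_
    have htI : t ∈ Icc 0 T := isClosed_Icc.closure_subset_iff.2 inter_subset_right ht
    have hlt : ∀ r ∈ Ico 0 t, z r = 0 := by
      intro r hr
      obtain ⟨s, hs1, hs2, -⟩ := mem_closure_iff.1 ht (Ioi r) isOpen_Ioi hr.2
      exact hs2 r ⟨hr.1, le_of_lt hs1⟩
    refine ⟨fun r hr => ?_, htI⟩
    rcases hr.2.eq_or_lt with rfl | hrt
    · simpa using hfrom r r hr.1 le_rfl htI.2 hlt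
    · exact hlt r ⟨hr.1, hrt⟩
  have hsub : Icc 0 T ⊆ S := by
    refine hSclosed.Icc_subset_of_forall_mem_nhdsWithin (fun r hr => ?_) fun τ hτ => ?_
    · obtain rfl : r = 0 := le_antisymm hr.2 hr.1
      exact hz0
    obtain ⟨hτS, hτI⟩ := hτ
    have hzτ : z τ = 0 := hτS τ ⟨hτI.1, le_rfl⟩
    have l1 : Tendsto (fun t => ∫ r in τ..t, θ r) (𝓝[>] τ) (𝓝 0) := by
      have hc : ContinuousOn (fun t => ∫ r in τ..t, θ r) (Icc τ T) := by
        have := intervalIntegral.continuousOn_primitive_interval (a := τ) (b := T) (f := θ)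
          (μ := volume) (by
            rw [uIcc_of_le hτI.2.le]
            exact hθ.mono_set (Icc_subset_Icc_left hτI.1))
        rwa [uIcc_of_le hτI.2.le] at this
      have := hc τ ⟨le_rfl, hτI.2.le⟩
      rw [ContinuousWithinAt, intervalIntegral.integral_same] at this
      refine this.mono_left (nhdsWithin_le_iff.2 ?_)
      filter_upwards [Ioo_mem_nhdsGT hτI.2] with s hs using ⟨hs.1.le, hs.2.le⟩
    have l2 : Tendsto (fun t => C * μ.real (Ioo τ t)) (𝓝[>] τ) (𝓝 0) := by
      simpa using (tendsto_measureReal_Ioo_right μ τ).const_mul C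
    have l3 := (l1.add l2).eventually (gt_mem_nhds (show (0 : ℝ) + 0 < 1 / 2 by norm_num))
    obtain ⟨u, hu, hul⟩ := (mem_nhdsGT_iff_exists_Ioo_subset' hτI.2).1
      (Filter.inter_mem l3 (Ioo_mem_nhdsGT hτI.2))
    have hτu : τ < u := hu
    -- Just to the right of τ the total weight is below 1/2, so any bound for z improves by the
    -- factor 1/2; iteration starts from the global bound M.
    have step : ∀ K, 0 ≤ K → (∀ r ∈ Ioo τ u, ‖z r‖ ≤ K) → ∀ t ∈ Ioo τ u, ‖z t‖ ≤ K / 2 := by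
      intro K hK0 hK t ht
      have hsmall : (∫ r in τ..t, θ r) + C * μ.real (Ioo τ t) < 1 / 2 := (hul ht).1
      have htT : t < T := (hul ht).2.2
      have hbd : ∀ r ∈ Ioo τ t, ‖z r‖ ≤ K := fun r hr => hK r ⟨hr.1, hr.2.trans ht.2⟩
      have hI' : ∀ r ∈ Ioo τ t, r ∈ Icc 0 T := fun r hr =>
        ⟨hτI.1.trans hr.1.le, hr.2.le.trans htT.le⟩
      rw [hfrom τ t hτI.1 ht.1.le htT.le fun r hr => hτS r ⟨hr.1, hr.2.le⟩]
      have b1 : ‖∫ r in τ..t, A r (z r)‖ ≤ K * ∫ r in τ..t, θ r := by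
        rw [intervalIntegral.integral_of_le ht.1.le, intervalIntegral.integral_of_le ht.1.le,
          integral_Ioc_eq_integral_Ioo, integral_Ioc_eq_integral_Ioo, ← integral_const_mul]
        refine norm_integral_le_of_norm_le (((hθ.mono_set hI').const_mul K)) ?_
        filter_upwards [ae_restrict_mem measurableSet_Ioo] with r hr
        rw [mul_comm]
        exact ((A r).le_opNorm _).trans (mul_le_mul (hAθ r (hI' r hr)) (hbd r hr) (norm_nonneg _)
          ((norm_nonneg _).trans (hAθ r (hI' r hr))))
      have b2 : ‖∫ r in Ico τ t, σ r • B r (z r) ∂μ‖ ≤ K * (C * μ.real (Ioo τ t)) := by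
        -- A jump of h at τ contributes nothing, because z(τ) = 0; the remaining open interval has
        -- small measure.
        have : ∫ r in Ico τ t, σ r • B r (z r) ∂μ = ∫ r in Ioo τ t, σ r • B r (z r) ∂μ := by
          refine setIntegral_eq_of_subset_of_forall_sdiff_eq_zero measurableSet_Ico
            Ioo_subset_Ico_self fun r hr => ?_
          obtain rfl : r = τ := by
            by_contra hne
            exact hr.2 ⟨lt_of_le_of_ne hr.1.1 (Ne.symm hne), hr.1.2⟩
          simp [hzτ]
        rw [this]
        have h3 := norm_setIntegral_le_of_norm_le_const (μ := μ) (s := Ioo τ t)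
          (f := fun r => σ r • B r (z r)) (C := C * K) (measure_lt_top _ _) fun r hr => by
            rw [hp.norm_smul]
            exact ((B r).le_opNorm _).trans (mul_le_mul (hBC r (hI' r hr)) (hbd r hr)
              (norm_nonneg _) hC0)
        linarith
      refine (norm_add_le _ _).trans ?_
      nlinarith
    have hpow : ∀ k : ℕ, ∀ t ∈ Ioo τ u, ‖z t‖ ≤ M * (1 / 2) ^ k := by
      intro k
      induction k with
      | zero =>
        intro t ht
        simpa using hM t ⟨hτI.1.trans ht.1.le, (hul ht).2.2.le⟩
      | succ k ih =>
        intro t ht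
        have := step _ (by positivity) ih t ht
        rw [pow_succ]
        linarith
    have hzero : ∀ t ∈ Ioo τ u, z t = 0 := by
      intro t ht
      have hl : Tendsto (fun k : ℕ => M * (1 / 2 : ℝ) ^ k) atTop (𝓝 0) := by
        simpa using (tendsto_pow_atTop_nhds_zero_of_lt_one (r := (1 / 2 : ℝ)) (by norm_num)
          (by norm_num)).const_mul M
      exact norm_le_zero_iff.1 (ge_of_tendsto' hl fun k => hpow k t ht)
    filter_upwards [Ioo_mem_nhdsGT hτu] with s hs r hr
    rcases le_or_gt r τ with h1 | h1
    · exact hτS r ⟨hr.1, h1⟩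
    · exact hzero r ⟨h1, hr.2.trans_lt hs.2⟩
  exact fun t ht => hsub ht t ⟨ht.1, le_rfl⟩

/-- Fredholm alternative: if the homogeneous periodic problem has a nontrivial solution, then the
inhomogeneous one is not solvable for all constant right-hand sides. -/
theorem exists_const_not_solvable (hT : 0 < T)
    (hh : IntegratorCondition T h) (hp : IsPolar T h μ σ)
    (hA : AEStronglyMeasurable A (volume.restrict (Ioc 0 T)))
    (hθ : IntegrableOn θ (Icc 0 T)) (hAθ : ∀ t ∈ Icc 0 T, ‖A t‖ ≤ θ t)
    (hBC : ∀ t ∈ Icc 0 T, ‖B t‖ ≤ C) {z : ℝ → Vec n}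
    (hz : IsLinearSolution T A B h (fun _ => 0) z) (hne : ∃ t ∈ Icc 0 T, z t ≠ 0) :
    ∃ c : Vec n, ¬ ∃ y, IsLinearSolution T A B h (fun _ => c) y := by
  by_contra! hcon
  obtain ⟨hzS, hzT⟩ := hz.mem_solutionSpace hT hh hp hA hθ hAθ hBC
  -- Solutions whose periodicity defects z(0) - z(T) are the unit vectors; a combination with
  -- coefficients c has defect c.
  choose Z hZ using fun i : Fin n => hcon (EuclideanSpace.single i 1)
  have hZS := fun i => (hZ i).mem_solutionSpace hT hh hp hA hθ hAθ hBC
  have h0 : (0 : ℝ) ∈ Icc 0 T := ⟨le_rfl, hT.le⟩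
  have hTT : T ∈ Icc 0 T := ⟨hT.le, le_rfl⟩
  have huniq := fun {y : ℝ → Vec n} => hp.eq_zero_of_mem_solutionSpace (A := A) (B := B) hT hθ hAθ
    hBC (z := y)
  have hcomb : ∀ c : Fin n → ℝ, (∑ i, c i • Z i) ∈ hp.solutionSpace A B := fun c =>
    Submodule.sum_mem _ fun i _ => Submodule.smul_mem _ _ (hZS i).1
  have hdiff : ∀ c : Fin n → ℝ, (∑ i, c i • Z i) 0 - (∑ i, c i • Z i) T = WithLp.toLp 2 c := by
    intro c
    simp only [Finset.sum_apply, Pi.smul_apply, ← Finset.sum_sub_distrib, ← smul_sub,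
      fun i => (hZS i).2]
    ext j
    simp [Pi.single_apply]
  let L : (Fin n → ℝ) →ₗ[ℝ] Vec n := Fintype.linearCombination ℝ fun i => Z i 0
  have hL : ∀ c, L c = (∑ i, c i • Z i) 0 := fun c => by
    simp [L, Fintype.linearCombination_apply]
  -- A combination with zero initial value vanishes by forward uniqueness, and so does its defect c.
  -- Equal dimensions then give surjectivity.
  have hinj : Function.Injective L := by
    rw [← LinearMap.ker_eq_bot, LinearMap.ker_eq_bot']
    intro c hc
    rw [hL] at hc
    have h1 := huniq (hcomb c) hc
    have h2 := hdiff c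
    rw [h1 0 h0, h1 T hTT, sub_zero] at h2
    exact (WithLp.toLp_injective 2 (h2.symm.trans (WithLp.toLp_zero 2).symm))
  have hsurj : Function.Surjective L :=
    (LinearMap.injective_iff_surjective_of_finrank_eq_finrank (by simp)).1 hinj
  obtain ⟨c, hc⟩ := hsurj (z 0)
  rw [hL] at hc
  have hw := huniq (Submodule.sub_mem _ (hcomb c) hzS) (by rw [Pi.sub_apply, hc, sub_self])
  have e0 := hw 0 h0
  have eT := hw T hTT
  rw [Pi.sub_apply, sub_eq_zero] at e0 eT
  have hc0 := hdiff c
  rw [e0, eT, hzT] at hc0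
  have hc0' : c = 0 := WithLp.toLp_injective 2 (hc0.symm.trans (WithLp.toLp_zero 2).symm)
  rw [hc0'] at e0
  obtain ⟨t, ht, hzt⟩ := hne
  exact hzt (huniq hzS (by simpa using e0.symm) t ht)

end MeasureDE

/-! ### Compactness and difference quotients of solutions -/

namespace MeasureDE

variable {n : ℕ} {T : ℝ}

/-- Compactness of bounded sequences with increments dominated by the increments of one function. -/
theorem exists_subseq_tendstoUniformlyOn (hT : 0 ≤ T) {z : ℕ → ℝ → Vec n} {Γ : ℝ → ℝ}
    (hz : ∀ k s t, 0 ≤ s → s ≤ t → t ≤ T → ‖z k t - z k s‖ ≤ Γ t - Γ s) {M : ℝ}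
    (hb : ∀ k, ∀ t ∈ Icc 0 T, ‖z k t‖ ≤ M) :
    ∃ φ : ℕ → ℕ, StrictMono φ ∧ ∃ w : ℝ → Vec n, Continuous w ∧
      TendstoUniformlyOn (fun k => z (φ k)) (fun t => w (Γ t)) atTop (Icc 0 T) := by
  have hmono : MonotoneOn Γ (Icc 0 T) := fun s hs t ht hst =>
    sub_nonneg.1 ((norm_nonneg _).trans (hz 0 s t hs.1 hst ht.2))
  have h0 : (0 : ℝ) ∈ Icc 0 T := ⟨le_rfl, hT⟩
  have hdist : ∀ k, ∀ s ∈ Icc 0 T, ∀ t ∈ Icc 0 T, ‖z k s - z k t‖ ≤ |Γ s - Γ t| := by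
    intro k s hs t ht
    rcases le_total s t with hst | hst
    · rw [norm_sub_rev, abs_sub_comm]
      exact (hz k s t hs.1 hst ht.2).trans (le_abs_self _)
    · exact (hz k t s ht.1 hst hs.2).trans (le_abs_self _)
  -- Reparametrized by Γ, the functions become 1-Lipschitz. The choice of preimage does not matter,
  -- since every z k is constant on the level sets of Γ.
  let inv : ℝ → ℝ := Function.invFunOn Γ (Icc 0 T)
  have hinv : ∀ y ∈ Γ '' Icc 0 T, inv y ∈ Icc 0 T ∧ Γ (inv y) = y := fun y hy =>
    ⟨Function.invFunOn_mem hy, Function.invFunOn_eq hy⟩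
  have hlip : ∀ k, LipschitzOnWith 1 (fun y => z k (inv y)) (Γ '' Icc 0 T) := by
    intro k
    refine LipschitzOnWith.of_dist_le_mul fun x hx y hy => ?_
    rw [dist_eq_norm, NNReal.coe_one, one_mul, Real.dist_eq]
    simpa only [(hinv x hx).2, (hinv y hy).2] using hdist k _ (hinv x hx).1 _ (hinv y hy).1
  -- The image of Γ may have gaps where Γ jumps; Lipschitz extension, with a constant independent of
  -- k, fills them so that Arzelà–Ascoli applies on an interval.
  choose g hg hgeq using fun k => (hlip k).extend_finite_dimension
  set K := lipschitzExtensionConstant (Vec n) * 1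
  have hgz : ∀ k, ∀ t ∈ Icc 0 T, g k (Γ t) = z k t := by
    intro k t ht
    have hmem := mem_image_of_mem Γ ht
    rw [← hgeq k hmem]
    have := hdist k _ (hinv _ hmem).1 t ht
    rw [(hinv _ hmem).2, sub_self, abs_zero] at this
    exact sub_eq_zero.1 (norm_le_zero_iff.1 this)
  have hle : Γ 0 ≤ Γ T := hmono h0 ⟨hT, le_rfl⟩ hT
  let G : ℕ → BoundedContinuousFunction (Icc (Γ 0) (Γ T)) (Vec n) := fun k =>
    BoundedContinuousFunction.mkOfCompact ⟨fun y => g k y, (hg k).continuous.comp continuous_subtype_val⟩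
  have hcomp : IsCompact (closure (range G)) := by
    refine BoundedContinuousFunction.arzela_ascoli (Metric.closedBall 0 (M + K * (Γ T - Γ 0)))
      (isCompact_closedBall _ _) _ ?_ ?_
    · rintro _ y ⟨k, rfl⟩
      rw [mem_closedBall_zero_iff]
      have h1 : ‖g k y - g k (Γ 0)‖ ≤ K * (Γ T - Γ 0) := by
        rw [← dist_eq_norm]
        refine ((hg k).dist_le_mul _ _).trans (mul_le_mul_of_nonneg_left ?_ (NNReal.coe_nonneg _))
        rw [Real.dist_eq, abs_of_nonneg (sub_nonneg.2 y.2.1)]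
        linarith [y.2.2]
      have h2 : ‖g k (Γ 0)‖ ≤ M := by
        rw [hgz k 0 h0]
        exact hb k 0 h0
      have h3 := norm_sub_norm_le (g k y) (g k (Γ 0))
      change ‖g k y‖ ≤ _
      linarith
    · refine (LipschitzWith.uniformEquicontinuous _ K ?_).equicontinuous
      rintro ⟨_, k, rfl⟩
      have := (hg k).comp (LipschitzWith.subtype_val (Icc (Γ 0) (Γ T)))
      rw [mul_one] at this
      exact this
  obtain ⟨W, -, φ, hφ, hlim⟩ := hcomp.tendsto_subseq fun k => subset_closure (mem_range_self (f := G) k)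
  refine ⟨φ, hφ, fun y => W (projIcc (Γ 0) (Γ T) hle y), W.continuous.comp continuous_projIcc, ?_⟩
  have hu := BoundedContinuousFunction.tendsto_iff_tendstoUniformly.1 hlim
  rw [Metric.tendstoUniformly_iff] at hu
  rw [Metric.tendstoUniformlyOn_iff]
  intro ε hε
  filter_upwards [hu ε hε] with k hk t ht
  have hΓt : Γ t ∈ Icc (Γ 0) (Γ T) := ⟨hmono h0 ht ht.1, hmono ht ⟨hT, le_rfl⟩ ht.2⟩
  have := hk ⟨Γ t, hΓt⟩
  rw [projIcc_of_mem hle hΓt, ← hgz _ t ht]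
  exact this

/-- Γ has one-sided limits by monotonicity, and continuity of w transports them. -/
lemma regulatedOn_comp_monotoneOn {E : Type*} [TopologicalSpace E] (hT : 0 ≤ T) {w : ℝ → E}
    (hw : Continuous w) {Γ : ℝ → ℝ} (hΓ : MonotoneOn Γ (Icc 0 T)) :
    RegulatedOn (fun t => w (Γ t)) 0 T := by
  have hmono : Monotone fun t => Γ (projIcc 0 T hT t) := fun s t hst =>
    hΓ (projIcc 0 T hT s).2 (projIcc 0 T hT t).2 (monotone_projIcc hT hst)
  refine ⟨fun t ht => ⟨_, ((hw.tendsto _).comp (hmono.tendsto_leftLim t)).congr' ?_⟩,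
    fun t ht => ⟨_, ((hw.tendsto _).comp (hmono.tendsto_rightLim t)).congr' ?_⟩⟩
  · filter_upwards [Ioo_mem_nhdsLT ht.1] with s hs
    simp [projIcc_of_mem hT ⟨hs.1.le, hs.2.le.trans ht.2⟩]
  · filter_upwards [Ioo_mem_nhdsGT ht.2] with s hs
    simp [projIcc_of_mem hT ⟨ht.1.trans hs.1.le, hs.2.le⟩]

variable {Lam : Set ℝ} {Om : Set (Vec n)} {f : ℝ → Vec n → ℝ → Vec n} {g : Vec n → ℝ → Vec n}
  {h : ℝ → ℝ} {μ : Measure ℝ} {σ : ℝ → ℝ}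

/-- The ball of the trivial branch contains the segments between its functions and the centre. -/
lemma TrivialBranch.segment_subset {x₀ : ℝ → Vec n} {ρ : ℝ} (hx₀ : TrivialBranch T Lam Om f g h x₀ ρ)
    {x : ℝ → Vec n} (hx : MemBall T x₀ ρ x) : ∀ t ∈ Icc 0 T, segment ℝ (x₀ t) (x t) ⊆ Om := by
  rintro t ht _ ⟨a, b, ha, hb, hab, rfl⟩
  refine hx₀.2.2 (fun s => a • x₀ s + b • x s)
    ⟨(hx₀.1.const_smul a).add (hx.1.const_smul b), fun s hs => ?_⟩ t ht
  have : a • x₀ s + b • x s - x₀ s = b • (x s - x₀ s) := by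
    rw [← eq_sub_iff_add_eq] at hab
    rw [hab, sub_smul, one_smul, smul_sub]
    abel
  rw [this, norm_smul, Real.norm_eq_abs, abs_of_nonneg hb]
  have h1 := hx.2 s hs
  nlinarith [norm_nonneg (x s - x₀ s)]

/-- Mean value inequality for difference quotients. -/
lemma norm_smul_image_sub_le {F : Vec n → Vec n} {x y : Vec n} {K c : ℝ}
    (hd : ∀ w ∈ segment ℝ x y, DifferentiableAt ℝ F w)
    (hb : ∀ w ∈ segment ℝ x y, ‖fderiv ℝ F w‖ ≤ K) (hc : ‖c • (y - x)‖ ≤ 1) :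
    ‖c • (F y - F x)‖ ≤ K := by
  have h1 := (convex_segment x y).norm_image_sub_le_of_norm_fderiv_le hd hb
    (left_mem_segment ℝ x y) (right_mem_segment ℝ x y)
  have hK : 0 ≤ K := (norm_nonneg _).trans (hb x (left_mem_segment ℝ x y))
  rw [norm_smul] at hc ⊢
  calc ‖c‖ * ‖F y - F x‖ ≤ ‖c‖ * (K * ‖y - x‖) := mul_le_mul_of_nonneg_left h1 (norm_nonneg _)
    _ = K * (‖c‖ * ‖y - x‖) := by ring
    _ ≤ K * 1 := mul_le_mul_of_nonneg_left hc hK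
    _ = K := mul_one K

/-- The integral equation for the difference quotient of two solutions. -/
lemma exists_quotient_eq (hT : 0 < T) (hh : IntegratorCondition T h) (hp : IsPolar T h μ σ)
    (hdf : DiffConditionF T Lam Om f) (hdg : DiffConditionG T Om g h) {θ : ℝ → ℝ}
    (hθ : ∀ lam ∈ Lam, ∀ x ∈ Om, ∀ t ∈ Icc 0 T, ‖fx f lam x t‖ ≤ θ t) {C : ℝ}
    (hC : ∀ x ∈ Om, ∀ t ∈ Icc 0 T, ‖gx g x t‖ ≤ C) {lam : ℝ} (hlam : lam ∈ Lam)
    {x y : ℝ → Vec n} (hx : IsSolution T Om f g h lam x) (hy : IsSolution T Om f g h lam y)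
    (hxy : ∀ t ∈ Icc 0 T, segment ℝ (x t) (y t) ⊆ Om) {c : ℝ}
    (hc : ∀ t ∈ Icc 0 T, ‖c • (y t - x t)‖ ≤ 1) :
    IntegrableOn (fun r => c • (f lam (y r) r - f lam (x r) r)) (Ioc 0 T) ∧
    (∀ r ∈ Icc 0 T, ‖c • (f lam (y r) r - f lam (x r) r)‖ ≤ θ r) ∧
    IntegrableOn (fun r => c • (g (y r) r - g (x r) r)) (Ico 0 T) μ ∧
    (∀ r ∈ Icc 0 T, ‖c • (g (y r) r - g (x r) r)‖ ≤ C) ∧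
    ∀ t ∈ Icc 0 T, c • (y t - x t) = c • (y 0 - x 0) +
      (∫ r in (0 : ℝ)..t, c • (f lam (y r) r - f lam (x r) r)) +
      ∫ r in Ico 0 t, σ r • c • (g (y r) r - g (x r) r) ∂μ := by
  have hfb : ∀ r ∈ Icc 0 T, ‖c • (f lam (y r) r - f lam (x r) r)‖ ≤ θ r := fun r hr =>
    norm_smul_image_sub_le (F := fun w => f lam w r) (fun w hw => hdf.1 lam hlam w (hxy r hr hw) r hr)
      (fun w hw => hθ lam hlam w (hxy r hr hw) r hr) (hc r hr)
  have hgb : ∀ r ∈ Icc 0 T, ‖c • (g (y r) r - g (x r) r)‖ ≤ C := fun r hr =>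
    norm_smul_image_sub_le (F := fun w => g w r) (fun w hw => hdg.1 w (hxy r hr hw) r hr)
      (fun w hw => hC w (hxy r hr hw) r hr) (hc r hr)
  have hfi : IntegrableOn (fun r => c • (f lam (y r) r - f lam (x r) r)) (Ioc 0 T) :=
    (Integrable.smul c (hy.2.2.2.1.sub hx.2.2.2.1)).mono_measure
      (Measure.restrict_mono Ioc_subset_Icc_self le_rfl)
  obtain ⟨H, hH, hxe⟩ := hx.exists_integral_eq hT hh
  obtain ⟨H', hH', hye⟩ := hy.exists_integral_eq hT hh
  -- The functions g(x(·),·) and g(y(·),·) may be unbounded, but their difference quotient is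
  -- bounded by C, so the comparison of integrals applies to it.
  obtain ⟨hgi, hge⟩ := hp.integrableOn_of_hasKSIntegral hT hgb
    fun t ht => ((hH' t ht).sub_fun (hH t ht)).const_smul c
  refine ⟨hfi, hfb, hgi, hgb, fun t ht => ?_⟩
  have hI : ∀ {u : ℝ → Vec n}, IsSolution T Om f g h lam u →
      IntervalIntegrable (fun r => f lam (u r) r) volume 0 t := fun hu =>
    (intervalIntegrable_iff_integrableOn_Ioc_of_le ht.1).2
      (hu.2.2.2.1.mono_set fun r hr => ⟨hr.1.le, hr.2.trans ht.2⟩)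
  rw [← hge t ht, intervalIntegral.integral_smul, intervalIntegral.integral_sub (hI hy) (hI hx),
    ← smul_add, ← smul_add]
  congr 1
  rw [hye t ht, hxe t ht]
  abel

end MeasureDE

/-! ### Linearization at a bifurcation point -/

namespace MeasureDE

variable {n : ℕ} {T : ℝ} {Lam : Set ℝ} {Om : Set (Vec n)} {f : ℝ → Vec n → ℝ → Vec n}
  {g : Vec n → ℝ → Vec n} {h : ℝ → ℝ} {μ : Measure ℝ} {σ : ℝ → ℝ}

/-- Uniform continuity in the parameter of the integrals of the differential of `f` alone. -/
lemma DiffUniformCondition.exists_modulus (hdiff : DiffUniformCondition T Lam Om f g h) :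
    ∃ γ : ℝ → ℝ, MonotoneOn γ (Icc 0 T) ∧ ∀ ε > 0, ∃ δ > 0, ∀ l₁ ∈ Lam, ∀ l₂ ∈ Lam,
      |l₁ - l₂| < δ → ∀ y ∈ Om, ∀ s t, 0 ≤ s → s ≤ t → t ≤ T →
        ‖∫ r in s..t, (fx f l₁ y r - fx f l₂ y r)‖ ≤ ε * (γ t - γ s) := by
  obtain ⟨γ, hγ, hd⟩ := hdiff
  refine ⟨γ, hγ, fun ε hε => ?_⟩
  obtain ⟨δ, hδ, hd⟩ := hd ε hε
  refine ⟨δ, hδ, fun l₁ hl₁ l₂ hl₂ hl y hy s t hs hst ht => ?_⟩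
  -- With equal space arguments the Stieltjes integrand is zero, so only the f-part survives.
  obtain ⟨J, hJ, hle⟩ := hd s ⟨hs, hst.trans ht⟩ t ⟨hs.trans hst, ht⟩ hst y hy y hy l₁ hl₁ l₂ hl₂
    (by simpa using hl)
  simp only [sub_self] at hJ
  rwa [hJ.unique (HasKSIntegral.zero hst), add_zero] at hle

/-- A sequence of nontrivial solutions which approaches a bifurcation point. -/
lemma IsBifurcationPoint.exists_seq {x₀ : ℝ → Vec n} {ρ lam₀ : ℝ}
    (hbif : IsBifurcationPoint T Lam Om f g h ρ x₀ lam₀) :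
    ∃ (lam : ℕ → ℝ) (x : ℕ → ℝ → Vec n) (N : ℕ → ℝ), (∀ k, lam k ∈ Lam) ∧
      Tendsto lam atTop (𝓝 lam₀) ∧ (∀ k, MemBall T x₀ ρ (x k)) ∧
      (∀ k, IsPeriodicSolution T Om f g h (lam k) (x k)) ∧ (∀ k, 0 < N k) ∧
      Tendsto N atTop (𝓝 0) ∧ (∀ k, ∀ t ∈ Icc 0 T, ‖x k t - x₀ t‖ ≤ N k) ∧
      ∀ k, ∃ t ∈ Icc 0 T, N k / 2 < ‖x k t - x₀ t‖ := by
  choose lam hlam x hxB hll hxε hxS hne using fun k : ℕ =>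
    hbif.2.2.2 (1 / ((k : ℝ) + 1)) Nat.one_div_pos_of_nat
  -- N k is the supremum of these values. It need not be attained by a regulated function, hence the
  -- weaker lower bound N k / 2.
  let S : ℕ → Set ℝ := fun k => (fun t => ‖x k t - x₀ t‖) '' Icc 0 T
  have hbdd : ∀ k, BddAbove (S k) := fun k => ⟨1 / ((k : ℝ) + 1), by
    rintro _ ⟨t, ht, rfl⟩
    exact (hxε k t ht).le⟩
  have hle : ∀ k, ∀ t ∈ Icc 0 T, ‖x k t - x₀ t‖ ≤ sSup (S k) := fun k t ht =>
    le_csSup (hbdd k) (mem_image_of_mem _ ht)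
  have hpos : ∀ k, 0 < sSup (S k) := by
    intro k
    obtain ⟨t, ht, htne⟩ := hne k
    exact (norm_pos_iff.2 (sub_ne_zero.2 htne)).trans_le (hle k t ht)
  have hN : ∀ k, sSup (S k) ≤ 1 / ((k : ℝ) + 1) := by
    intro k
    obtain ⟨t, ht, -⟩ := hne k
    refine csSup_le ⟨_, mem_image_of_mem _ ht⟩ ?_
    rintro _ ⟨t, ht, rfl⟩
    exact (hxε k t ht).le
  refine ⟨lam, x, fun k => sSup (S k), hlam, ?_, hxB, hxS, hpos, ?_, hle, fun k => ?_⟩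
  · refine tendsto_iff_dist_tendsto_zero.2 (squeeze_zero (fun _ => dist_nonneg) (fun k => ?_)
      (tendsto_one_div_add_atTop_nhds_zero_nat (𝕜 := ℝ)))
    exact (hll k).le
  · exact squeeze_zero (fun k => (hpos k).le) hN (tendsto_one_div_add_atTop_nhds_zero_nat (𝕜 := ℝ))
  · obtain ⟨t, ht, -⟩ := hne k
    obtain ⟨_, ⟨t, ht, rfl⟩, hlt⟩ := exists_lt_of_lt_csSup ⟨_, mem_image_of_mem _ ht⟩
      (half_lt_self (hpos k))
    exact ⟨t, ht, hlt⟩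

/-- Convergence of difference quotients along converging directions. -/
lemma tendsto_quotient {F : Vec n → Vec n} {x₀ v : Vec n} (hF : DifferentiableAt ℝ F x₀)
    {x : ℕ → Vec n} {N : ℕ → ℝ} (hN : Tendsto N atTop (𝓝 0)) (hx : ∀ k, ‖x k - x₀‖ ≤ N k)
    (hv : Tendsto (fun k => (N k)⁻¹ • (x k - x₀)) atTop (𝓝 v)) :
    Tendsto (fun k => (N k)⁻¹ • (F (x k) - F x₀)) atTop (𝓝 (fderiv ℝ F x₀ v)) := by
  have := (hasFDerivWithinAt_univ.2 hF.hasFDerivAt).lim (d := fun k => x k - x₀)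
    (squeeze_zero_norm hx hN) (Eventually.of_forall fun _ => mem_univ _) hv
  simpa only [add_sub_cancel] using this

/-- Limits of normalized differences of solutions solve the linearized problem. -/
theorem isLinearSolution_of_tendsto (hT : 0 < T) (hOm : IsOpen Om) (hh : IntegratorCondition T h)
    (hp : IsPolar T h μ σ) (hf : CaratheodoryCondition T Lam Om f)
    (hdf : DiffConditionF T Lam Om f) (hdg : DiffConditionG T Om g h) {x₀ : ℝ → Vec n} {ρ : ℝ}
    (hx₀ : TrivialBranch T Lam Om f g h x₀ ρ) (hdiff : DiffUniformCondition T Lam Om f g h)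
    {lam₀ : ℝ} (hlam₀ : lam₀ ∈ Lam) {lam : ℕ → ℝ} (hlam : ∀ k, lam k ∈ Lam)
    (hlim : Tendsto lam atTop (𝓝 lam₀)) {x : ℕ → ℝ → Vec n} (hxB : ∀ k, MemBall T x₀ ρ (x k))
    (hxS : ∀ k, IsPeriodicSolution T Om f g h (lam k) (x k)) {N : ℕ → ℝ} (hN0 : ∀ k, 0 < N k)
    (hN : Tendsto N atTop (𝓝 0)) (hxN : ∀ k, ∀ t ∈ Icc 0 T, ‖x k t - x₀ t‖ ≤ N k)
    {z : ℝ → Vec n} (hzr : RegulatedOn z 0 T)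
    (hz : ∀ t ∈ Icc 0 T, Tendsto (fun k => (N k)⁻¹ • (x k t - x₀ t)) atTop (𝓝 (z t))) :
    IsLinearSolution T (fun τ => fx f lam₀ (x₀ τ) τ) (fun τ => gx g (x₀ τ) τ) h (fun _ => 0) z := by
  have := hp.finite
  obtain ⟨θ, hθi, hθ⟩ := hdf.2.2
  obtain ⟨C, hC⟩ := hdg.2.1
  obtain ⟨γ, hγ, hmod⟩ := hdiff.exists_modulus
  have h0 : (0 : ℝ) ∈ Icc 0 T := ⟨le_rfl, hT.le⟩
  have hTT : T ∈ Icc 0 T := ⟨hT.le, le_rfl⟩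
  have hx₀S : IsPeriodicSolution T Om f g h lam₀ x₀ := hx₀.2.1 lam₀ hlam₀
  have hx₀O := hx₀S.1.2.2.1
  have hseg : ∀ k, ∀ t ∈ Icc 0 T, segment ℝ (x₀ t) (x k t) ⊆ Om := fun k =>
    hx₀.segment_subset (hxB k)
  have hc : ∀ k, ∀ t ∈ Icc 0 T, ‖(N k)⁻¹ • (x k t - x₀ t)‖ ≤ 1 := by
    intro k t ht
    rw [norm_smul, norm_inv, Real.norm_eq_abs, abs_of_pos (hN0 k), inv_mul_le_one₀ (hN0 k)]
    exact hxN k t ht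
  have hq := fun k => exists_quotient_eq hT hh hp hdf hdg hθ hC (hlam k) (hx₀.2.1 _ (hlam k)).1
    (hxS k).1 (hseg k) (hc k)
  have ha : ∀ k, ∀ r ∈ Icc 0 T, ‖(N k)⁻¹ • (f lam₀ (x k r) r - f lam₀ (x₀ r) r)‖ ≤ θ r :=
    fun k r hr => norm_smul_image_sub_le (F := fun w => f lam₀ w r)
      (fun w hw => hdf.1 lam₀ hlam₀ w (hseg k r hr hw) r hr)
      (fun w hw => hθ lam₀ hlam₀ w (hseg k r hr hw) r hr) (hc k r hr)
  have ham : ∀ k, AEStronglyMeasurable (fun r => (N k)⁻¹ • (f lam₀ (x k r) r - f lam₀ (x₀ r) r))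
      (volume.restrict (Ioc 0 T)) := fun k =>
    (((hf.aemeasurable_comp hT hlam₀ (hxS k).1.2.1 (hxS k).1.2.2.1).sub
      (hf.aemeasurable_comp hT hlam₀ hx₀S.1.2.1 hx₀O)).const_smul (N k)⁻¹).aestronglyMeasurable
  have hal : ∀ r ∈ Icc 0 T, Tendsto (fun k => (N k)⁻¹ • (f lam₀ (x k r) r - f lam₀ (x₀ r) r)) atTop
      (𝓝 (fx f lam₀ (x₀ r) r (z r))) := fun r hr =>
    tendsto_quotient (F := fun w => f lam₀ w r) (hdf.1 lam₀ hlam₀ _ (hx₀O r hr) r hr) hN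
      (fun k => hxN k r hr) (hz r hr)
  have hbl : ∀ r ∈ Icc 0 T, Tendsto (fun k => (N k)⁻¹ • (g (x k r) r - g (x₀ r) r)) atTop
      (𝓝 (gx g (x₀ r) r (z r))) := fun r hr =>
    tendsto_quotient (F := fun w => g w r) (hdg.1 _ (hx₀O r hr) r hr) hN
      (fun k => hxN k r hr) (hz r hr)
  have hAz : IntegrableOn (fun r => fx f lam₀ (x₀ r) r (z r)) (Ioc 0 T) := by
    refine Integrable.mono' (hθi.mono_set Ioc_subset_Icc_self)
      (aestronglyMeasurable_of_tendsto_ae atTop ham ?_) ?_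
    all_goals filter_upwards [ae_restrict_mem measurableSet_Ioc] with r hr
    · exact hal r (Ioc_subset_Icc_self hr)
    · exact le_of_tendsto (hal r (Ioc_subset_Icc_self hr)).norm
        (Eventually.of_forall fun k => ha k r (Ioc_subset_Icc_self hr))
  -- Measurability of the limit integrand is inherited from the difference quotients, so
  -- measurability of the differential of g along x₀ is never needed.
  have hBz : IntegrableOn (fun r => gx g (x₀ r) r (z r)) (Ico 0 T) μ := by
    refine Integrable.of_bound (aestronglyMeasurable_of_tendsto_ae atTop
      (fun k => (hq k).2.2.1.aestronglyMeasurable) ?_) C ?_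
    all_goals filter_upwards [ae_restrict_mem measurableSet_Ico] with r hr
    · exact hbl r (Ico_subset_Icc_self hr)
    · exact le_of_tendsto (hbl r (Ico_subset_Icc_self hr)).norm
        (Eventually.of_forall fun k => (hq k).2.2.2.1 r (Ico_subset_Icc_self hr))
  have hAlim : ∀ t ∈ Icc 0 T, Tendsto (fun k => ∫ r in (0 : ℝ)..t,
      (N k)⁻¹ • (f lam₀ (x k r) r - f lam₀ (x₀ r) r)) atTop
      (𝓝 (∫ r in (0 : ℝ)..t, fx f lam₀ (x₀ r) r (z r))) := by
    intro t ht
    have hsub : Ioc 0 t ⊆ Icc 0 T := fun r hr => ⟨hr.1.le, hr.2.trans ht.2⟩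
    refine intervalIntegral.tendsto_integral_filter_of_dominated_convergence θ
      (Eventually.of_forall fun k => ?_) (Eventually.of_forall fun k =>
        Eventually.of_forall fun r hr => ?_) ?_ (Eventually.of_forall fun r hr => ?_)
    · rw [uIoc_of_le ht.1]
      exact (ham k).mono_measure (Measure.restrict_mono (Ioc_subset_Ioc_right ht.2) le_rfl)
    · rw [uIoc_of_le ht.1] at hr
      exact ha k r (hsub hr)
    · exact (intervalIntegrable_iff_integrableOn_Ioc_of_le ht.1).2 (hθi.mono_set hsub)
    · rw [uIoc_of_le ht.1] at hr
      exact hal r (hsub hr)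
  have hBlim : ∀ t ∈ Icc 0 T, Tendsto (fun k => ∫ r in Ico 0 t,
      σ r • (N k)⁻¹ • (g (x k r) r - g (x₀ r) r) ∂μ) atTop
      (𝓝 (∫ r in Ico 0 t, σ r • gx g (x₀ r) r (z r) ∂μ)) := by
    intro t ht
    have hsub : Ico 0 t ⊆ Icc 0 T := fun r hr => ⟨hr.1, hr.2.le.trans ht.2⟩
    refine tendsto_integral_of_dominated_convergence (fun _ => C) (fun k => ?_)
      (integrable_const C) (fun k => ?_) ?_
    · exact ((hp.integrableOn_smul (hq k).2.2.1).mono_set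
        (Ico_subset_Ico_right ht.2)).aestronglyMeasurable
    all_goals filter_upwards [ae_restrict_mem measurableSet_Ico] with r hr
    · rw [hp.norm_smul]
      exact (hq k).2.2.2.1 r (hsub hr)
    · exact (hbl r (hsub hr)).const_smul (σ r)
  -- Cost of freezing the parameter at λ₀. Regrouped, it is N⁻¹ times the integral of a mixed
  -- difference in λ and x, which is at most a small ε' times (γ(t) - γ(0)) N; the factor N cancels.
  have hrem : ∀ t ∈ Icc 0 T, Tendsto (fun k => (∫ r in (0 : ℝ)..t,
      (N k)⁻¹ • (f (lam k) (x k r) r - f (lam k) (x₀ r) r)) - ∫ r in (0 : ℝ)..t,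
      (N k)⁻¹ • (f lam₀ (x k r) r - f lam₀ (x₀ r) r)) atTop (𝓝 0) := by
    intro t ht
    rcases ht.1.eq_or_lt with rfl | ht0
    · simp
    have hγt : 0 ≤ γ t - γ 0 := sub_nonneg.2 (hγ h0 ht ht.1)
    rw [Metric.tendsto_atTop']
    intro ε hε
    obtain ⟨δ, hδ, hmod⟩ := hmod (ε / (γ t - γ 0 + 1)) (by positivity)
    obtain ⟨K, hK⟩ := eventually_atTop.1 (hlim.eventually (Metric.ball_mem_nhds lam₀ hδ))
    refine ⟨K, fun k hk => ?_⟩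
    have hle := norm_integral_comp_sub_le hOm hf hdf hlam₀ (hlam k) (by positivity) hγ
      (hmod _ (hlam k) _ hlam₀ (hK k hk.le)) hx₀S.1.2.1 (hxS k).1.2.1 (hseg k) (hxN k) ht0 ht.2
    have hI : ∀ {l : ℝ}, l ∈ Lam → ∀ {y : ℝ → Vec n}, (∀ t ∈ Ioc 0 T,
        ContinuousWithinAt y (Iic t) t) → (∀ t ∈ Icc 0 T, y t ∈ Om) →
        IntervalIntegrable (fun r => f l (y r) r) volume 0 t := fun hl y hy hyO =>
      hf.intervalIntegrable hl le_rfl ht.1 ht.2 ((hf.aemeasurable_comp hT hl hy hyO).mono_measure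
        (Measure.restrict_mono (Ioc_subset_Ioc_right ht.2) le_rfl))
        fun r hr => hyO r ⟨hr.1.le, hr.2.trans ht.2⟩
    have e : (∫ r in (0 : ℝ)..t, (N k)⁻¹ • (f (lam k) (x k r) r - f (lam k) (x₀ r) r)) -
        ∫ r in (0 : ℝ)..t, (N k)⁻¹ • (f lam₀ (x k r) r - f lam₀ (x₀ r) r) =
        (N k)⁻¹ • ∫ r in (0 : ℝ)..t, ((f (lam k) (x k r) r - f lam₀ (x k r) r) -
          (f (lam k) (x₀ r) r - f lam₀ (x₀ r) r)) := by
      have i1 := hI (hlam k) (hxS k).1.2.1 (hxS k).1.2.2.1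
      have i2 := hI hlam₀ (hxS k).1.2.1 (hxS k).1.2.2.1
      have i3 := hI (hlam k) hx₀S.1.2.1 hx₀O
      have i4 := hI hlam₀ hx₀S.1.2.1 hx₀O
      rw [intervalIntegral.integral_smul, intervalIntegral.integral_smul, ← smul_sub,
        ← intervalIntegral.integral_sub (i1.sub i3) (i2.sub i4)]
      congr 2
      funext r
      abel
    rw [dist_zero_right, e, norm_smul, norm_inv, Real.norm_eq_abs, abs_of_pos (hN0 k),
      inv_mul_lt_iff₀ (hN0 k)]
    refine hle.trans_lt ?_
    rw [mul_comm (N k) ε]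
    refine mul_lt_mul_of_pos_right ?_ (hN0 k)
    rw [div_mul_eq_mul_div, div_lt_iff₀ (by positivity)]
    nlinarith
  have hzeq : ∀ t ∈ Icc 0 T, z t = z 0 + (∫ r in (0 : ℝ)..t, fx f lam₀ (x₀ r) r (z r)) +
      ∫ r in Ico 0 t, σ r • gx g (x₀ r) r (z r) ∂μ := by
    intro t ht
    have hsum := ((hz 0 h0).add ((hrem t ht).add (hAlim t ht))).add (hBlim t ht)
    rw [zero_add] at hsum
    refine tendsto_nhds_unique (hz t ht) (hsum.congr fun k => ?_)
    rw [sub_add_cancel, (hq k).2.2.2.2 t ht]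
  have hzT : z 0 = z T := by
    refine tendsto_nhds_unique (hz 0 h0) ((hz T hTT).congr fun k => ?_)
    rw [(hxS k).2, hx₀S.2]
  refine ⟨hzr, fun t ht => ⟨_, _, hasKSIntegral_id hAz ht, hp.hasKSIntegral hBz ht, ?_⟩⟩
  change _ = (0 : Vec n)
  rw [← hzT, hzeq t ht]
  abel

/-- The linearized problem at a bifurcation point has a nontrivial solution. -/
theorem exists_isLinearSolution (hT : 0 < T) (hOm : IsOpen Om) (hh : IntegratorCondition T h)
    (hp : IsPolar T h μ σ) (hf : CaratheodoryCondition T Lam Om f)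
    (hdf : DiffConditionF T Lam Om f) (hdg : DiffConditionG T Om g h) {x₀ : ℝ → Vec n} {ρ : ℝ}
    (hx₀ : TrivialBranch T Lam Om f g h x₀ ρ) (hdiff : DiffUniformCondition T Lam Om f g h)
    {lam₀ : ℝ} (hbif : IsBifurcationPoint T Lam Om f g h ρ x₀ lam₀) :
    ∃ z : ℝ → Vec n, IsLinearSolution T (fun τ => fx f lam₀ (x₀ τ) τ)
      (fun τ => gx g (x₀ τ) τ) h (fun _ => 0) z ∧ ∃ t ∈ Icc 0 T, z t ≠ 0 := by
  have := hp.finite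
  obtain ⟨θ, hθi, hθ⟩ := hdf.2.2
  obtain ⟨C, hC⟩ := hdg.2.1
  have h0 : (0 : ℝ) ∈ Icc 0 T := ⟨le_rfl, hT.le⟩
  obtain ⟨lam, x, N, hlam, hlim, hxB, hxS, hN0, hN, hxN, hxt⟩ := hbif.exists_seq
  have hnorm : ∀ k (v : Vec n), ‖(N k)⁻¹ • v‖ = (N k)⁻¹ * ‖v‖ := fun k v => by
    rw [norm_smul, norm_inv, Real.norm_eq_abs, abs_of_pos (hN0 k)]
  have hc : ∀ k, ∀ t ∈ Icc 0 T, ‖(N k)⁻¹ • (x k t - x₀ t)‖ ≤ 1 := by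
    intro k t ht
    rw [hnorm, inv_mul_le_one₀ (hN0 k)]
    exact hxN k t ht
  -- The mean value inequality bounds the normalized differences of f by θ and those of g by C, so Γ
  -- controls all increments uniformly in k.
  let Γ : ℝ → ℝ := fun t => (∫ r in (0 : ℝ)..t, θ r) + C * μ.real (Ico 0 t)
  have hθ' : ∀ s t, 0 ≤ s → s ≤ t → t ≤ T → IntervalIntegrable θ volume s t :=
    fun s t hs hst ht => (intervalIntegrable_iff_integrableOn_Ioc_of_le hst).2
      (hθi.mono_set fun r hr => ⟨hs.trans hr.1.le, hr.2.trans ht⟩)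
  have hΓ : ∀ k s t, 0 ≤ s → s ≤ t → t ≤ T →
      ‖(N k)⁻¹ • (x k t - x₀ t) - (N k)⁻¹ • (x k s - x₀ s)‖ ≤ Γ t - Γ s := by
    intro k s t hs hst ht
    obtain ⟨hai, hab, hbi, hbb, he⟩ := exists_quotient_eq hT hh hp hdf hdg hθ hC (hlam k)
      (hx₀.2.1 _ (hlam k)).1 (hxS k).1 (hx₀.segment_subset (hxB k)) (hc k)
    have hai' : ∀ u v, 0 ≤ u → u ≤ v → v ≤ T → IntervalIntegrable
        (fun r => (N k)⁻¹ • (f (lam k) (x k r) r - f (lam k) (x₀ r) r)) volume u v :=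
      fun u v hu huv hv => (intervalIntegrable_iff_integrableOn_Ioc_of_le huv).2
        (hai.mono_set (Ioc_subset_Ioc hu hv))
    rw [he t ⟨hs.trans hst, ht⟩, he s ⟨hs, hst.trans ht⟩, add_sub_add_comm, add_sub_add_left_eq_sub,
      intervalIntegral.integral_interval_sub_left (hai' 0 t le_rfl (hs.trans hst) ht)
        (hai' 0 s le_rfl hs (hst.trans ht)),
      setIntegral_Ico_sub (hp.integrableOn_smul hbi) hs hst ht]
    have e : Γ t - Γ s = (∫ r in s..t, θ r) + C * μ.real (Ico s t) := by
      rw [← intervalIntegral.integral_interval_sub_left (hθ' 0 t le_rfl (hs.trans hst) ht)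
        (hθ' 0 s le_rfl hs (hst.trans ht)), ← measureReal_Ico_sub hs hst]
      simp only [Γ]
      ring
    rw [e]
    refine (norm_add_le _ _).trans (add_le_add ?_ ?_)
    · refine intervalIntegral.norm_integral_le_of_norm_le hst (Eventually.of_forall fun r hr => ?_)
        (hθ' s t hs hst ht)
      exact hab r ⟨hs.trans hr.1.le, hr.2.trans ht⟩
    · refine norm_setIntegral_le_of_norm_le_const (measure_lt_top _ _) fun r hr => ?_
      rw [hp.norm_smul]
      exact hbb r ⟨hs.trans hr.1, hr.2.le.trans ht⟩
  obtain ⟨φ, hφ, w, hw, hu⟩ := exists_subseq_tendstoUniformlyOn hT.le hΓ hc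
  have hΓm : MonotoneOn Γ (Icc 0 T) := fun s hs t ht hst =>
    sub_nonneg.1 ((norm_nonneg _).trans (hΓ 0 s t hs.1 hst ht.2))
  refine ⟨fun t => w (Γ t), isLinearSolution_of_tendsto hT hOm hh hp hf hdf hdg hx₀ hdiff hbif.2.1
    (fun k => hlam (φ k)) (hlim.comp hφ.tendsto_atTop) (fun k => hxB (φ k)) (fun k => hxS (φ k))
    (fun k => hN0 (φ k)) (hN.comp hφ.tendsto_atTop) (fun k => hxN (φ k))
    (regulatedOn_comp_monotoneOn hT.le hw hΓm) fun t ht => hu.tendsto_at ht, ?_⟩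
  -- At some t the k-th quotient has norm above 1/2, while uniformly it lies within 1/2 of the
  -- limit, which therefore cannot vanish at t.
  obtain ⟨k, hk⟩ := (Metric.tendstoUniformlyOn_iff.1 hu (1 / 2) (by norm_num)).exists
  obtain ⟨t, ht, hlt⟩ := hxt (φ k)
  refine ⟨t, ht, fun hzero => ?_⟩
  have := hk t ht
  rw [show w (Γ t) = 0 from hzero, dist_zero_left, hnorm, inv_mul_lt_iff₀ (hN0 _)] at this
  linarith

/-- Because ρ > 0, the shifted functions x₀ + sv stay in the ball for small s and hence take values
in Ω, so the differential along x₀ is a limit of measurable difference quotients. -/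
lemma TrivialBranch.aestronglyMeasurable_fx (hT : 0 < T) (hf : CaratheodoryCondition T Lam Om f)
    (hdf : DiffConditionF T Lam Om f) {x₀ : ℝ → Vec n} {ρ : ℝ} (hρ : 0 < ρ)
    (hx₀ : TrivialBranch T Lam Om f g h x₀ ρ) {lam₀ : ℝ} (hlam₀ : lam₀ ∈ Lam) :
    AEStronglyMeasurable (fun τ => fx f lam₀ (x₀ τ) τ) (volume.restrict (Ioc 0 T)) := by
  have hx₀S := (hx₀.2.1 lam₀ hlam₀).1
  refine aestronglyMeasurable_of_hasFDerivAt (F := f lam₀) (y := x₀) ?_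
    (hf.aemeasurable_comp hT hlam₀ hx₀S.2.1 hx₀S.2.2.1) fun v => ?_
  · filter_upwards [ae_restrict_mem measurableSet_Ioc] with r hr
    have hr' := Ioc_subset_Icc_self hr
    exact (hdf.1 lam₀ hlam₀ _ (hx₀S.2.2.1 r hr') r hr').hasFDerivAt
  · have hlim : Tendsto (fun s : ℝ => ‖s • v‖) (𝓝 0) (𝓝 0) := by
      have : Continuous fun s : ℝ => ‖s • v‖ := by fun_prop
      simpa using this.tendsto 0
    filter_upwards [hlim.eventually (gt_mem_nhds hρ)] with s hs
    refine hf.aemeasurable_comp hT hlam₀ (x := fun r => x₀ r + s • v)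
      (fun t ht => (hx₀S.2.1 t ht).add continuousWithinAt_const)
      (hx₀.2.2 _ ⟨hx₀.1.add (regulatedOn_const _), fun t _ => ?_⟩)
    rw [add_sub_cancel_left]
    exact hs.le

end MeasureDE

/-! ### Conclusion -/

theorem mainTheorem3 {n : ℕ} (T : ℝ) (hT : 0 < T)
    (Lam : Set ℝ) (hLam : IsOpen Lam)
    (Om : Set (MeasureDE.Vec n)) (hOm : IsOpen Om)
    (f : ℝ → MeasureDE.Vec n → ℝ → MeasureDE.Vec n)
    (g : MeasureDE.Vec n → ℝ → MeasureDE.Vec n)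
    (h : ℝ → ℝ)
    (hh : MeasureDE.IntegratorCondition T h)
    (hf : MeasureDE.CaratheodoryCondition T Lam Om f)
    (hg : MeasureDE.StieltjesCondition T Om g h)
    (hdf : MeasureDE.DiffConditionF T Lam Om f)
    (hdg : MeasureDE.DiffConditionG T Om g h)
    (x₀ : ℝ → MeasureDE.Vec n) (ρ : ℝ) (hρ : 0 < ρ)
    (hx₀ : MeasureDE.TrivialBranch T Lam Om f g h x₀ ρ)
    (hpar : MeasureDE.ParameterCondition T Lam Om f)
    (hdiff : MeasureDE.DiffUniformCondition T Lam Om f g h)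
    (lam₀ : ℝ)
    (hbif : MeasureDE.IsBifurcationPoint T Lam Om f g h ρ x₀ lam₀) :
    (∃ q : ℝ → MeasureDE.Vec n, MeasureDE.RegulatedOn q 0 T ∧
      ¬ ∃ z : ℝ → MeasureDE.Vec n,
        MeasureDE.IsLinearSolution T (fun τ => MeasureDE.fx f lam₀ (x₀ τ) τ)
          (fun τ => MeasureDE.gx g (x₀ τ) τ) h q z) ∧
    (∃ z : ℝ → MeasureDE.Vec n,
      MeasureDE.IsLinearSolution T (fun τ => MeasureDE.fx f lam₀ (x₀ τ) τ)
        (fun τ => MeasureDE.gx g (x₀ τ) τ) h (fun _ => 0) z ∧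
      ∃ t ∈ Set.Icc 0 T, z t ≠ 0) := by
  obtain ⟨μ, σ, hp⟩ := hh.exists_isPolar hT.le
  obtain ⟨θ, hθi, hθ⟩ := hdf.2.2
  obtain ⟨C, hC⟩ := hdg.2.1
  have hx₀O := (hx₀.2.1 lam₀ hbif.2.1).1.2.2.1
  obtain ⟨z, hz, hne⟩ := MeasureDE.exists_isLinearSolution hT hOm hh hp hf hdf hdg hx₀ hdiff hbif
  obtain ⟨c, hc⟩ := MeasureDE.exists_const_not_solvable hT hh hp
    (hx₀.aestronglyMeasurable_fx hT hf hdf hρ hbif.2.1) hθi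
    (fun t ht => hθ lam₀ hbif.2.1 _ (hx₀O t ht) t ht) (fun t ht => hC _ (hx₀O t ht) t ht) hz hne
  exact ⟨⟨fun _ => c, MeasureDE.regulatedOn_const c, hc⟩, z, hz, hne⟩
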